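/- Let $N\ge 3$ and let $p,q>0$ satisfy $\frac1p+\frac1q=\frac{N-2}{N}$; put $q'=\frac{q}{q-1}$. Let $$D^{2,q'}(\mathbb R^N)=\{u\in L^p(\mathbb R^N): u \text{ is twice weakly differentiable},\ \Delta u\in L^{q'}(\mathbb R^N)\},\qquad \|u\|_{q'}=\Big(\int_{\mathbb R^N}|\Delta u|^{q'}\Big)^{1/q'},$$ and for $u,w\in D^{2,q'}(\mathbb R^N)$ let $$J'(u)w=\int_{\mathbb R^N}|\Delta u|^{q'-2}\Delta u\,\Delta w-\int_{\mathbb R^N}|u|^{p-2}u\,w,$$ which is the derivative of $J(u)=\frac1{q'}\int_{\mathbb R^N}|\Delta u|^{q'}-\frac1p\int_{\mathbb R^N}|u|^p$. Let $G$ be a closed subgroup of the orthogonal group $O(N)$ and $\phi:G\to\{1,-1\}$ a continuous group homomorphism. A function $u$ is called $\phi$-equivariant if $u(gx)=\phi(g)u(x)$ for all $g\in G$ and all $x$ (for each $g$ and almost every $x$, if $u\in D^{2,q'}(\mathbb R^N)$), and $G$-invariant if $u(gx)=u(x)$ for all $g\in G$ and all $x$. Denote by $D^{2,q'}(\mathbb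 R^N)^\phi$ the set of $\phi$-equivariant elements of $D^{2,q'}(\mathbb R^N)$. Let $\Theta\subset\mathbb R^N$ be a $G$-invariant open set (for instance a $G$-invariant smooth domain, not necessarily bounded), and denote by $C_c^\infty(\Theta)^\phi$ and $C_c^\infty(\Theta)^G$ the sets of $\phi$-equivariant and of $G$-invariant functions in $C_c^\infty(\Theta)$, extended by zero to $\mathbb R^N$. Let $v_k,v\in D^{2,q'}(\mathbb R^N)^\phi$ be such that $v_k\rightharpoonup v$ weakly in $D^{2,q'}(\mathbb R^N)$. Assume that $$\lim_{k\to\infty}J'(v_k)\varphi=0\qquad\text{and}\qquad\lim_{k\to\infty}J'(v_k)[\psi(v_k-v)]=0$$ for every $\varphi\in C_c^\infty(\Theta)^\phi$ and every $\psi\in C_c^\infty(\Theta)^G$. Then $J'(v)\varphi=0$ for every $\varphi\in C_c^\infty(\Theta)^\phi$. -/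

import Mathlib

open MeasureTheory Filter Topology

noncomputable section

namespace LaneEmden

/-- The Euclidean space `ℝᴺ`. -/
abbrev Space (N : ℕ) : Type := EuclideanSpace ℝ (Fin N)

/-- `g` is the weak partial derivative `∂ᵢ u` on `ℝᴺ`: both functions are locally integrable and
`∫ u ∂ᵢη = - ∫ g η` for every test function `η`. -/
def HasWeakPartial {N : ℕ} (i : Fin N) (u g : Space N → ℝ) : Prop :=
  LocallyIntegrable u volume ∧ LocallyIntegrable g volume ∧
    ∀ η : Space N → ℝ, ContDiff ℝ (⊤ : ℕ∞) η → HasCompactSupport η →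
      ∫ x, u x * fderiv ℝ η x (EuclideanSpace.single i (1 : ℝ)) = - ∫ x, g x * η x

open Classical in
/-- A choice of the weak partial derivative `∂ᵢ u` (unique up to a null set, see
`HasWeakPartial.weakPartial_ae_eq`), with the value `0` when `u` has none. -/
def weakPartial {N : ℕ} (i : Fin N) (u : Space N → ℝ) : Space N → ℝ :=
  if h : ∃ g, HasWeakPartial i u g then h.choose else 0

/-- `u` is twice weakly differentiable: all weak partial derivatives of first and second order
exist. -/
def TwiceWeaklyDifferentiable {N : ℕ} (u : Space N → ℝ) : Prop :=
  ∀ i, ∃ g, HasWeakPartial i u g ∧ ∀ j, ∃ h, HasWeakPartial j g h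

/-- The weak Laplacian `Δu = ∑ᵢ ∂ᵢ∂ᵢ u`. -/
def weakLaplacian {N : ℕ} (u : Space N → ℝ) : Space N → ℝ :=
  fun x => ∑ i, weakPartial i (weakPartial i u) x

section Basic

variable {N : ℕ} {i : Fin N} {u u' v g g' h : Space N → ℝ}

theorem HasWeakPartial.congr (H : HasWeakPartial i u g) (hu : u =ᵐ[volume] u')
    (hg : g =ᵐ[volume] g') : HasWeakPartial i u' g' := by
  obtain ⟨h1, h2, h3⟩ := H
  refine ⟨h1.congr hu, h2.congr hg, fun η hη hc => ?_⟩
  have e1 : ∫ x, u' x * fderiv ℝ η x (EuclideanSpace.single i (1 : ℝ)) =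
      ∫ x, u x * fderiv ℝ η x (EuclideanSpace.single i (1 : ℝ)) :=
    integral_congr_ae (by filter_upwards [hu] with x hx; rw [hx])
  have e2 : ∫ x, g' x * η x = ∫ x, g x * η x :=
    integral_congr_ae (by filter_upwards [hg] with x hx; rw [hx])
  rw [e1, e2]
  exact h3 η hη hc

theorem HasWeakPartial.unique (H : HasWeakPartial i u g) (H' : HasWeakPartial i u g') :
    g =ᵐ[volume] g' := by
  refine ae_eq_of_integral_contDiff_smul_eq H.2.1 H'.2.1 fun η hη hc => ?_
  have := (H.2.2 η hη hc).symm.trans (H'.2.2 η hη hc)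
  simpa [mul_comm] using this

theorem HasWeakPartial.weakPartial_ae_eq (H : HasWeakPartial i u g) :
    weakPartial i u =ᵐ[volume] g := by
  have hex : ∃ g, HasWeakPartial i u g := ⟨g, H⟩
  have : HasWeakPartial i u (weakPartial i u) := by
    rw [weakPartial, dif_pos hex]
    exact hex.choose_spec
  exact this.unique H

theorem integrable_mul_fderiv (hu : LocallyIntegrable u volume) {η : Space N → ℝ}
    (hη : ContDiff ℝ (⊤ : ℕ∞) η) (hc : HasCompactSupport η) :
    Integrable (fun x => u x * fderiv ℝ η x (EuclideanSpace.single i (1 : ℝ))) := by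
  have hcont : Continuous fun x => fderiv ℝ η x (EuclideanSpace.single i (1 : ℝ)) :=
    (hη.continuous_fderiv (by simp)).clm_apply continuous_const
  have hcs : HasCompactSupport fun x => fderiv ℝ η x (EuclideanSpace.single i (1 : ℝ)) :=
    hc.fderiv_apply ℝ _
  simpa [mul_comm] using hu.integrable_smul_left_of_hasCompactSupport hcont hcs

theorem integrable_mul_test (hu : LocallyIntegrable u volume) {η : Space N → ℝ}
    (hη : ContDiff ℝ (⊤ : ℕ∞) η) (hc : HasCompactSupport η) :
    Integrable (fun x => u x * η x) := by
  simpa [mul_comm] using hu.integrable_smul_left_of_hasCompactSupport hη.continuous hc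

theorem HasWeakPartial.add (H : HasWeakPartial i u g) (H' : HasWeakPartial i v h) :
    HasWeakPartial i (u + v) (g + h) := by
  refine ⟨H.1.add H'.1, H.2.1.add H'.2.1, fun η hη hc => ?_⟩
  simp only [Pi.add_apply, add_mul]
  rw [integral_add (integrable_mul_fderiv H.1 hη hc) (integrable_mul_fderiv H'.1 hη hc),
    integral_add (integrable_mul_test H.2.1 hη hc) (integrable_mul_test H'.2.1 hη hc),
    H.2.2 η hη hc, H'.2.2 η hη hc]
  ring

theorem HasWeakPartial.const_smul (c : ℝ) (H : HasWeakPartial i u g) :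
    HasWeakPartial i (c • u) (c • g) := by
  refine ⟨H.1.smul c, H.2.1.smul c, fun η hη hc => ?_⟩
  simp only [Pi.smul_apply, smul_eq_mul, mul_assoc]
  rw [integral_const_mul, integral_const_mul, H.2.2 η hη hc]
  ring

theorem hasWeakPartial_zero : HasWeakPartial i (0 : Space N → ℝ) 0 :=
  ⟨locallyIntegrable_zero, locallyIntegrable_zero, fun η _ _ => by simp⟩

/-- For smooth functions the weak partial derivatives are the classical ones. -/
theorem hasWeakPartial_of_contDiff (hu : ContDiff ℝ (⊤ : ℕ∞) u) :
    HasWeakPartial i u fun x => fderiv ℝ u x (EuclideanSpace.single i (1 : ℝ)) := by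
  have hcont : Continuous fun x => fderiv ℝ u x (EuclideanSpace.single i (1 : ℝ)) :=
    (hu.continuous_fderiv (by simp)).clm_apply continuous_const
  refine ⟨hu.continuous.locallyIntegrable, hcont.locallyIntegrable, fun η hη hc => ?_⟩
  exact integral_mul_fderiv_eq_neg_fderiv_mul_of_integrable
    (integrable_mul_test hcont.locallyIntegrable hη hc)
    (integrable_mul_fderiv hu.continuous.locallyIntegrable hη hc)
    (integrable_mul_test hu.continuous.locallyIntegrable hη hc)
    (fun x _ => (hu.differentiable (by simp)) x)
    (fun x _ => (hη.differentiable (by simp)) x)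

theorem TwiceWeaklyDifferentiable.weakPartial (H : TwiceWeaklyDifferentiable u) (i j : Fin N) :
    HasWeakPartial i u (weakPartial i u) ∧
      HasWeakPartial j (LaneEmden.weakPartial i u)
        (LaneEmden.weakPartial j (LaneEmden.weakPartial i u)) := by
  obtain ⟨g, hg, hg2⟩ := H i
  obtain ⟨h, hh⟩ := hg2 j
  have e := hg.weakPartial_ae_eq
  have hh' := hh.congr e.symm (ae_eq_refl h)
  exact ⟨hg.congr (ae_eq_refl u) e.symm,
    hh'.congr (ae_eq_refl _) hh'.weakPartial_ae_eq.symm⟩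

theorem TwiceWeaklyDifferentiable.of_ae_eq (H : TwiceWeaklyDifferentiable u)
    (hu : u =ᵐ[volume] u') : TwiceWeaklyDifferentiable u' := fun i => by
  obtain ⟨g, hg, hg2⟩ := H i
  exact ⟨g, hg.congr hu (ae_eq_refl g), hg2⟩

theorem TwiceWeaklyDifferentiable.add (H : TwiceWeaklyDifferentiable u)
    (H' : TwiceWeaklyDifferentiable v) : TwiceWeaklyDifferentiable (u + v) := fun i => by
  exact ⟨_, (H.weakPartial i i).1.add (H'.weakPartial i i).1,
    fun j => ⟨_, (H.weakPartial i j).2.add (H'.weakPartial i j).2⟩⟩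

theorem TwiceWeaklyDifferentiable.const_smul (c : ℝ) (H : TwiceWeaklyDifferentiable u) :
    TwiceWeaklyDifferentiable (c • u) := fun i => by
  exact ⟨_, (H.weakPartial i i).1.const_smul c,
    fun j => ⟨_, (H.weakPartial i j).2.const_smul c⟩⟩

theorem twiceWeaklyDifferentiable_zero : TwiceWeaklyDifferentiable (0 : Space N → ℝ) :=
  fun _ => ⟨0, hasWeakPartial_zero, fun _ => ⟨0, hasWeakPartial_zero⟩⟩

/-- The weak Laplacian may be computed from any weak derivatives. -/
theorem weakLaplacian_ae_eq {a b : Fin N → Space N → ℝ} (ha : ∀ i, HasWeakPartial i u (a i))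
    (hb : ∀ i, HasWeakPartial i (a i) (b i)) :
    weakLaplacian u =ᵐ[volume] fun x => ∑ i, b i x := by
  have : ∀ i, LaneEmden.weakPartial i (LaneEmden.weakPartial i u) =ᵐ[volume] b i := fun i =>
    ((hb i).congr (ha i).weakPartial_ae_eq.symm (ae_eq_refl _)).weakPartial_ae_eq
  filter_upwards [ae_all_iff.2 this] with x hx
  exact Finset.sum_congr rfl fun i _ => hx i

theorem weakLaplacian_congr (H : TwiceWeaklyDifferentiable u) (hu : u =ᵐ[volume] u') :
    weakLaplacian u' =ᵐ[volume] weakLaplacian u :=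
  weakLaplacian_ae_eq (fun i => (H.weakPartial i i).1.congr hu (ae_eq_refl _))
    (fun i => (H.weakPartial i i).2)

theorem weakLaplacian_add (H : TwiceWeaklyDifferentiable u) (H' : TwiceWeaklyDifferentiable v) :
    weakLaplacian (u + v) =ᵐ[volume] weakLaplacian u + weakLaplacian v := by
  refine (weakLaplacian_ae_eq (fun i => (H.weakPartial i i).1.add (H'.weakPartial i i).1)
    (fun i => (H.weakPartial i i).2.add (H'.weakPartial i i).2)).trans (ae_of_all _ fun x => ?_)
  simp [weakLaplacian, Finset.sum_add_distrib]

theorem weakLaplacian_const_smul (c : ℝ) (H : TwiceWeaklyDifferentiable u) :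
    weakLaplacian (c • u) =ᵐ[volume] c • weakLaplacian u := by
  refine (weakLaplacian_ae_eq (fun i => (H.weakPartial i i).1.const_smul c)
    (fun i => (H.weakPartial i i).2.const_smul c)).trans (ae_of_all _ fun x => ?_)
  simp [weakLaplacian, Finset.mul_sum]

theorem weakLaplacian_zero : weakLaplacian (0 : Space N → ℝ) =ᵐ[volume] 0 := by
  refine (weakLaplacian_ae_eq (fun i => hasWeakPartial_zero)
    (fun i => hasWeakPartial_zero)).trans (ae_of_all _ fun x => ?_)
  simp

end Basic

/-- The space `D^{2,r}(ℝᴺ)` of the (classes of) functions in `L^p(ℝᴺ)` which are twice weakly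
differentiable with `Δu ∈ L^r(ℝᴺ)`, as a linear subspace of `L^p(ℝᴺ)`. It is used with
`p = Nr/(N-2r)`. -/
def D2 (N : ℕ) (p r : ℝ) : Submodule ℝ (Lp ℝ (ENNReal.ofReal p) (volume : Measure (Space N))) where
  carrier := {u | TwiceWeaklyDifferentiable (u : Space N → ℝ) ∧
    MemLp (weakLaplacian (u : Space N → ℝ)) (ENNReal.ofReal r) volume}
  add_mem' := by
    rintro u v ⟨hu, hu'⟩ ⟨hv, hv'⟩
    have e := (Lp.coeFn_add u v).symm
    refine ⟨(hu.add hv).of_ae_eq e, (hu'.add hv').ae_eq ?_⟩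
    exact ((weakLaplacian_congr (hu.add hv) e).trans (weakLaplacian_add hu hv)).symm
  zero_mem' := by
    have e := (Lp.coeFn_zero ℝ (ENNReal.ofReal p) (volume : Measure (Space N))).symm
    refine ⟨twiceWeaklyDifferentiable_zero.of_ae_eq e, MemLp.zero.ae_eq ?_⟩
    exact ((weakLaplacian_congr twiceWeaklyDifferentiable_zero e).trans weakLaplacian_zero).symm
  smul_mem' := by
    rintro c u ⟨hu, hu'⟩
    have e := (Lp.coeFn_smul c u).symm
    refine ⟨(hu.const_smul c).of_ae_eq e, (hu'.const_smul c).ae_eq ?_⟩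
    exact ((weakLaplacian_congr (hu.const_smul c) e).trans (weakLaplacian_const_smul c hu)).symm

/-- The function on `ℝᴺ` underlying an element of `D^{2,r}(ℝᴺ)`. -/
def fnD2 {N : ℕ} {p r : ℝ} (u : D2 N p r) : Space N → ℝ :=
  ((u : Lp ℝ (ENNReal.ofReal p) (volume : Measure (Space N))) : Space N → ℝ)

/-- The norm `‖u‖_r = (∫ |Δu|^r)^{1/r}` of `D^{2,r}(ℝᴺ)`. -/
def normD2 {N : ℕ} {p r : ℝ} (u : D2 N p r) : ℝ :=
  (∫ x, |weakLaplacian (fnD2 u) x| ^ r) ^ (1 / r)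

/-- `ℓ` is a bounded linear functional on `(D^{2,r}(ℝᴺ), ‖·‖_r)`. -/
def IsBoundedFunctional {N : ℕ} {p r : ℝ} (ℓ : D2 N p r →ₗ[ℝ] ℝ) : Prop :=
  ∃ C : ℝ, ∀ w, |ℓ w| ≤ C * normD2 w

/-- Weak convergence `v_k ⇀ v` in `(D^{2,r}(ℝᴺ), ‖·‖_r)`. -/
def WeaklyConverges {N : ℕ} {p r : ℝ} (v : ℕ → D2 N p r) (v₀ : D2 N p r) : Prop :=
  ∀ ℓ : D2 N p r →ₗ[ℝ] ℝ, IsBoundedFunctional ℓ →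
    Tendsto (fun k => ℓ (v k)) atTop (𝓝 (ℓ v₀))

/-- The functional `J(u) = (1/r) ∫ |Δu|^r - (1/p) ∫ |u|^p` (with `r = q'`). -/
def functionalJ {N : ℕ} (p r : ℝ) (u : Space N → ℝ) : ℝ :=
  (1 / r) * (∫ x, |weakLaplacian u x| ^ r) - (1 / p) * ∫ x, |u x| ^ p

/-- The derivative `J'(u)w = ∫ |Δu|^{r-2} Δu Δw - ∫ |u|^{p-2} u w`
(with `r = q'`), see `hasDerivAt_functionalJ`. -/
def derivJ {N : ℕ} (p r : ℝ) (u w : Space N → ℝ) : ℝ :=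
  (∫ x, |weakLaplacian u x| ^ (r - 2) * weakLaplacian u x * weakLaplacian w x) -
    ∫ x, |u x| ^ (p - 2) * u x * w x

theorem hasDerivAt_integral_abs_rpow {α : Type*} [MeasurableSpace α] {μ : Measure α} {s : ℝ}
    (hs : 1 < s) {f g : α → ℝ} (hf : MemLp f (ENNReal.ofReal s) μ)
    (hg : MemLp g (ENNReal.ofReal s) μ) :
    HasDerivAt (fun t : ℝ => (1 / s) * ∫ x, |f x + t * g x| ^ s ∂μ)
      (∫ x, |f x| ^ (s - 2) * f x * g x ∂μ) 0 := by
  have hs0 : 0 < s := by linarith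
  have key : ∀ t : ℝ, Integrable (fun x => |f x + t * g x| ^ s) μ := fun t => by
    have h := (hf.add (hg.const_mul t)).integrable_norm_rpow
      (by simpa using hs0) ENNReal.ofReal_ne_top
    simpa [ENNReal.toReal_ofReal hs0.le] using h
  have hbd : Integrable (fun x => s * (|f x| + |g x|) ^ s) μ := by
    have h := (hf.norm.add hg.norm).integrable_norm_rpow
      (by simpa using hs0) ENNReal.ofReal_ne_top
    have h2 : Integrable (fun x => (|f x| + |g x|) ^ s) μ := by
      refine h.congr (ae_of_all _ fun x => ?_)
      simp only [Pi.add_apply, Real.norm_eq_abs, ENNReal.toReal_ofReal hs0.le]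
      rw [abs_of_nonneg (by positivity)]
    exact h2.const_mul s
  have main := (hasDerivAt_integral_of_dominated_loc_of_deriv_le (μ := μ) (𝕜 := ℝ)
    (F := fun t x => |f x + t * g x| ^ s)
    (F' := fun t x => s * |f x + t * g x| ^ (s - 2) * (f x + t * g x) * g x)
    (x₀ := 0) (s := Metric.ball 0 1) (bound := fun x => s * (|f x| + |g x|) ^ s)
    (Metric.ball_mem_nhds _ one_pos)
    (Eventually.of_forall fun t => (key t).aestronglyMeasurable) (key 0) ?_ ?_ hbd ?_).2
  · have := main.const_mul (1 / s)
    have e : (1 / s) * ∫ x, s * |f x + 0 * g x| ^ (s - 2) * (f x + 0 * g x) * g x ∂μ =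
        ∫ x, |f x| ^ (s - 2) * f x * g x ∂μ := by
      rw [← integral_const_mul]
      refine integral_congr_ae (ae_of_all _ fun x => ?_)
      simp only [zero_mul, add_zero]
      field_simp
    rwa [e] at this
  · have hf' := hf.aestronglyMeasurable.aemeasurable
    have hg' := hg.aestronglyMeasurable.aemeasurable
    simp only [zero_mul, add_zero]
    refine AEMeasurable.aestronglyMeasurable ?_
    have habs : AEMeasurable (fun x => |f x|) μ := by
      simpa [Real.norm_eq_abs] using hf'.norm
    exact (((habs.pow_const _).const_mul s).mul hf').mul hg'
  · refine ae_of_all _ fun x t ht => ?_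
    have ht' : |t| ≤ 1 := by simpa using (Metric.mem_ball.1 ht).le
    have hy : |f x + t * g x| ≤ |f x| + |g x| := by
      refine (abs_add_le _ _).trans (add_le_add le_rfl ?_)
      rw [abs_mul]
      exact mul_le_of_le_one_left (abs_nonneg _) ht'
    set y := f x + t * g x
    have h1 : |y| ^ (s - 2) * |y| = |y| ^ (s - 1) := by
      rcases eq_or_lt_of_le (abs_nonneg y) with h0 | h0
      · rw [← h0, Real.zero_rpow (by linarith : s - 1 ≠ 0)]
        simp
      · rw [← Real.rpow_add_one h0.ne']
        congr 1
        ring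
    have h2 : (|f x| + |g x|) ^ (s - 1) * (|f x| + |g x|) = (|f x| + |g x|) ^ s := by
      rcases eq_or_lt_of_le (show 0 ≤ |f x| + |g x| by positivity) with h0 | h0
      · rw [← h0, Real.zero_rpow hs0.ne']
        simp
      · rw [← Real.rpow_add_one h0.ne']
        congr 1
        ring
    rw [Real.norm_eq_abs, abs_mul, abs_mul, abs_mul, abs_of_pos hs0,
      abs_of_nonneg (Real.rpow_nonneg (abs_nonneg y) _), mul_assoc s, h1, mul_assoc, ← h2]
    gcongr
    have := abs_nonneg (f x)
    linarith
  · refine ae_of_all _ fun x t _ => ?_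
    have h1 : HasDerivAt (fun t : ℝ => f x + t * g x) (g x) t := by
      simpa using ((hasDerivAt_id t).mul_const (g x)).const_add (f x)
    exact (hasDerivAt_abs_rpow (f x + t * g x) hs).comp t h1

/-- `derivJ` is the directional derivative of `J` on `D^{2,r}(ℝᴺ)`. -/
theorem hasDerivAt_functionalJ {N : ℕ} {p r : ℝ} (hp : 1 < p) (hr : 1 < r) (u w : D2 N p r) :
    HasDerivAt (fun t : ℝ => functionalJ p r (fnD2 (u + t • w))) (derivJ p r (fnD2 u) (fnD2 w)) 0 := by
  have e : ∀ t : ℝ, ((fnD2 u) + t • (fnD2 w)) =ᵐ[volume] (fnD2 (u + t • w)) := fun t => by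
    have h1 := Lp.coeFn_add (u : Lp ℝ (ENNReal.ofReal p) (volume : Measure (Space N))) (t • w)
    have h2 := Lp.coeFn_smul t (w : Lp ℝ (ENNReal.ofReal p) (volume : Measure (Space N)))
    filter_upwards [h1, h2] with x hx1 hx2
    have : (fnD2 (u + t • w)) x = (fnD2 u) x + t * (fnD2 w) x := by
      refine hx1.trans ?_
      rw [Pi.add_apply, hx2]
      rfl
    simp [this]
  have hu := u.2.1
  have hw := w.2.1
  have e2 : ∀ t : ℝ, weakLaplacian (fnD2 (u + t • w)) =ᵐ[volume]
      weakLaplacian (fnD2 u) + t • weakLaplacian (fnD2 w) := fun t =>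
    (weakLaplacian_congr (hu.add (hw.const_smul t)) (e t)).trans
      ((weakLaplacian_add hu (hw.const_smul t)).trans
        ((ae_eq_refl _).add (weakLaplacian_const_smul t hw)))
  have := (hasDerivAt_integral_abs_rpow hr u.2.2 w.2.2).sub
    (hasDerivAt_integral_abs_rpow hp (Lp.memLp u.1) (Lp.memLp w.1))
  refine this.congr_of_eventuallyEq (Eventually.of_forall fun t => ?_)
  simp only [functionalJ, Pi.sub_apply]
  congr 2
  · refine integral_congr_ae ?_
    filter_upwards [e2 t] with x hx
    simp only [hx]
    rfl
  · refine integral_congr_ae ?_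
    filter_upwards [e t] with x hx
    simp only [← hx]
    rfl

/-- The action of an orthogonal matrix on `ℝᴺ`. -/
def act {N : ℕ} (g : Matrix.orthogonalGroup (Fin N) ℝ) (x : Space N) : Space N :=
  Matrix.toEuclideanLin (g : Matrix (Fin N) (Fin N) ℝ) x

/-- The set `Θ` is `G`-invariant. -/
def IsInvariantSet {N : ℕ} (G : Subgroup (Matrix.orthogonalGroup (Fin N) ℝ))
    (Θ : Set (Space N)) : Prop :=
  ∀ g ∈ G, ∀ x ∈ Θ, act g x ∈ Θ

/-- The class `u ∈ D^{2,r}(ℝᴺ)` is `φ`-equivariant: for each `g ∈ G`,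
`u(gx) = φ(g)u(x)` for almost every `x`. -/
def IsEquivariantD2 {N : ℕ} {p r : ℝ} {G : Subgroup (Matrix.orthogonalGroup (Fin N) ℝ)}
    (φ : G →* ℤˣ) (u : D2 N p r) : Prop :=
  ∀ g : G, ∀ᵐ x, (fnD2 u) (act g x) = ((φ g : ℤ) : ℝ) * (fnD2 u) x

/-- `η ∈ C_c^∞(Θ)`, a function on `Θ` being extended by zero to `ℝᴺ`. -/
def IsTestFunction {N : ℕ} (Θ : Set (Space N)) (η : Space N → ℝ) : Prop :=
  ContDiff ℝ (⊤ : ℕ∞) η ∧ HasCompactSupport η ∧ tsupport η ⊆ Θ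

/-- `η ∈ C_c^∞(Θ)^φ`. -/
def IsEquivariantTestFunction {N : ℕ} {G : Subgroup (Matrix.orthogonalGroup (Fin N) ℝ)}
    (φ : G →* ℤˣ) (Θ : Set (Space N)) (η : Space N → ℝ) : Prop :=
  IsTestFunction Θ η ∧ ∀ g : G, ∀ x ∈ Θ, η (act g x) = ((φ g : ℤ) : ℝ) * η x

/-- `η ∈ C_c^∞(Θ)^G`. -/
def IsInvariantTestFunction {N : ℕ} (G : Subgroup (Matrix.orthogonalGroup (Fin N) ℝ))
    (Θ : Set (Space N)) (η : Space N → ℝ) : Prop :=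
  IsTestFunction Θ η ∧ ∀ g ∈ G, ∀ x ∈ Θ, η (act g x) = η x

end LaneEmden

end

/-!
# Weak limits of `φ`-equivariant Palais–Smale sequences are critical

Write `r = q/(q-1)`, `f_k = Δv_k`, `f = Δv`, `w_k = v_k - v`, and `spow s t = |t|^(s-2) t`. It is
enough that `∫ spow r f_k Δη → ∫ spow r f Δη` and `∫ spow p v_k η → ∫ spow p v η` along some free
ultrafilter, because the limit of `J'(v_k)η` is already known to be `0`.

**Compactness of lower order terms.** A smoothed Newtonian kernel and its first derivatives
belong to `L^q`, and convolving them with `Δw_k` gives mollifications of `w_k` and `∂ᵢ w_k`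
(`conv_rescale_lap_eq`). As `Δw_k ⇀ 0` in `L^r`, it follows that `w_k → 0` and `∂ᵢ w_k → 0` in `L^r`
on sets of finite measure (`tendsto_eLpNorm_restrict`, `tendsto_eLpNorm_weakPartial_restrict`).
Consequently a smooth cut-off of `w_k` only costs an error that tends to zero, and `∫ spow p v_k η`
converges (`tendsto_integral_spow_sub_mul`).

**Sobolev inequality.** The inequality `‖u‖_p ≤ C ‖Δu‖_r` for compactly supported `u`
(`exists_sobolev_hasCompactSupport`) is reduced by mollification to test functions. There `-Δu` is
tested against a smooth substitute for `|u|^(p/q-1) u`; the first order Sobolev inequality with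
exponent `2` and Hölder's inequality do the rest.

**Concentration.** Fix a small radius. A point is bad if, along the ultrafilter, the ball about it
carries `|Δw_k|^r`-mass more than `ε`. Since the total mass is bounded, the bad points lie in a set
whose measure is small with the radius. On balls around good points the Sobolev inequality gives
`∫ |w_k|^p ≤ C m^(p/r) ≤ C ε^(p/r-1) m` up to `o(1)`, with `m` the local mass of `|Δw_k|^r`. As
`p > r`, and as balls of a covering have bounded overlap, `w_k` is small in `L^p` near the good
points. The function `|Δw_k|` is `G`-invariant, so the set of good points is too, and it has a
`G`-invariant cut-off function `ψ` (`exists_cutoff_lintegral_le`). The ultrafilter makes the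
dichotomy between good and bad available for all points at once, without passing to subsequences.

**Monotonicity.** Testing `J'(v_k)` with `ψ w_k` shows that
`∫ ψ (spow r f_k - spow r f)(f_k - f)` is, up to `o(1)`, the integral of `ψ spow p v_k w_k`
(`tendsto_integral_cutoff_mul_spow_sub`), which is small by the choice of `ψ`
(`eventually_enorm_integral_spow_mul_le`). The integrand is nonnegative and controls
`spow r f_k - spow r f` where `ψ = 1`; the remaining set has small measure and is dealt with by
Hölder's inequality (`enorm_integral_spow_sub_mul_le`).
-/

namespace LaneEmden

/-! ### Classical and weak derivatives -/

/-- The classical partial derivative `∂ᵢ η`. -/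
noncomputable def pd {N : ℕ} (i : Fin N) (η : Space N → ℝ) (x : Space N) : ℝ :=
  fderiv ℝ η x (EuclideanSpace.single i (1 : ℝ))

/-- The classical Laplacian `∑ᵢ ∂ᵢ∂ᵢ η`. -/
noncomputable def lap {N : ℕ} (η : Space N → ℝ) (x : Space N) : ℝ :=
  ∑ i, pd i (pd i η) x

/-- `η ∈ C_c^∞(ℝᴺ)`. -/
def IsTest {N : ℕ} (η : Space N → ℝ) : Prop :=
  ContDiff ℝ (⊤ : ℕ∞) η ∧ HasCompactSupport η

section Classical

variable {N : ℕ} {i : Fin N} {u g η ψ : Space N → ℝ}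

theorem _root_.ContDiff.pd (hη : ContDiff ℝ (⊤ : ℕ∞) η) (i : Fin N) :
    ContDiff ℝ (⊤ : ℕ∞) (pd i η) :=
  (hη.fderiv_right (by simp)).clm_apply contDiff_const

theorem _root_.ContDiff.lap (hη : ContDiff ℝ (⊤ : ℕ∞) η) : ContDiff ℝ (⊤ : ℕ∞) (lap η) :=
  ContDiff.sum fun i _ => (hη.pd i).pd i

theorem support_pd_subset (i : Fin N) (η : Space N → ℝ) :
    tsupport (pd i η) ⊆ tsupport η :=
  tsupport_fderiv_apply_subset ℝ _

theorem support_lap_subset (η : Space N → ℝ) : tsupport (lap η) ⊆ tsupport η := by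
  refine closure_minimal (fun x hx => ?_) (isClosed_tsupport η)
  by_contra h
  refine hx (Finset.sum_eq_zero fun i _ => ?_)
  exact image_eq_zero_of_notMem_tsupport fun h' =>
    h (support_pd_subset i _ (support_pd_subset i _ h'))

theorem IsTest.pd (hη : IsTest η) (i : Fin N) : IsTest (pd i η) :=
  ⟨hη.1.pd i, hη.2.mono' ((subset_tsupport _).trans (support_pd_subset i η))⟩

theorem IsTest.lap (hη : IsTest η) : IsTest (lap η) :=
  ⟨hη.1.lap, hη.2.mono' ((subset_tsupport _).trans (support_lap_subset η))⟩

theorem IsTest.mul_left (hη : IsTest η) (hψ : ContDiff ℝ (⊤ : ℕ∞) ψ) :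
    IsTest fun x => ψ x * η x :=
  ⟨hψ.mul hη.1, hη.2.mul_left⟩

theorem IsTest.continuous (hη : IsTest η) : Continuous η := hη.1.continuous

theorem IsTest.memLp (hη : IsTest η) (s : ENNReal) : MemLp η s volume :=
  hη.continuous.memLp_of_hasCompactSupport hη.2

theorem pd_mul (hη : ContDiff ℝ (⊤ : ℕ∞) η) (hψ : ContDiff ℝ (⊤ : ℕ∞) ψ) :
    pd i (fun x => ψ x * η x) = fun x => ψ x * pd i η x + pd i ψ x * η x := by
  funext x
  unfold pd
  rw [fderiv_fun_mul ((hψ.differentiable (by simp)) x) ((hη.differentiable (by simp)) x)]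
  simp [mul_comm]

theorem pd_sub (hη : ContDiff ℝ (⊤ : ℕ∞) η) (hψ : ContDiff ℝ (⊤ : ℕ∞) ψ) :
    pd i (fun x => ψ x - η x) = fun x => pd i ψ x - pd i η x := by
  funext x
  unfold pd
  rw [fderiv_fun_sub ((hψ.differentiable (by simp)) x) ((hη.differentiable (by simp)) x)]
  simp

theorem lap_sub (hη : ContDiff ℝ (⊤ : ℕ∞) η) (hψ : ContDiff ℝ (⊤ : ℕ∞) ψ) (x : Space N) :
    lap (fun x => ψ x - η x) x = lap ψ x - lap η x := by
  unfold lap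
  rw [← Finset.sum_sub_distrib]
  refine Finset.sum_congr rfl fun i _ => ?_
  rw [pd_sub hη hψ, pd_sub (hη.pd i) (hψ.pd i)]

/-- Mixed partial derivatives commute. -/
theorem pd_comm (hη : ContDiff ℝ (⊤ : ℕ∞) η) (i j : Fin N) : pd i (pd j η) = pd j (pd i η) := by
  funext x
  have h2 : ∀ i j : Fin N, pd i (pd j η) x =
      fderiv ℝ (fderiv ℝ η) x (EuclideanSpace.single i (1 : ℝ))
        (EuclideanSpace.single j (1 : ℝ)) := fun i j => by
    have hd : DifferentiableAt ℝ (fderiv ℝ η) x :=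
      ((hη.fderiv_right (m := (⊤ : ℕ∞)) (by simp)).differentiable (by simp)) x
    change fderiv ℝ (fun y => fderiv ℝ η y _) x _ = _
    rw [fderiv_clm_apply hd (differentiableAt_const _)]
    simp
  rw [h2, h2]
  exact (hη.contDiffAt.isSymmSndFDerivAt
    (by simpa using WithTop.coe_le_coe.2 (le_top : (2 : ℕ∞) ≤ ⊤))) _ _

theorem lap_pd (hη : ContDiff ℝ (⊤ : ℕ∞) η) (i : Fin N) : lap (pd i η) = pd i (lap η) := by
  funext x
  have h : pd i (lap η) x = ∑ j, pd i (pd j (pd j η)) x := by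
    change fderiv ℝ (fun y => ∑ j, pd j (pd j η) y) x _ = _
    rw [fderiv_fun_sum fun j _ => (((hη.pd j).pd j).differentiable (by simp)) x]
    simp [pd]
  rw [h]
  refine Finset.sum_congr rfl fun j _ => ?_
  rw [pd_comm hη j i, pd_comm (hη.pd j) j i]

theorem pd_comp_sub_left (hη : ContDiff ℝ (⊤ : ℕ∞) η) (x : Space N) :
    pd i (fun y => η (x - y)) = fun y => - pd i η (x - y) := by
  funext y
  have h1 : HasFDerivAt (fun y : Space N => x - y) (-ContinuousLinearMap.id ℝ (Space N)) y :=
    (hasFDerivAt_id y).const_sub x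
  have h2 := ((hη.differentiable (by simp)) (x - y)).hasFDerivAt.comp y h1
  change fderiv ℝ (η ∘ fun y => x - y) y _ = _
  rw [h2.fderiv]
  simp [pd]

theorem pd_neg (η : Space N → ℝ) : pd i (fun y => - η y) = fun y => - pd i η y := by
  funext y
  unfold pd
  rw [fderiv_fun_neg]
  simp

theorem lap_comp_sub_left (hη : ContDiff ℝ (⊤ : ℕ∞) η) (x : Space N) :
    lap (fun y => η (x - y)) = fun y => lap η (x - y) := by
  funext y
  unfold lap
  refine Finset.sum_congr rfl fun i _ => ?_
  rw [pd_comp_sub_left hη, pd_neg, pd_comp_sub_left (hη.pd i)]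
  simp

theorem IsTest.comp_sub_left (hη : IsTest η) (x : Space N) : IsTest fun y => η (x - y) :=
  ⟨hη.1.comp (contDiff_const.sub contDiff_id),
    hη.2.comp_homeomorph (Homeomorph.subLeft x)⟩

end Classical

section Weak

variable {N : ℕ} {i : Fin N} {u g η ψ : Space N → ℝ}

theorem HasWeakPartial.integral_mul_pd (H : HasWeakPartial i u g) (hη : IsTest η) :
    ∫ x, u x * pd i η x = - ∫ x, g x * η x := H.2.2 η hη.1 hη.2

theorem _root_.MeasureTheory.LocallyIntegrable.integrable_mul_isTest
    (hu : LocallyIntegrable u volume) (hη : IsTest η) : Integrable fun x => u x * η x :=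
  integrable_mul_test hu hη.1 hη.2

theorem TwiceWeaklyDifferentiable.locallyIntegrable (hN : 0 < N)
    (H : TwiceWeaklyDifferentiable u) : LocallyIntegrable u volume :=
  (H.weakPartial ⟨0, hN⟩ ⟨0, hN⟩).1.1

theorem TwiceWeaklyDifferentiable.locallyIntegrable_weakLaplacian
    (H : TwiceWeaklyDifferentiable u) : LocallyIntegrable (weakLaplacian u) volume :=
  locallyIntegrable_finsetSum (f := fun i => LaneEmden.weakPartial i (LaneEmden.weakPartial i u))
    Finset.univ fun i _ => (H.weakPartial i i).2.2.1

/-- Integration by parts: the weak Laplacian is the distributional one. -/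
theorem TwiceWeaklyDifferentiable.integral_mul_lap (H : TwiceWeaklyDifferentiable u)
    (hη : IsTest η) : ∫ x, u x * lap η x = ∫ x, weakLaplacian u x * η x := by
  unfold lap weakLaplacian
  simp_rw [Finset.mul_sum, Finset.sum_mul]
  rw [integral_finsetSum _ fun i _ =>
      ((H.weakPartial i i).1.1.integrable_mul_isTest ((hη.pd i).pd i)),
    integral_finsetSum _ fun i _ => ((H.weakPartial i i).2.2.1.integrable_mul_isTest hη)]
  refine Finset.sum_congr rfl fun i _ => ?_
  rw [(H.weakPartial i i).1.integral_mul_pd (hη.pd i), (H.weakPartial i i).2.integral_mul_pd hη,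
    neg_neg]

/-- The Leibniz rule for the product of a smooth function and a weakly differentiable one. -/
theorem HasWeakPartial.smooth_mul (H : HasWeakPartial i u g) (hψ : ContDiff ℝ (⊤ : ℕ∞) ψ) :
    HasWeakPartial i (fun x => ψ x * u x) (fun x => ψ x * g x + pd i ψ x * u x) := by
  refine ⟨H.1.continuous_mul hψ.continuous,
    (H.2.1.continuous_mul hψ.continuous).add (H.1.continuous_mul (hψ.pd i).continuous),
    fun η h1 h2 => ?_⟩
  have hη : IsTest η := ⟨h1, h2⟩
  have hηψ : IsTest fun x => ψ x * η x := hη.mul_left hψ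
  have key := H.integral_mul_pd hηψ
  rw [pd_mul h1 hψ] at key
  have i1 := H.1.integrable_mul_isTest ((hη.pd i).mul_left hψ)
  have i2 := H.1.integrable_mul_isTest (hη.mul_left (hψ.pd i))
  have i3 := H.2.1.integrable_mul_isTest hηψ
  simp_rw [mul_add] at key
  rw [integral_add i1 i2] at key
  have e1 : ∫ x, ψ x * u x * fderiv ℝ η x (EuclideanSpace.single i (1 : ℝ)) =
      ∫ x, u x * (ψ x * pd i η x) := integral_congr_ae (ae_of_all _ fun x => by
    simp only [pd]; ring)
  have e2 : ∫ x, (ψ x * g x + pd i ψ x * u x) * η x =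
      (∫ x, g x * (ψ x * η x)) + ∫ x, u x * (pd i ψ x * η x) := by
    rw [← integral_add i3 i2]
    exact integral_congr_ae (ae_of_all _ fun x => by simp only []; ring)
  rw [e1, e2]
  linarith

theorem TwiceWeaklyDifferentiable.hasWeakPartial_smooth_mul (H : TwiceWeaklyDifferentiable u)
    (hψ : ContDiff ℝ (⊤ : ℕ∞) ψ) (i j : Fin N) :
    HasWeakPartial j (fun x => ψ x * LaneEmden.weakPartial i u x + pd i ψ x * u x)
      (fun x => (ψ x * LaneEmden.weakPartial j (LaneEmden.weakPartial i u) x +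
        pd j ψ x * LaneEmden.weakPartial i u x) + (pd i ψ x * LaneEmden.weakPartial j u x +
        pd j (pd i ψ) x * u x)) :=
  ((H.weakPartial i j).2.smooth_mul hψ).add ((H.weakPartial j j).1.smooth_mul (hψ.pd i))

theorem TwiceWeaklyDifferentiable.smooth_mul (H : TwiceWeaklyDifferentiable u)
    (hψ : ContDiff ℝ (⊤ : ℕ∞) ψ) : TwiceWeaklyDifferentiable fun x => ψ x * u x := fun i =>
  ⟨_, (H.weakPartial i i).1.smooth_mul hψ, fun j => ⟨_, H.hasWeakPartial_smooth_mul hψ i j⟩⟩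

/-- `Δ(ψu) = ψΔu + 2∇ψ·∇u + uΔψ`. -/
theorem TwiceWeaklyDifferentiable.weakLaplacian_smooth_mul (H : TwiceWeaklyDifferentiable u)
    (hψ : ContDiff ℝ (⊤ : ℕ∞) ψ) :
    weakLaplacian (fun x => ψ x * u x) =ᵐ[volume] fun x => ψ x * weakLaplacian u x +
      (2 * (∑ i, pd i ψ x * LaneEmden.weakPartial i u x) + lap ψ x * u x) := by
  refine (weakLaplacian_ae_eq (fun i => (H.weakPartial i i).1.smooth_mul hψ)
    (fun i => H.hasWeakPartial_smooth_mul hψ i i)).trans (ae_of_all _ fun x => ?_)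
  simp only [weakLaplacian, lap, Finset.mul_sum, Finset.sum_mul, ← Finset.sum_add_distrib]
  exact Finset.sum_congr rfl fun i _ => by ring

theorem weakLaplacian_of_contDiff (hη : ContDiff ℝ (⊤ : ℕ∞) η) :
    weakLaplacian η =ᵐ[volume] lap η :=
  weakLaplacian_ae_eq (fun _ => hasWeakPartial_of_contDiff hη)
    (fun i => hasWeakPartial_of_contDiff (hη.pd i))

end Weak

/-! ### The Sobolev inequality for the Laplacian of a test function -/

section Sobolev

variable {N : ℕ} {u : Space N → ℝ}

theorem norm_fderiv_sq_le (u : Space N → ℝ) (x : Space N) :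
    ‖fderiv ℝ u x‖ ^ 2 ≤ ∑ i, pd i u x ^ 2 := by
  set L := fderiv ℝ u x
  set w : Space N := WithLp.toLp 2 fun i => pd i u x
  have hL : ∀ y : Space N, L y = inner ℝ w y := fun y => by
    have hy : y = ∑ i, y i • EuclideanSpace.single i (1 : ℝ) := by
      ext j
      simp [Finset.sum_apply, Pi.single_apply]
    conv_lhs => rw [hy]
    simp [PiLp.inner_apply, w, L, pd]
  have h1 : ‖L‖ ≤ ‖w‖ :=
    L.opNorm_le_bound (norm_nonneg _) fun y => by rw [hL]; exact norm_inner_le_norm _ _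
  have h2 : ‖w‖ ^ 2 = ∑ i, pd i u x ^ 2 := by
    rw [EuclideanSpace.norm_sq_eq]
    simp [w]
  rw [← h2]
  gcongr

theorem pd_comp {φ : ℝ → ℝ} (hφ : ContDiff ℝ (⊤ : ℕ∞) φ) (hu : ContDiff ℝ (⊤ : ℕ∞) u) (i : Fin N)
    (x : Space N) : pd i (fun y => φ (u y)) x = deriv φ (u x) * pd i u x := by
  have h1 := ((hφ.differentiable (by simp)) (u x)).hasDerivAt.comp_hasFDerivAt x
    ((hu.differentiable (by simp)) x).hasFDerivAt
  change fderiv ℝ (φ ∘ u) x _ = _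
  rw [h1.fderiv]
  simp [pd]

theorem IsTest.comp {φ : ℝ → ℝ} (hφ : ContDiff ℝ (⊤ : ℕ∞) φ) (h0 : φ 0 = 0) (hu : IsTest u) :
    IsTest fun y => φ (u y) :=
  ⟨hφ.comp hu.1, hu.2.comp_left h0⟩

/-- Green's formula for `-Δu` tested against `φ ∘ u`. -/
theorem integral_neg_lap_mul_comp {φ : ℝ → ℝ} (hφ : ContDiff ℝ (⊤ : ℕ∞) φ) (h0 : φ 0 = 0)
    (hu : IsTest u) :
    ∫ x, - lap u x * φ (u x) = ∫ x, deriv φ (u x) * ∑ i, pd i u x ^ 2 := by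
  have hφu := hu.comp hφ h0
  have hcont : Continuous fun x => deriv φ (u x) :=
    (hφ.continuous_deriv (by simp)).comp hu.continuous
  simp_rw [lap, Finset.mul_sum, ← Finset.sum_neg_distrib, Finset.sum_mul]
  rw [integral_finsetSum _ fun i _ => ?_, integral_finsetSum _ fun i _ => ?_]
  · refine Finset.sum_congr rfl fun i _ => ?_
    have h := (hasWeakPartial_of_contDiff (i := i) (hu.1.pd i)).integral_mul_pd hφu
    have e : ∀ x, deriv φ (u x) * pd i u x ^ 2 = pd i u x * pd i (fun y => φ (u y)) x :=
      fun x => by rw [pd_comp hφ hu.1]; ring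
    simp_rw [e]
    rw [h, ← integral_neg]
    refine integral_congr_ae (ae_of_all _ fun x => ?_)
    simp [pd]
  · refine Continuous.integrable_of_hasCompactSupport (hcont.mul ((hu.pd i).continuous.pow 2)) ?_
    have : HasCompactSupport fun x => pd i u x ^ 2 :=
      (hu.pd i).2.comp_left (g := fun t => t ^ 2) (by simp)
    exact this.mul_left
  · exact Continuous.integrable_of_hasCompactSupport
      (((hu.pd i).pd i).continuous.neg.mul hφu.continuous) hφu.2.mul_left

/-- The first order Sobolev inequality with exponent `2`, in terms of partial derivatives. -/
theorem exists_sobolev_two (hN : 3 ≤ N) : ∃ C : ℝ, 0 ≤ C ∧ ∀ v : Space N → ℝ, IsTest v →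
    (∫ x, |v x| ^ (2 * N / (N - 2) : ℝ)) ^ ((N - 2) / N : ℝ) ≤ C * ∫ x, ∑ i, pd i v x ^ 2 := by
  have hN' : (3 : ℝ) ≤ N := by exact_mod_cast hN
  have hs : (0 : ℝ) < 2 * N / (N - 2) := by
    have : (0 : ℝ) < N - 2 := by linarith
    positivity
  set s : NNReal := ⟨2 * N / (N - 2), hs.le⟩
  have hs' : (s : ℝ) = 2 * N / (N - 2) := rfl
  set C := SNormLESNormFDerivOfEqConst ℝ (volume : Measure (Space N)) ((2 : NNReal) : ℝ)
  refine ⟨(C : ℝ) ^ 2, by positivity, fun v hv => ?_⟩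
  have key := eLpNorm_le_eLpNorm_fderiv_of_eq (F := ℝ) (volume : Measure (Space N))
    (u := v) (hv.1.of_le (by exact_mod_cast le_top)) hv.2 (p := 2) (p' := s) (by norm_num)
    (by simp; omega) (by
      rw [hs']
      simp
      have : (N : ℝ) - 2 ≠ 0 := by linarith
      field_simp)
  have hvs : MemLp v s volume := hv.memLp _
  have hdc : Continuous fun x => fderiv ℝ v x := hv.1.continuous_fderiv (by simp)
  have hd : MemLp (fderiv ℝ v) (2 : NNReal) volume :=
    hdc.memLp_of_hasCompactSupport (hv.2.fderiv ℝ)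
  have s0 : (s : ENNReal) ≠ 0 := by
    simpa using (NNReal.coe_pos.1 (by rw [hs']; exact hs)).ne'
  rw [hvs.eLpNorm_eq_integral_rpow_norm s0 (by simp),
    hd.eLpNorm_eq_integral_rpow_norm (by simp) (by simp)] at key
  rw [← ENNReal.ofReal_coe_nnreal (p := C), ← ENNReal.ofReal_mul (by positivity),
    ENNReal.ofReal_le_ofReal_iff (by positivity)] at key
  simp only [ENNReal.coe_toReal, hs', Real.norm_eq_abs, NNReal.coe_ofNat] at key
  set I := ∫ x, |v x| ^ (2 * N / (N - 2) : ℝ)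
  have hI : 0 ≤ I := by positivity
  have h2 : I ^ ((N - 2) / N : ℝ) = (I ^ ((2 * N / (N - 2) : ℝ)⁻¹)) ^ 2 := by
    rw [← Real.rpow_mul_natCast hI]
    congr 1
    have : (N : ℝ) - 2 ≠ 0 := by linarith
    field_simp
    push_cast; ring
  rw [h2]
  refine (pow_le_pow_left₀ (by positivity) key 2).trans ?_
  rw [mul_pow]
  gcongr
  rw [← Real.rpow_mul_natCast (by positivity)]
  norm_num
  refine integral_mono_of_nonneg (ae_of_all _ fun x => by positivity) ?_
    (ae_of_all _ fun x => norm_fderiv_sq_le v x)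
  refine integrable_finsetSum _ fun i _ => ?_
  exact Continuous.integrable_of_hasCompactSupport ((hv.pd i).continuous.pow 2)
    ((hv.pd i).2.comp_left (g := fun t => t ^ 2) (by simp))

theorem contDiff_sq_add_rpow {δ : ℝ} (hδ : 0 < δ) (b : ℝ) :
    ContDiff ℝ (⊤ : ℕ∞) fun t : ℝ => (t ^ 2 + δ) ^ b :=
  ContDiff.rpow_const_of_ne (by fun_prop) fun t => by positivity

theorem hasDerivAt_sq_add_rpow {δ : ℝ} (hδ : 0 < δ) (b t : ℝ) :
    HasDerivAt (fun t : ℝ => (t ^ 2 + δ) ^ b) (2 * b * t * (t ^ 2 + δ) ^ (b - 1)) t := by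
  have h1 : HasDerivAt (fun t : ℝ => t ^ 2 + δ) (2 * t) t := by
    simpa using (hasDerivAt_pow 2 t).add_const δ
  convert h1.rpow_const (p := b) (Or.inl (by positivity)) using 1
  ring

/-- The energy estimate behind the second order Sobolev inequality. The function
`t(t²+δ)^((a-1)/2)` is a smooth substitute for `|t|^(a-1)t`, and its derivative dominates the
square of the derivative of `(t²+δ)^((a+1)/4)`. -/
theorem exists_energy_bound (hN : 3 ≤ N) {a : ℝ} (ha : 0 < a) :
    ∃ C : ℝ, 0 ≤ C ∧ ∀ u : Space N → ℝ, IsTest u → ∀ δ : ℝ, 0 < δ →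
      (∫ x, |(u x ^ 2 + δ) ^ ((a + 1) / 4) - δ ^ ((a + 1) / 4)| ^ (2 * N / (N - 2) : ℝ))
        ^ ((N - 2) / N : ℝ) ≤
      C * ∫ x, |lap u x| * (|u x| * (u x ^ 2 + δ) ^ ((a - 1) / 2)) := by
  obtain ⟨C, hC, hS⟩ := exists_sobolev_two hN
  refine ⟨C * ((a + 1) ^ 2 / (4 * a)), by positivity, fun u hu δ hδ => ?_⟩
  set φ : ℝ → ℝ := fun t => t * (t ^ 2 + δ) ^ ((a - 1) / 2) with hφdef
  set H : ℝ → ℝ := fun t => (t ^ 2 + δ) ^ ((a + 1) / 4) - δ ^ ((a + 1) / 4) with hHdef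
  have hφ : ContDiff ℝ (⊤ : ℕ∞) φ := contDiff_id.mul (contDiff_sq_add_rpow hδ _)
  have hH : ContDiff ℝ (⊤ : ℕ∞) H := (contDiff_sq_add_rpow hδ _).sub contDiff_const
  have hφ' : ∀ t, deriv φ t = (t ^ 2 + δ) ^ ((a - 3) / 2) * (a * t ^ 2 + δ) := fun t => by
    have h := (hasDerivAt_id t).mul (hasDerivAt_sq_add_rpow hδ ((a - 1) / 2) t)
    have hpos : 0 < t ^ 2 + δ := by positivity
    refine h.deriv.trans ?_
    have e : (t ^ 2 + δ) ^ ((a - 1) / 2) = (t ^ 2 + δ) ^ ((a - 3) / 2) * (t ^ 2 + δ) := by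
      rw [← Real.rpow_add_one hpos.ne']
      congr 1; ring
    have e' : (a - 1) / 2 - 1 = (a - 3) / 2 := by ring
    simp only [id, e, e']
    ring
  have hH' : ∀ t, deriv H t = (a + 1) / 2 * t * (t ^ 2 + δ) ^ ((a - 3) / 4) := fun t => by
    have h := (hasDerivAt_sq_add_rpow hδ ((a + 1) / 4) t).sub_const (δ ^ ((a + 1) / 4))
    refine h.deriv.trans ?_
    have e' : (a + 1) / 4 - 1 = (a - 3) / 4 := by ring
    rw [e']
    ring
  have hcmp : ∀ t, deriv H t ^ 2 ≤ (a + 1) ^ 2 / (4 * a) * deriv φ t := fun t => by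
    have hpos : 0 < t ^ 2 + δ := by positivity
    have e : ((t ^ 2 + δ) ^ ((a - 3) / 4)) ^ 2 = (t ^ 2 + δ) ^ ((a - 3) / 2) := by
      rw [← Real.rpow_mul_natCast hpos.le]
      congr 1; push_cast; ring
    rw [hφ', hH', mul_pow, e, mul_comm ((t ^ 2 + δ) ^ ((a - 3) / 2)), ← mul_assoc]
    refine mul_le_mul_of_nonneg_right ?_ (by positivity)
    rw [mul_add]
    have e2 : (a + 1) ^ 2 / (4 * a) * (a * t ^ 2) = ((a + 1) / 2 * t) ^ 2 := by
      field_simp; ring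
    rw [e2]
    have : 0 ≤ (a + 1) ^ 2 / (4 * a) * δ := by positivity
    linarith
  have hφ0 : φ 0 = 0 := by simp [hφdef]
  have hHu : IsTest fun x => H (u x) := hu.comp hH (by simp [hHdef])
  refine (hS _ hHu).trans ?_
  rw [mul_assoc]
  refine mul_le_mul_of_nonneg_left ?_ hC
  have hu2 : ∀ i, HasCompactSupport fun x => pd i u x ^ 2 := fun i =>
    (hu.pd i).2.comp_left (g := fun t => t ^ 2) (by simp)
  have hsum : HasCompactSupport fun x => ∑ i, pd i u x ^ 2 := by
    refine hu.2.mono' fun x hx => ?_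
    by_contra h
    exact hx (Finset.sum_eq_zero fun i _ => by
      rw [image_eq_zero_of_notMem_tsupport fun h' => h (support_pd_subset i u h')]; simp)
  calc ∫ x, ∑ i, pd i (fun y => H (u y)) x ^ 2
      ≤ ∫ x, (a + 1) ^ 2 / (4 * a) * (deriv φ (u x) * ∑ i, pd i u x ^ 2) := by
        refine integral_mono_of_nonneg (ae_of_all _ fun x => by positivity) ?_
          (ae_of_all _ fun x => ?_)
        · refine Integrable.const_mul (Continuous.integrable_of_hasCompactSupport ?_
            hsum.mul_left) _
          refine ((hφ.continuous_deriv (by simp)).comp hu.continuous).mul ?_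
          exact continuous_finsetSum _ fun i _ => (hu.pd i).continuous.pow 2
        · simp only [pd_comp hH hu.1, mul_pow, ← Finset.mul_sum, ← mul_assoc]
          exact mul_le_mul_of_nonneg_right (hcmp _) (by positivity)
    _ = (a + 1) ^ 2 / (4 * a) * ∫ x, - lap u x * φ (u x) := by
        rw [integral_const_mul, integral_neg_lap_mul_comp hφ hφ0 hu]
    _ ≤ _ := by
        refine mul_le_mul_of_nonneg_left ?_ (by positivity)
        refine (le_abs_self _).trans ((abs_integral_le_integral_abs).trans_eq ?_)
        refine integral_congr_ae (ae_of_all _ fun x => ?_)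
        simp only [hφdef, abs_mul, abs_neg]
        rw [abs_of_nonneg (Real.rpow_nonneg (by positivity : 0 ≤ u x ^ 2 + δ) _)]

/-- The energy estimate in the limit `δ → 0`. -/
theorem exists_energy_bound_limit (hN : 3 ≤ N) {a : ℝ} (ha : 0 < a) :
    ∃ C : ℝ, 0 ≤ C ∧ ∀ u : Space N → ℝ, IsTest u →
      (∫ x, |u x| ^ ((a + 1) * N / (N - 2) : ℝ)) ^ ((N - 2) / N : ℝ) ≤
      C * ∫ x, |lap u x| * |u x| ^ a := by
  obtain ⟨C, hC, hS⟩ := exists_energy_bound hN ha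
  refine ⟨C, hC, fun u hu => ?_⟩
  have hN' : (3 : ℝ) ≤ N := by exact_mod_cast hN
  have hN2 : (0 : ℝ) < N - 2 := by linarith
  set s : ℝ := 2 * N / (N - 2) with hs
  have hs0 : 0 < s := by positivity
  set δ : ℕ → ℝ := fun n => 1 / ((n : ℝ) + 1)
  have hδ : ∀ n, 0 < δ n := fun n => by positivity
  have hδ1 : ∀ n, δ n ≤ 1 := fun n => by
    simp only [δ]
    rw [div_le_one (by positivity)]
    simp
  have hδ0 : Tendsto δ atTop (𝓝 0) := tendsto_one_div_add_atTop_nhds_zero_nat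
  have hlim : ∀ (t b : ℝ), 0 ≤ b →
      Tendsto (fun n => (t ^ 2 + δ n) ^ b) atTop (𝓝 (|t| ^ (2 * b))) := by
    intro t b hb
    have h := ((tendsto_const_nhds (x := t ^ 2)).add hδ0).rpow_const (p := b) (Or.inr hb)
    rw [add_zero, ← sq_abs, ← Real.rpow_natCast, ← Real.rpow_mul (abs_nonneg t)] at h
    simpa using h
  have hL : Tendsto (fun n => (∫ x, |(u x ^ 2 + δ n) ^ ((a + 1) / 4) - δ n ^ ((a + 1) / 4)| ^ s))
      atTop (𝓝 (∫ x, |u x| ^ ((a + 1) * N / (N - 2) : ℝ))) := by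
    refine tendsto_integral_of_dominated_convergence
      ((tsupport u).indicator fun x => ((u x ^ 2 + 1) ^ ((a + 1) / 4)) ^ s) (fun n => ?_) ?_
      (fun n => ae_of_all _ fun x => ?_) (ae_of_all _ fun x => ?_)
    · have h1 : Continuous fun x => (u x ^ 2 + δ n) ^ ((a + 1) / 4) :=
        ((contDiff_sq_add_rpow (hδ n) _).continuous).comp hu.continuous
      exact ((h1.sub continuous_const).abs.rpow_const
        fun x => Or.inr hs0.le).aestronglyMeasurable
    · rw [integrable_indicator_iff (isClosed_tsupport u).measurableSet]
      refine ContinuousOn.integrableOn_compact hu.2 (Continuous.continuousOn ?_)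
      have h1 : Continuous fun x => (u x ^ 2 + 1) ^ ((a + 1) / 4) :=
        ((contDiff_sq_add_rpow one_pos _).continuous).comp hu.continuous
      exact h1.rpow_const fun x => Or.inr hs0.le
    · by_cases hx : x ∈ tsupport u
      · rw [Set.indicator_of_mem hx, Real.norm_eq_abs, abs_of_nonneg (by positivity)]
        have h1 : δ n ^ ((a + 1) / 4) ≤ (u x ^ 2 + δ n) ^ ((a + 1) / 4) :=
          Real.rpow_le_rpow (hδ n).le (by nlinarith [sq_nonneg (u x)]) (by positivity)
        have h2 : (u x ^ 2 + δ n) ^ ((a + 1) / 4) ≤ (u x ^ 2 + 1) ^ ((a + 1) / 4) :=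
          Real.rpow_le_rpow (by have := hδ n; positivity) (by linarith [hδ1 n]) (by positivity)
        have h3 : 0 ≤ δ n ^ ((a + 1) / 4) := Real.rpow_nonneg (hδ n).le _
        refine Real.rpow_le_rpow (abs_nonneg _) ?_ hs0.le
        rw [abs_of_nonneg (by linarith)]
        linarith
      · simp [image_eq_zero_of_notMem_tsupport hx, hs0.ne', Set.indicator_of_notMem hx]
    · have h := (((hlim (u x) ((a + 1) / 4) (by positivity)).sub
        (hlim 0 ((a + 1) / 4) (by positivity))).abs).rpow_const (p := s) (Or.inr hs0.le)
      have e : |(|u x| ^ (2 * ((a + 1) / 4)) - |(0 : ℝ)| ^ (2 * ((a + 1) / 4)))| ^ s =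
          |u x| ^ ((a + 1) * N / (N - 2) : ℝ) := by
        rw [abs_zero, Real.zero_rpow (by positivity), sub_zero,
          abs_of_nonneg (Real.rpow_nonneg (abs_nonneg _) _), ← Real.rpow_mul (abs_nonneg _)]
        congr 1
        rw [hs]
        field_simp
        ring
      rw [e] at h
      simpa using h
  have hR : Tendsto (fun n => ∫ x, |lap u x| * (|u x| * (u x ^ 2 + δ n) ^ ((a - 1) / 2))) atTop
      (𝓝 (∫ x, |lap u x| * |u x| ^ a)) := by
    refine tendsto_integral_of_dominated_convergence
      (fun x => |lap u x| * (u x ^ 2 + 1) ^ (a / 2)) (fun n => ?_) ?_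
      (fun n => ae_of_all _ fun x => ?_) (ae_of_all _ fun x => ?_)
    · have h1 : Continuous fun x => (u x ^ 2 + δ n) ^ ((a - 1) / 2) :=
        ((contDiff_sq_add_rpow (hδ n) _).continuous).comp hu.continuous
      exact (hu.lap.continuous.abs.mul (hu.continuous.abs.mul h1)).aestronglyMeasurable
    · have h1 : Continuous fun x => (u x ^ 2 + 1) ^ (a / 2) :=
        ((contDiff_sq_add_rpow one_pos _).continuous).comp hu.continuous
      exact (hu.lap.continuous.abs.mul h1).integrable_of_hasCompactSupport
        (HasCompactSupport.mul_right (hu.lap.2.comp_left (g := fun t => |t|) abs_zero))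
    · have hpos : 0 < u x ^ 2 + δ n := by have := hδ n; positivity
      rw [Real.norm_eq_abs, abs_of_nonneg (by positivity)]
      refine mul_le_mul_of_nonneg_left ?_ (abs_nonneg _)
      have h1 : |u x| ≤ (u x ^ 2 + δ n) ^ (1 / 2 : ℝ) := by
        rw [← Real.sqrt_eq_rpow]
        exact Real.abs_le_sqrt (by linarith [hδ n])
      calc |u x| * (u x ^ 2 + δ n) ^ ((a - 1) / 2)
          ≤ (u x ^ 2 + δ n) ^ (1 / 2 : ℝ) * (u x ^ 2 + δ n) ^ ((a - 1) / 2) := by gcongr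
        _ = (u x ^ 2 + δ n) ^ (a / 2) := by
          rw [← Real.rpow_add hpos]
          congr 1; ring
        _ ≤ _ := Real.rpow_le_rpow hpos.le (by linarith [hδ1 n]) (by positivity)
    · refine Tendsto.const_mul _ ?_
      rcases eq_or_ne (u x) 0 with h0 | h0
      · simp [h0, Real.zero_rpow ha.ne']
      · have h := ((tendsto_const_nhds (x := u x ^ 2)).add hδ0).rpow_const (p := (a - 1) / 2)
          (Or.inl (by positivity))
        have h' := h.const_mul |u x|
        have e : |u x| * (u x ^ 2 + 0) ^ ((a - 1) / 2) = |u x| ^ a := by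
          rw [add_zero, ← sq_abs, ← Real.rpow_natCast, ← Real.rpow_mul (abs_nonneg _)]
          have : ((2 : ℕ) : ℝ) * ((a - 1) / 2) = a - 1 := by push_cast; ring
          rw [this, mul_comm, ← Real.rpow_add_one (by positivity)]
          congr 1; ring
        rw [e] at h'
        exact h'
  have hL' := hL.rpow_const (p := ((N - 2) / N : ℝ)) (Or.inr (by positivity))
  exact le_of_tendsto_of_tendsto' hL' (hR.const_mul C) fun n => hS u hu (δ n) (hδ n)

end Sobolev

/-! ### The critical hyperbola and the second order Sobolev inequality -/

/-- The exponents of the problem: `p` and `q` lie on the critical hyperbola and `r = q'`. -/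
structure CriticalExponents (N : ℕ) (p q r : ℝ) : Prop where
  three_le : 3 ≤ N
  p_pos : 0 < p
  conj : r.HolderConjugate q
  hyperbola : 1 / p + 1 / q = ((N : ℝ) - 2) / N

namespace CriticalExponents

variable {N : ℕ} {p q r : ℝ} (E : CriticalExponents N p q r)
include E

theorem cast_three_le : (3 : ℝ) ≤ N := by exact_mod_cast E.three_le

theorem r_pos : 0 < r := E.conj.pos

theorem q_pos : 0 < q := E.conj.symm.pos

theorem one_lt_r : 1 < r := E.conj.lt

theorem one_div_r : 1 / r = 1 / p + 2 / N := by
  have h1 := E.conj.inv_add_inv_eq_one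
  have h2 := E.hyperbola
  have hN := E.cast_three_le
  have : ((N : ℝ) - 2) / N = 1 - 2 / N := by
    field_simp
  simp only [one_div] at *
  linarith

theorem r_lt_p : r < p := by
  have h := E.one_div_r
  have hN := E.cast_three_le
  have : 0 < 2 / (N : ℝ) := by positivity
  exact lt_of_one_div_lt_one_div E.p_pos (by linarith)

theorem one_lt_p : 1 < p := E.one_lt_r.trans E.r_lt_p

theorem lt_mul_q : (N : ℝ) < (N - 2) * q := by
  have h2 := E.hyperbola
  have hN := E.cast_three_le
  have hq := E.q_pos
  have : 0 < 1 / p := one_div_pos.2 E.p_pos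
  have h3 : 1 / q < ((N : ℝ) - 2) / N := by linarith
  rw [div_lt_div_iff₀ hq (by linarith)] at h3
  linarith

end CriticalExponents

section SobolevLp

variable {N : ℕ} {p q r : ℝ} {u : Space N → ℝ}

theorem eLpNorm_ofReal_eq {α : Type*} [MeasurableSpace α] {μ : Measure α} {s : ℝ} (hs : 0 < s)
    {f : α → ℝ} (hf : MemLp f (ENNReal.ofReal s) μ) :
    eLpNorm f (ENNReal.ofReal s) μ = ENNReal.ofReal ((∫ x, |f x| ^ s ∂μ) ^ (1 / s)) := by
  rw [hf.eLpNorm_eq_integral_rpow_norm (by simpa using hs) (by simp)]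
  simp [ENNReal.toReal_ofReal hs.le]

/-- The second order Sobolev inequality for test functions: in the energy estimate with `a = p/q`
the left-hand side is a power of `∫ |u|^p`, and Hölder's inequality bounds the right-hand side by
`‖Δu‖_r (∫ |u|^p)^(1/q)`, a lower power of it. -/
theorem exists_sobolev_isTest (E : CriticalExponents N p q r) :
    ∃ C : ℝ, 0 ≤ C ∧ ∀ u : Space N → ℝ, IsTest u →
      eLpNorm u (ENNReal.ofReal p) ≤ ENNReal.ofReal C * eLpNorm (lap u) (ENNReal.ofReal r) := by
  have hp := E.p_pos
  have hq := E.q_pos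
  have hr := E.r_pos
  have hN := E.cast_three_le
  obtain ⟨C, hC, hS⟩ := exists_energy_bound_limit E.three_le (a := p / q) (by positivity)
  refine ⟨C, hC, fun u hu => ?_⟩
  rw [eLpNorm_ofReal_eq hp (hu.memLp _), eLpNorm_ofReal_eq hr (hu.lap.memLp _),
    ← ENNReal.ofReal_mul hC]
  refine ENNReal.ofReal_le_ofReal ?_
  have h := hS u hu
  have e1 : (p / q + 1) * N / (N - 2) = p := by
    have h2 := E.hyperbola
    have : (N : ℝ) - 2 ≠ 0 := by linarith
    have h3 : p / q + 1 = p * (((N : ℝ) - 2) / N) := by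
      rw [← h2]; field_simp; ring
    rw [h3]; field_simp
  rw [e1, ← E.hyperbola] at h
  set I := ∫ x, |u x| ^ p
  have hI : 0 ≤ I := by positivity
  set Λ := (∫ x, |lap u x| ^ r) ^ (1 / r)
  have hΛ : 0 ≤ Λ := by positivity
  have hold : ∫ x, |lap u x| * |u x| ^ (p / q) ≤ Λ * I ^ (1 / q) := by
    have hm : MemLp (fun x => |u x| ^ (p / q)) (ENNReal.ofReal q) volume := by
      refine Continuous.memLp_of_hasCompactSupport
        (hu.continuous.abs.rpow_const fun x => Or.inr (by positivity)) ?_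
      exact hu.2.comp_left (g := fun t => |t| ^ (p / q))
        (by simp [Real.zero_rpow (by positivity : p / q ≠ 0)])
    have := integral_mul_le_Lp_mul_Lq_of_nonneg E.conj (μ := (volume : Measure (Space N)))
      (f := fun x => |lap u x|) (g := fun x => |u x| ^ (p / q))
      (ae_of_all _ fun x => abs_nonneg _) (ae_of_all _ fun x => by positivity)
      (hu.lap.memLp _).abs hm
    refine this.trans_eq ?_
    congr 2
    refine integral_congr_ae (ae_of_all _ fun x => ?_)
    simp only [← Real.rpow_mul (abs_nonneg _)]
    congr 1
    field_simp
  rcases hI.eq_or_lt with h0 | h0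
  · rw [← h0, Real.zero_rpow (by positivity)]
    positivity
  · have h1 : I ^ (1 / p) * I ^ (1 / q) ≤ C * Λ * I ^ (1 / q) := by
      rw [← Real.rpow_add h0, mul_assoc]
      exact h.trans (mul_le_mul_of_nonneg_left hold hC)
    exact le_of_mul_le_mul_right h1 (by positivity)

end SobolevLp

/-! ### Convolutions -/

section Convolution

variable {N : ℕ} {r : ℝ} {k u f : Space N → ℝ} {i : Fin N}

/-- The convolution `(k * u)(x) = ∫ k(x - y) u(y) dy`. -/
noncomputable def conv (k u : Space N → ℝ) (x : Space N) : ℝ := ∫ y, k (x - y) * u y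

theorem conv_eq_convolution (k u : Space N → ℝ) :
    conv k u = convolution u k (ContinuousLinearMap.mul ℝ ℝ) volume := by
  funext x
  simp [conv, convolution, mul_comm]

/-- Young's inequality `‖k * f‖_r ≤ ‖k‖_1 ‖f‖_r`. -/
theorem eLpNorm_conv_le {q : ℝ} (hrq : r.HolderConjugate q) (hk : Measurable k)
    (hf : AEStronglyMeasurable f volume) :
    eLpNorm (conv k f) (ENNReal.ofReal r) ≤ eLpNorm k 1 * eLpNorm f (ENNReal.ofReal r) := by
  have hr := hrq.pos
  have hq := hrq.symm.pos
  set κ := eLpNorm k 1 (volume : Measure (Space N)) with hκ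
  rw [eLpNorm_one_eq_lintegral_enorm] at hκ
  have hk' : ∀ x, ∫⁻ y, ‖k (x - y)‖ₑ = κ := fun x => by
    rw [hκ]
    exact lintegral_sub_left_eq_self (fun y => ‖k y‖ₑ) x
  have hfe : AEMeasurable (fun y => ‖f y‖ₑ) volume := hf.enorm
  have hpt : ∀ x, ‖conv k f x‖ₑ ^ r ≤ κ ^ (r / q) * ∫⁻ y, ‖k (x - y)‖ₑ * ‖f y‖ₑ ^ r := fun x => by
    have hkx : Measurable fun y => ‖k (x - y)‖ₑ :=
      (hk.comp (measurable_const.sub measurable_id)).enorm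
    have h1 : ‖conv k f x‖ₑ ≤ ∫⁻ y, ‖k (x - y)‖ₑ ^ (1 / q) * (‖k (x - y)‖ₑ ^ (1 / r) * ‖f y‖ₑ) := by
      refine (enorm_integral_le_lintegral_enorm _).trans_eq (lintegral_congr fun y => ?_)
      rw [← mul_assoc, ← ENNReal.rpow_add_of_nonneg _ _ (by positivity) (by positivity), enorm_mul]
      have := hrq.symm.inv_add_inv_eq_one
      simp only [one_div, this, ENNReal.rpow_one]
    have h2 := ENNReal.lintegral_mul_le_Lp_mul_Lq (volume : Measure (Space N)) hrq.symm
      (f := fun y => ‖k (x - y)‖ₑ ^ (1 / q)) (g := fun y => ‖k (x - y)‖ₑ ^ (1 / r) * ‖f y‖ₑ)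
      (hkx.pow_const _).aemeasurable ((hkx.pow_const _).aemeasurable.mul hfe)
    have h3 := ENNReal.rpow_le_rpow (h1.trans h2) hr.le
    refine h3.trans_eq ?_
    rw [ENNReal.mul_rpow_of_nonneg _ _ hr.le, ← ENNReal.rpow_mul, ← ENNReal.rpow_mul]
    congr 1
    · simp_rw [← ENNReal.rpow_mul]
      rw [one_div_mul_cancel hq.ne']
      simp_rw [ENNReal.rpow_one]
      rw [hk']
      congr 1; field_simp
    · rw [one_div_mul_cancel hr.ne', ENNReal.rpow_one]
      refine lintegral_congr fun y => ?_
      rw [ENNReal.mul_rpow_of_nonneg _ _ hr.le, ← ENNReal.rpow_mul, one_div_mul_cancel hr.ne',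
        ENNReal.rpow_one]
  have htot : ∫⁻ x, ‖conv k f x‖ₑ ^ r ≤ κ ^ r * ∫⁻ y, ‖f y‖ₑ ^ r := by
    refine (lintegral_mono hpt).trans ?_
    have hm : AEMeasurable (Function.uncurry fun x y : Space N => ‖k (x - y)‖ₑ * ‖f y‖ₑ ^ r)
        (volume.prod volume) := by
      refine AEMeasurable.mul ?_ ?_
      · exact ((hk.comp (measurable_fst.sub measurable_snd)).enorm).aemeasurable
      · exact (hfe.comp_snd (μ := (volume : Measure (Space N)))).pow_const r
    have hm' : AEMeasurable (fun x => ∫⁻ y, ‖k (x - y)‖ₑ * ‖f y‖ₑ ^ r) volume :=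
      hm.lintegral_prod_right'
    rw [lintegral_const_mul'' _ hm', lintegral_lintegral_swap hm]
    have hx : ∀ y, ∫⁻ x, ‖k (x - y)‖ₑ * ‖f y‖ₑ ^ r = κ * ‖f y‖ₑ ^ r := fun y => by
      have hky : Measurable fun x => ‖k (x - y)‖ₑ :=
        (hk.comp (measurable_id.sub measurable_const)).enorm
      rw [lintegral_mul_const _ hky]
      congr 1
      rw [hκ]
      exact lintegral_sub_right_eq_self (fun x => ‖k x‖ₑ) y
    simp_rw [hx]
    rw [lintegral_const_mul'' _ (hfe.pow_const r), ← mul_assoc]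
    gcongr
    nth_rewrite 2 [← ENNReal.rpow_one κ]
    rw [← ENNReal.rpow_add_of_nonneg _ _ (by positivity) zero_le_one]
    have : r / q + 1 = r := by
      have := hrq.inv_add_inv_eq_one
      field_simp at this ⊢
      linarith
    rw [this]
  rw [eLpNorm_eq_lintegral_rpow_enorm_toReal (by simpa using hr) (by simp),
    eLpNorm_eq_lintegral_rpow_enorm_toReal (by simpa using hr) (by simp),
    ENNReal.toReal_ofReal hr.le]
  refine (ENNReal.rpow_le_rpow htot (by positivity)).trans_eq ?_
  rw [ENNReal.mul_rpow_of_nonneg _ _ (by positivity), ← ENNReal.rpow_mul,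
    mul_one_div_cancel hr.ne', ENNReal.rpow_one]

theorem continuous_conv (hk : Continuous k) (hkc : HasCompactSupport k)
    (hu : LocallyIntegrable u volume) : Continuous (conv k u) := by
  rw [conv_eq_convolution]
  exact hkc.continuous_convolution_right _ hu hk

theorem contDiff_conv (hk : IsTest k) (hu : LocallyIntegrable u volume) :
    ContDiff ℝ (⊤ : ℕ∞) (conv k u) := by
  rw [conv_eq_convolution]
  exact hk.2.contDiff_convolution_right _ hu hk.1

theorem pd_conv (hk : IsTest k) (hu : LocallyIntegrable u volume) :
    pd i (conv k u) = conv (pd i k) u := by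
  funext x
  have h := hk.2.hasFDerivAt_convolution_right (ContinuousLinearMap.mul ℝ ℝ) hu
    (hk.1.of_le (by exact_mod_cast le_top)) x
  rw [← conv_eq_convolution] at h
  rw [pd, h.fderiv]
  have hci : ConvolutionExistsAt u (fderiv ℝ k) x
      ((ContinuousLinearMap.mul ℝ ℝ).precompR (Space N)) volume :=
    (hk.2.fderiv ℝ).convolutionExists_right _ hu (hk.1.continuous_fderiv (by simp)) x
  rw [convolution, ContinuousLinearMap.integral_apply hci]
  simp [conv, pd, mul_comm]

theorem lap_conv (hk : IsTest k) (hu : LocallyIntegrable u volume) :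
    lap (conv k u) = conv (lap k) u := by
  funext x
  simp only [lap, conv, Finset.sum_mul]
  rw [integral_finsetSum]
  · refine Finset.sum_congr rfl fun i _ => ?_
    change pd i (pd i (conv k u)) x = conv (pd i (pd i k)) u x
    rw [pd_conv hk hu, pd_conv (hk.pd i) hu]
  · intro i _
    have := hu.integrable_mul_isTest (((hk.pd i).pd i).comp_sub_left x)
    simpa only [mul_comm] using this

/-- The Laplacian of a convolution may be put on the second factor. -/
theorem conv_lap_eq (hk : IsTest k) (hu : TwiceWeaklyDifferentiable u) :
    conv (lap k) u = conv k (weakLaplacian u) := by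
  funext x
  have h := hu.integral_mul_lap (hk.comp_sub_left x)
  rw [lap_comp_sub_left hk.1] at h
  simpa only [conv, mul_comm] using h

theorem hasCompactSupport_conv (hk : HasCompactSupport k) (hu : HasCompactSupport u) :
    HasCompactSupport (conv k u) := by
  rw [conv_eq_convolution]
  exact hu.convolution _ hk

end Convolution

/-! ### Mollification -/

section ApproximateIdentity

variable {N : ℕ} {p q r : ℝ} {ρ u : Space N → ℝ}

/-- The rescaled kernel `δ⁻ˢ e(x/δ)`. The exponent `s = N` preserves the integral, whereas
`s = N - 2` preserves the Newtonian kernel. -/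
noncomputable def rescale (s : ℕ) (e : Space N → ℝ) (δ : ℝ) (x : Space N) : ℝ :=
  (δ ^ s)⁻¹ * e (δ⁻¹ • x)

theorem contDiff_rescale {s : ℕ} {e : Space N → ℝ} (he : ContDiff ℝ (⊤ : ℕ∞) e) (δ : ℝ) :
    ContDiff ℝ (⊤ : ℕ∞) (rescale s e δ) :=
  contDiff_const.mul (he.comp (contDiff_const_smul _))

theorem continuous_rescale {s : ℕ} {e : Space N → ℝ} (he : Continuous e) (δ : ℝ) :
    Continuous (rescale s e δ) :=
  continuous_const.mul (he.comp (continuous_const_smul _))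

theorem hasCompactSupport_rescale {s : ℕ} {e : Space N → ℝ} (he : HasCompactSupport e) {δ : ℝ}
    (hδ : 0 < δ) : HasCompactSupport (rescale s e δ) :=
  (he.comp_homeomorph (Homeomorph.smulOfNeZero δ⁻¹ (inv_pos.2 hδ).ne')).mul_left

theorem isTest_rescale {s : ℕ} {e : Space N → ℝ} (he : IsTest e) {δ : ℝ} (hδ : 0 < δ) :
    IsTest (rescale s e δ) :=
  ⟨contDiff_rescale he.1 δ, hasCompactSupport_rescale he.2 hδ⟩

theorem integral_rescale (ρ : Space N → ℝ) {δ : ℝ} (hδ : 0 < δ) :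
    ∫ x, rescale N ρ δ x = ∫ x, ρ x := by
  simp only [rescale]
  rw [integral_const_mul, Measure.integral_comp_inv_smul_of_nonneg _ _ hδ.le]
  have : δ ^ N ≠ 0 := by positivity
  simp [this]

/-- A mollified function converges at every Lebesgue point. -/
theorem ae_tendsto_conv_rescale (hρ : Continuous ρ) (hρc : HasCompactSupport ρ)
    (hu : LocallyIntegrable u volume) :
    ∀ᵐ x, ∀ δ : ℕ → ℝ, Tendsto δ atTop (𝓝[>] 0) →
      Tendsto (fun n => conv (rescale N ρ (δ n)) u x) atTop (𝓝 ((∫ y, ρ y) * u x)) := by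
  obtain ⟨R, hR, hRs⟩ : ∃ R : ℝ, 0 < R ∧ tsupport ρ ⊆ Metric.closedBall 0 R := by
    obtain ⟨R, hR⟩ := hρc.isBounded.subset_closedBall (0 : Space N)
    exact ⟨max R 1, by positivity, hR.trans (Metric.closedBall_subset_closedBall (le_max_left _ _))⟩
  obtain ⟨M, hM⟩ := hρ.bounded_above_of_compact_support hρc
  have hM0 : 0 ≤ M := (norm_nonneg _).trans (hM 0)
  filter_upwards [IsUnifLocDoublingMeasure.ae_tendsto_average_norm_sub
    (volume : Measure (Space N)) hu 1] with x hx δ hδ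
  have hδpos : ∀ᶠ n in atTop, 0 < δ n := hδ self_mem_nhdsWithin
  have hRδ : Tendsto (fun n => R * δ n) atTop (𝓝[>] 0) := by
    refine tendsto_nhdsWithin_iff.2 ⟨?_, ?_⟩
    · simpa using (tendsto_nhds_of_tendsto_nhdsWithin hδ).const_mul R
    · filter_upwards [hδpos] with n hn
      exact mul_pos hR hn
  have h1 := hx (fun _ => x) (fun n => R * δ n) hRδ (by
    filter_upwards [hδpos] with n hn
    exact Metric.mem_closedBall_self (by positivity))
  set ω := (volume : Measure (Space N)).real (Metric.ball 0 1)
  have h2 := h1.const_mul (M * (R ^ N * ω))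
  rw [mul_zero] at h2
  rw [tendsto_iff_norm_sub_tendsto_zero]
  refine squeeze_zero' (Eventually.of_forall fun n => norm_nonneg _) ?_ h2
  filter_upwards [hδpos] with n hn
  have hk : Continuous fun y => rescale N ρ (δ n) (x - y) :=
    (continuous_rescale hρ _).comp (continuous_const.sub continuous_id)
  have hkc : HasCompactSupport fun y => rescale N ρ (δ n) (x - y) :=
    (hasCompactSupport_rescale hρc hn).comp_homeomorph (Homeomorph.subLeft x)
  have i1 : Integrable fun y => rescale N ρ (δ n) (x - y) * u y := by
    simpa using hu.integrable_smul_left_of_hasCompactSupport hk hkc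
  have i2 : Integrable fun y => rescale N ρ (δ n) (x - y) * u x :=
    (hk.integrable_of_hasCompactSupport hkc).mul_const _
  have e1 : conv (rescale N ρ (δ n)) u x - (∫ y, ρ y) * u x =
      ∫ y, rescale N ρ (δ n) (x - y) * (u y - u x) := by
    simp only [mul_sub]
    rw [integral_sub i1 i2, integral_mul_const,
      integral_sub_left_eq_self (fun y => rescale N ρ (δ n) y), integral_rescale ρ hn]
    rfl
  set B := Metric.closedBall x (R * δ n)
  have hsupp : ∀ y, y ∉ B → rescale N ρ (δ n) (x - y) = 0 := fun y hy => by
    have : (δ n)⁻¹ • (x - y) ∉ tsupport ρ := fun h => by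
      have h3 := hRs h
      rw [mem_closedBall_zero_iff, norm_smul, norm_inv, Real.norm_of_nonneg hn.le] at h3
      refine hy ?_
      rw [Metric.mem_closedBall, dist_comm, dist_eq_norm]
      rwa [inv_mul_le_iff₀ hn, mul_comm] at h3
    simp [rescale, image_eq_zero_of_notMem_tsupport this]
  have e2 : ∫ y, rescale N ρ (δ n) (x - y) * (u y - u x) =
      ∫ y in B, rescale N ρ (δ n) (x - y) * (u y - u x) := by
    rw [setIntegral_eq_integral_of_forall_compl_eq_zero]
    intro y hy
    rw [hsupp y hy, zero_mul]
  have hB : volume.real B = R ^ N * δ n ^ N * ω := by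
    rw [Measure.real, Measure.addHaar_closedBall _ _ (by positivity), ENNReal.toReal_mul,
      ENNReal.toReal_ofReal (by positivity)]
    simp [ω, Measure.real, mul_pow]
  have hint : IntegrableOn (fun y => ‖u y - u x‖) B :=
    ((hu.integrableOn_isCompact (isCompact_closedBall _ _)).sub
      (integrableOn_const (by simp [measure_closedBall_lt_top.ne]))).norm
  rw [e1, e2, setAverage_eq, hB, smul_eq_mul]
  have hδN : δ n ^ N ≠ 0 := by positivity
  have hωpos : 0 < ω := by
    simp only [ω, Measure.real]
    exact ENNReal.toReal_pos (Metric.measure_ball_pos _ _ one_pos).ne' measure_ball_lt_top.ne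
  have e3 : M * (R ^ N * ω) * ((R ^ N * δ n ^ N * ω)⁻¹ * ∫ y in B, ‖u y - u x‖) =
      ∫ y in B, M * (δ n ^ N)⁻¹ * ‖u y - u x‖ := by
    rw [integral_const_mul]
    have : R ^ N ≠ 0 := by positivity
    field_simp
  rw [e3]
  refine norm_integral_le_of_norm_le (hint.const_mul _) (ae_of_all _ fun y => ?_)
  rw [norm_mul, rescale, norm_mul, norm_inv, norm_pow, Real.norm_of_nonneg hn.le,
    mul_comm (δ n ^ N)⁻¹]
  gcongr
  exact hM _

/-- The second order Sobolev inequality for compactly supported weakly differentiable functions,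
obtained by mollification and Fatou's lemma. -/
theorem exists_sobolev_hasCompactSupport (E : CriticalExponents N p q r) :
    ∃ C : ℝ, 0 ≤ C ∧ ∀ u : Space N → ℝ, TwiceWeaklyDifferentiable u → HasCompactSupport u →
      eLpNorm u (ENNReal.ofReal p) ≤
        ENNReal.ofReal C * eLpNorm (weakLaplacian u) (ENNReal.ofReal r) := by
  obtain ⟨C, hC, hS⟩ := exists_sobolev_isTest E
  refine ⟨C, hC, fun u hu huc => ?_⟩
  have hloc := hu.locallyIntegrable (by have := E.three_le; omega)
  let φ : ContDiffBump (0 : Space N) := ⟨1, 2, one_pos, one_lt_two⟩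
  set ρ : Space N → ℝ := φ.normed volume
  have hρ : IsTest ρ := ⟨φ.contDiff_normed, φ.hasCompactSupport_normed⟩
  have hρ1 : ∫ x, ρ x = 1 := φ.integral_normed
  have hρ0 : ∀ x, 0 ≤ ρ x := φ.nonneg_normed
  set δ : ℕ → ℝ := fun n => 1 / ((n : ℝ) + 1)
  have hδ : ∀ n, 0 < δ n := fun n => by positivity
  have hδ0 : Tendsto δ atTop (𝓝[>] 0) := tendsto_nhdsWithin_iff.2
    ⟨tendsto_one_div_add_atTop_nhds_zero_nat, Eventually.of_forall hδ⟩
  have hk : ∀ n, IsTest (rescale N ρ (δ n)) := fun n => isTest_rescale hρ (hδ n)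
  have hk1 : ∀ n, eLpNorm (rescale N ρ (δ n)) 1 (volume : Measure (Space N)) = 1 := fun n => by
    rw [eLpNorm_one_eq_lintegral_enorm]
    have h0 : ∀ x, 0 ≤ rescale N ρ (δ n) x := fun x =>
      mul_nonneg (by have := hδ n; positivity) (hρ0 _)
    have h1 := ofReal_integral_eq_lintegral_ofReal
      (μ := (volume : Measure (Space N)))
      ((hk n).continuous.integrable_of_hasCompactSupport (hk n).2) (ae_of_all _ h0)
    rw [integral_rescale _ (hδ n), hρ1, ENNReal.ofReal_one] at h1
    rw [h1]
    exact lintegral_congr fun x => Real.enorm_of_nonneg (h0 x)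
  refine Lp.eLpNorm_le_of_ae_tendsto (u := atTop)
    (f := fun n => conv (rescale N ρ (δ n)) u) (Eventually.of_forall fun n => ?_)
    (fun n => (continuous_conv (hk n).continuous (hk n).2 hloc).aestronglyMeasurable) ?_
  · refine (hS _ ⟨contDiff_conv (hk n) hloc, hasCompactSupport_conv (hk n).2 huc⟩).trans ?_
    rw [lap_conv (hk n) hloc, conv_lap_eq (hk n) hu]
    gcongr
    refine (eLpNorm_conv_le E.conj (hk n).continuous.measurable
      hu.locallyIntegrable_weakLaplacian.aestronglyMeasurable).trans_eq ?_
    rw [hk1, one_mul]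
  · filter_upwards [ae_tendsto_conv_rescale hρ.continuous hρ.2 hloc] with x hx
    simpa [hρ1] using hx δ hδ0

end ApproximateIdentity

/-! ### A regularised Newtonian kernel -/

section Rescale

variable {N : ℕ} {e : Space N → ℝ} {s : ℕ} {i : Fin N}

theorem pd_rescale (he : ContDiff ℝ (⊤ : ℕ∞) e) (δ : ℝ) :
    pd i (rescale s e δ) = rescale (s + 1) (pd i e) δ := by
  funext x
  have h1 : HasFDerivAt (fun x : Space N => δ⁻¹ • x)
      (δ⁻¹ • ContinuousLinearMap.id ℝ (Space N)) x := (hasFDerivAt_id x).const_smul δ⁻¹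
  have h2 := (((he.differentiable (by simp)) (δ⁻¹ • x)).hasFDerivAt.comp x h1).const_mul
    (δ ^ s)⁻¹
  change fderiv ℝ (fun x => (δ ^ s)⁻¹ * (e ∘ fun x => δ⁻¹ • x) x) x _ = _
  rw [h2.fderiv]
  simp [pd, rescale, pow_succ]
  ring

theorem lap_rescale (he : ContDiff ℝ (⊤ : ℕ∞) e) (δ : ℝ) :
    lap (rescale s e δ) = rescale (s + 2) (lap e) δ := by
  funext x
  simp only [lap, pd_rescale he, pd_rescale (he.pd _)]
  simp only [rescale, lap, Finset.mul_sum]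

/-- A bound `|e(x)| ≤ M (1 + ‖x‖)⁻ˢ` rescales to `|e_δ(x)| ≤ M (δ + ‖x‖)⁻ˢ`. -/
theorem abs_rescale_le {M δ : ℝ} (hδ : 0 < δ) (h : ∀ x, |e x| ≤ M * ((1 + ‖x‖) ^ s)⁻¹)
    (x : Space N) : |rescale s e δ x| ≤ M * ((δ + ‖x‖) ^ s)⁻¹ := by
  rw [rescale, abs_mul, abs_of_pos (by positivity)]
  refine (mul_le_mul_of_nonneg_left (h _) (by positivity)).trans_eq ?_
  rw [norm_smul, norm_inv, Real.norm_of_nonneg hδ.le]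
  have : δ + ‖x‖ = δ * (1 + δ⁻¹ * ‖x‖) := by field_simp
  rw [this, mul_pow, mul_inv]
  ring

end Rescale

/-- The properties of a kernel `e` on which the potential representation rests: it is smooth,
decays like `‖x‖⁻ˢ`, agrees with its rescalings `δ⁻ˢ e(·/δ)` away from a ball, and its Laplacian
has compact support. -/
structure IsPotentialKernel {N : ℕ} (s : ℕ) (e : Space N → ℝ) : Prop where
  contDiff : ContDiff ℝ (⊤ : ℕ∞) e
  exists_bound : ∃ M, 0 ≤ M ∧ ∀ x, |e x| ≤ M * ((1 + ‖x‖) ^ s)⁻¹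
  rescale_eq : ∀ δ R : ℝ, 0 < δ → 0 < R → ∀ x, δ < ‖x‖ → R < ‖x‖ →
    rescale s e δ x = rescale s e R x
  isTest_lap : IsTest (lap e)

section PotentialKernel

variable {N : ℕ} {e : Space N → ℝ} {s : ℕ} {i : Fin N}

/-- A continuous function which agrees with its rescalings away from a ball decays. -/
theorem exists_decay_of_rescale_eq (he : Continuous e)
    (h : ∀ δ R : ℝ, 0 < δ → 0 < R → ∀ x, δ < ‖x‖ → R < ‖x‖ → rescale s e δ x = rescale s e R x) :
    ∃ M, 0 ≤ M ∧ ∀ x, |e x| ≤ M * ((1 + ‖x‖) ^ s)⁻¹ := by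
  obtain ⟨M, hM⟩ := (isCompact_closedBall (0 : Space N) 2).exists_bound_of_continuousOn
    he.continuousOn
  have hM0 : 0 ≤ M := (norm_nonneg _).trans (hM 0 (by simp))
  refine ⟨M * 3 ^ s, by positivity, fun x => ?_⟩
  rw [mul_assoc, ← inv_inv (3 ^ s : ℝ), ← mul_inv]
  rcases le_or_gt ‖x‖ 2 with hx | hx
  · have h1 := hM x (by simpa using hx)
    rw [Real.norm_eq_abs] at h1
    refine h1.trans (le_mul_of_one_le_right hM0 ?_)
    rw [one_le_inv₀ (by positivity), inv_mul_le_iff₀ (by positivity), mul_one]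
    exact pow_le_pow_left₀ (by positivity) (by linarith) _
  · -- compare with the rescaling for which `x` lies on the sphere of radius `2`
    have hR : 0 < ‖x‖ / 2 := by positivity
    have h1 := h 1 (‖x‖ / 2) one_pos hR x (by linarith) (by linarith)
    have h2 : |e ((‖x‖ / 2)⁻¹ • x)| ≤ M := hM _ (by
      rw [mem_closedBall_zero_iff, norm_smul, norm_inv, Real.norm_of_nonneg hR.le]
      field_simp
      exact le_rfl)
    simp only [rescale, one_pow, inv_one, one_mul, one_smul] at h1
    rw [h1, abs_mul, abs_of_pos (by positivity), mul_comm]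
    refine mul_le_mul h2 ?_ (by positivity) hM0
    rw [inv_le_inv₀ (by positivity) (by positivity), inv_mul_le_iff₀ (by positivity), ← mul_pow]
    exact pow_le_pow_left₀ (by positivity) (by linarith) _

theorem IsPotentialKernel.isTest_sub (he : IsPotentialKernel s e) {δ R : ℝ} (hδ : 0 < δ)
    (hR : 0 < R) : IsTest fun x => rescale s e δ x - rescale s e R x := by
  refine ⟨(contDiff_rescale he.contDiff δ).sub (contDiff_rescale he.contDiff R), ?_⟩
  refine HasCompactSupport.intro (isCompact_closedBall (0 : Space N) (max δ R)) fun x hx => ?_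
  rw [mem_closedBall_zero_iff, not_le, max_lt_iff] at hx
  rw [he.rescale_eq δ R hδ hR x hx.1 hx.2, sub_self]

/-- Partial derivatives of a potential kernel are potential kernels. -/
theorem IsPotentialKernel.pd (he : IsPotentialKernel s e) (i : Fin N) :
    IsPotentialKernel (s + 1) (pd i e) := by
  have hr : ∀ δ R : ℝ, 0 < δ → 0 < R → ∀ x, δ < ‖x‖ → R < ‖x‖ →
      rescale (s + 1) (LaneEmden.pd i e) δ x = rescale (s + 1) (LaneEmden.pd i e) R x := by
    intro δ R hδ hR x h1 h2
    rw [← pd_rescale he.contDiff, ← pd_rescale he.contDiff]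
    have : rescale s e δ =ᶠ[𝓝 x] rescale s e R := by
      filter_upwards [(isOpen_lt continuous_const continuous_norm).mem_nhds h1,
        (isOpen_lt continuous_const continuous_norm).mem_nhds h2] with y hy1 hy2
      exact he.rescale_eq δ R hδ hR y hy1 hy2
    simp only [LaneEmden.pd, this.fderiv_eq]
  exact ⟨he.contDiff.pd i, exists_decay_of_rescale_eq (he.contDiff.pd i).continuous hr, hr,
    by rw [lap_pd he.contDiff]; exact he.isTest_lap.pd i⟩

end PotentialKernel

section Newton

variable {N : ℕ}

/-- A smooth function on the line, bounded below by `1/2`, equal to `t` for `t ≥ 1`. -/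
noncomputable def clampedId (t : ℝ) : ℝ :=
  Real.smoothTransition (2 * t - 1) * t + (1 - Real.smoothTransition (2 * t - 1))

theorem contDiff_clampedId : ContDiff ℝ (⊤ : ℕ∞) clampedId := by
  have h : ContDiff ℝ (⊤ : ℕ∞) fun t : ℝ => Real.smoothTransition (2 * t - 1) :=
    Real.smoothTransition.contDiff.comp (by fun_prop)
  exact (h.mul contDiff_id).add (contDiff_const.sub h)

theorem clampedId_of_one_le {t : ℝ} (ht : 1 ≤ t) : clampedId t = t := by
  simp [clampedId, Real.smoothTransition.one_of_one_le (by linarith : 1 ≤ 2 * t - 1)]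

theorem clampedId_pos (t : ℝ) : 0 < clampedId t := by
  rcases le_or_gt t (1 / 2) with h | h
  · simp [clampedId, Real.smoothTransition.zero_of_nonpos (by linarith : 2 * t - 1 ≤ 0)]
  · have h0 := Real.smoothTransition.nonneg (2 * t - 1)
    have h1 := Real.smoothTransition.le_one (2 * t - 1)
    have : clampedId t = 1 - Real.smoothTransition (2 * t - 1) * (1 - t) := by
      rw [clampedId]; ring
    rw [this]
    nlinarith

/-- The radial profile of the kernel: a smooth function of `t = ‖x‖²`, equal to `t^((2-N)/2)` for
`t ≥ 1`. -/
noncomputable def profile (N : ℕ) (t : ℝ) : ℝ := clampedId t ^ (-((N : ℝ) - 2) / 2)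

theorem contDiff_profile (N : ℕ) : ContDiff ℝ (⊤ : ℕ∞) (profile N) :=
  contDiff_clampedId.rpow_const_of_ne fun t => (clampedId_pos t).ne'

theorem profile_of_one_le {t : ℝ} (ht : 1 ≤ t) : profile N t = t ^ (-((N : ℝ) - 2) / 2) := by
  rw [profile, clampedId_of_one_le ht]

theorem deriv_profile {t : ℝ} (ht : 1 < t) :
    deriv (profile N) t = (-((N : ℝ) - 2) / 2) * t ^ (-((N : ℝ) - 2) / 2 - 1) := by
  have h : profile N =ᶠ[𝓝 t] fun t => t ^ (-((N : ℝ) - 2) / 2) := by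
    filter_upwards [lt_mem_nhds ht] with y hy
    exact profile_of_one_le hy.le
  rw [h.deriv_eq]
  exact (Real.hasDerivAt_rpow_const (Or.inl (by linarith))).deriv

theorem deriv_deriv_profile {t : ℝ} (ht : 1 < t) :
    deriv (deriv (profile N)) t = (-((N : ℝ) - 2) / 2) *
      ((-((N : ℝ) - 2) / 2 - 1) * t ^ (-((N : ℝ) - 2) / 2 - 1 - 1)) := by
  have h : deriv (profile N) =ᶠ[𝓝 t]
      fun t => (-((N : ℝ) - 2) / 2) * t ^ (-((N : ℝ) - 2) / 2 - 1) := by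
    filter_upwards [lt_mem_nhds ht] with y hy
    exact deriv_profile hy
  rw [h.deriv_eq]
  exact ((Real.hasDerivAt_rpow_const (Or.inl (by linarith))).const_mul _).deriv

/-- The Newtonian kernel `‖x‖^(2-N)`, smoothed inside the unit ball. -/
noncomputable def newton (N : ℕ) (x : Space N) : ℝ := profile N (‖x‖ ^ 2)

theorem contDiff_newton (N : ℕ) : ContDiff ℝ (⊤ : ℕ∞) (newton N) :=
  (contDiff_profile N).comp (contDiff_norm_sq ℝ)

theorem newton_of_one_le {x : Space N} (hN : 2 ≤ N) (hx : 1 ≤ ‖x‖) :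
    newton N x = (‖x‖ ^ (N - 2))⁻¹ := by
  have h0 : 0 < ‖x‖ := by linarith
  rw [newton, profile_of_one_le (one_le_pow₀ hx), ← Real.rpow_natCast, ← Real.rpow_mul h0.le,
    ← Real.rpow_natCast, ← Real.rpow_neg h0.le]
  congr 1
  push_cast [hN]
  ring

theorem pd_radial {G : ℝ → ℝ} (hG : ContDiff ℝ (⊤ : ℕ∞) G) (i : Fin N) :
    pd i (fun x : Space N => G (‖x‖ ^ 2)) = fun x => 2 * (x i) * deriv G (‖x‖ ^ 2) := by
  funext x
  have h := ((hG.differentiable (by simp)) (‖x‖ ^ 2)).hasDerivAt.comp_hasFDerivAt x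
    (hasStrictFDerivAt_norm_sq x).hasFDerivAt
  change fderiv ℝ (G ∘ fun x => ‖x‖ ^ 2) x _ = _
  rw [h.fderiv]
  simp [EuclideanSpace.inner_single_right]
  ring

theorem contDiff_coord (i : Fin N) : ContDiff ℝ (⊤ : ℕ∞) fun x : Space N => x i :=
  (EuclideanSpace.proj i : Space N →L[ℝ] ℝ).contDiff

theorem lap_radial {G : ℝ → ℝ} (hG : ContDiff ℝ (⊤ : ℕ∞) G) (x : Space N) :
    lap (fun x : Space N => G (‖x‖ ^ 2)) x =
      4 * ‖x‖ ^ 2 * deriv (deriv G) (‖x‖ ^ 2) + 2 * N * deriv G (‖x‖ ^ 2) := by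
  have hG' : ContDiff ℝ (⊤ : ℕ∞) (deriv G) := (contDiff_infty_iff_deriv.1 hG).2
  have hc : ∀ i : Fin N, pd i (fun x : Space N => 2 * x i) x = 2 := fun i => by
    have h : HasFDerivAt (fun x : Space N => 2 * x i)
        ((2 : ℝ) • (EuclideanSpace.proj i : Space N →L[ℝ] ℝ)) x :=
      (EuclideanSpace.proj i : Space N →L[ℝ] ℝ).hasFDerivAt.const_mul 2
    rw [pd, h.fderiv]
    simp
  have h : ∀ i : Fin N, pd i (pd i fun x : Space N => G (‖x‖ ^ 2)) x =
      4 * (x i) ^ 2 * deriv (deriv G) (‖x‖ ^ 2) + 2 * deriv G (‖x‖ ^ 2) := fun i => by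
    have h1 : ContDiff ℝ (⊤ : ℕ∞) fun x : Space N => deriv G (‖x‖ ^ 2) :=
      hG'.comp (contDiff_norm_sq ℝ)
    rw [pd_radial hG, pd_mul h1 (contDiff_const.mul (contDiff_coord i)), pd_radial hG']
    simp only [hc]
    ring
  simp only [lap, h, Finset.sum_add_distrib, ← Finset.sum_mul, ← Finset.mul_sum]
  rw [EuclideanSpace.norm_sq_eq]
  simp only [Real.norm_eq_abs, sq_abs, Finset.sum_const, Finset.card_univ, Fintype.card_fin,
    nsmul_eq_mul]
  ring

/-- The kernel is harmonic outside the unit ball. -/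
theorem lap_newton_of_one_lt {x : Space N} (hx : 1 < ‖x‖) : lap (newton N) x = 0 := by
  have h1 : 1 < ‖x‖ ^ 2 := by nlinarith
  have h0 : 0 < ‖x‖ ^ 2 := by linarith
  have := lap_radial (contDiff_profile N) x
  refine this.trans ?_
  rw [deriv_profile h1, deriv_deriv_profile h1]
  have e : (‖x‖ ^ 2) ^ (-((N : ℝ) - 2) / 2 - 1) =
      (‖x‖ ^ 2) ^ (-((N : ℝ) - 2) / 2 - 1 - 1) * ‖x‖ ^ 2 := by
    rw [← Real.rpow_add_one h0.ne']
    congr 1; ring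
  rw [e]
  ring

theorem isPotentialKernel_newton (hN : 2 ≤ N) : IsPotentialKernel (N - 2) (newton N) := by
  have hr : ∀ δ R : ℝ, 0 < δ → 0 < R → ∀ x : Space N, δ < ‖x‖ → R < ‖x‖ →
      rescale (N - 2) (newton N) δ x = rescale (N - 2) (newton N) R x := by
    have key : ∀ δ : ℝ, 0 < δ → ∀ x : Space N, δ < ‖x‖ →
        rescale (N - 2) (newton N) δ x = (‖x‖ ^ (N - 2))⁻¹ := by
      intro δ hδ x hx
      have hn : ‖δ⁻¹ • x‖ = δ⁻¹ * ‖x‖ := by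
        rw [norm_smul, norm_inv, Real.norm_of_nonneg hδ.le]
      rw [rescale, newton_of_one_le hN (by rw [hn, ← div_eq_inv_mul, one_le_div hδ]; exact hx.le),
        hn, ← mul_inv, ← mul_pow, mul_inv_cancel_left₀ hδ.ne']
    intro δ R hδ hR x h1 h2
    rw [key δ hδ x h1, key R hR x h2]
  refine ⟨contDiff_newton N, exists_decay_of_rescale_eq (contDiff_newton N).continuous hr, hr,
    (contDiff_newton N).lap, ?_⟩
  refine HasCompactSupport.intro (isCompact_closedBall (0 : Space N) 1) fun x hx => ?_
  rw [mem_closedBall_zero_iff, not_le] at hx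
  exact lap_newton_of_one_lt hx

/-- The total mass of `Δ` of the kernel is not zero (it is the flux of `∇‖x‖^(2-N)` through a
sphere). -/
theorem integral_lap_newton_ne_zero (hN : 3 ≤ N) : ∫ x, lap (newton N) x ≠ 0 := by
  have hne : Nonempty (Fin N) := ⟨⟨0, by omega⟩⟩
  have hN' : (3 : ℝ) ≤ N := by exact_mod_cast hN
  set G := profile N
  have hG : ContDiff ℝ (⊤ : ℕ∞) G := contDiff_profile N
  have hG' : ContDiff ℝ (⊤ : ℕ∞) (deriv G) := (contDiff_infty_iff_deriv.1 hG).2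
  set f : ℝ → ℝ := fun s => 4 * s ^ 2 * deriv (deriv G) (s ^ 2) + 2 * N * deriv G (s ^ 2) with hf
  have e1 : ∫ x, lap (newton N) x = ∫ x : Space N, f ‖x‖ :=
    integral_congr_ae (ae_of_all _ fun x => lap_radial hG x)
  have hzero : ∀ s, 1 < s → f s = 0 := fun s hs => by
    obtain ⟨i⟩ := hne
    have hn : ‖(EuclideanSpace.single i s : Space N)‖ = s := by
      simp [abs_of_pos (by linarith : 0 < s)]
    have h := lap_newton_of_one_lt (x := (EuclideanSpace.single i s : Space N))
      (by rw [hn]; exact hs)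
    rw [← h]
    refine Eq.trans ?_ (lap_radial hG _).symm
    rw [hn]
  rw [e1, integral_fun_norm_addHaar, finrank_euclideanSpace, Fintype.card_fin]
  have e2 : ∫ y in Set.Ioi (0 : ℝ), y ^ (N - 1) • f y =
      ∫ y in Set.Ioc (0 : ℝ) 2, y ^ (N - 1) • f y := by
    refine setIntegral_eq_of_subset_of_forall_sdiff_eq_zero measurableSet_Ioi
      Set.Ioc_subset_Ioi_self fun y hy => ?_
    have : 2 < y := by
      by_contra h
      exact hy.2 ⟨hy.1, not_lt.1 h⟩
    rw [hzero y (by linarith), smul_zero]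
  have hd : ∀ y : ℝ,
      HasDerivAt (fun y : ℝ => 2 * y ^ N * deriv G (y ^ 2)) (y ^ (N - 1) • f y) y := by
    intro y
    have h1 : HasDerivAt (fun y : ℝ => deriv G (y ^ 2)) (deriv (deriv G) (y ^ 2) * (2 * y)) y := by
      have := ((hG'.differentiable (by simp)) (y ^ 2)).hasDerivAt.comp y (hasDerivAt_pow 2 y)
      simp only [Nat.cast_ofNat, Nat.add_one_sub_one, pow_one] at this
      exact this
    have h2 := ((hasDerivAt_pow N y).const_mul 2).mul h1
    refine h2.congr_deriv ?_
    simp only [hf, smul_eq_mul]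
    have : y ^ N = y ^ (N - 1) * y := by
      rw [← pow_succ]; congr 1; omega
    rw [this]
    ring
  have hcf : Continuous fun y => y ^ (N - 1) • f y := by
    have c1 := (contDiff_infty_iff_deriv.1 hG').2.continuous
    have c2 := hG'.continuous
    simp only [hf]
    fun_prop
  rw [e2, ← intervalIntegral.integral_of_le (by norm_num),
    intervalIntegral.integral_eq_sub_of_hasDerivAt (fun y _ => hd y) (hcf.intervalIntegrable _ _)]
  have h4 : deriv G (2 ^ 2) ≠ 0 := by
    rw [deriv_profile (by norm_num)]
    have : (-((N : ℝ) - 2) / 2) ≠ 0 := by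
      intro h; linarith
    positivity
  have hω : volume.real (Metric.ball (0 : Space N) 1) ≠ 0 := by
    simp only [Measure.real]
    exact (ENNReal.toReal_pos (Metric.measure_ball_pos _ _ one_pos).ne' measure_ball_lt_top.ne).ne'
  have hN0 : N ≠ 0 := by omega
  simp only [nsmul_eq_mul, smul_eq_mul]
  rw [zero_pow hN0]
  simp [hω, hN0, h4]

end Newton

/-! ### Hölder's inequality -/

section Holder

variable {α : Type*} [MeasurableSpace α] {μ : Measure α} {f g : α → ℝ} {r q : ℝ}

theorem eLpNorm_mul_le (h : r.HolderConjugate q) (hf : AEStronglyMeasurable f μ)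
    (hg : AEStronglyMeasurable g μ) :
    eLpNorm (fun x => f x * g x) 1 μ ≤
      eLpNorm f (ENNReal.ofReal r) μ * eLpNorm g (ENNReal.ofReal q) μ := by
  have := h.ennrealOfReal
  have key := eLpNorm_le_eLpNorm_mul_eLpNorm_of_nnnorm (p := ENNReal.ofReal r)
    (q := ENNReal.ofReal q) (r := 1) hf hg (fun a b => a * b) 1 (ae_of_all _ fun x => by simp)
  simpa only [ENNReal.coe_one, one_mul] using key

theorem enorm_integral_mul_le (h : r.HolderConjugate q) (hf : AEStronglyMeasurable f μ)
    (hg : AEStronglyMeasurable g μ) :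
    ‖∫ x, f x * g x ∂μ‖ₑ ≤
      eLpNorm f (ENNReal.ofReal r) μ * eLpNorm g (ENNReal.ofReal q) μ := by
  refine le_trans ?_ (eLpNorm_mul_le h hf hg)
  rw [eLpNorm_one_eq_lintegral_enorm]
  exact enorm_integral_le_lintegral_enorm _

theorem integrable_mul_of_memLp (h : r.HolderConjugate q) (hf : MemLp f (ENNReal.ofReal r) μ)
    (hg : MemLp g (ENNReal.ofReal q) μ) : Integrable (fun x => f x * g x) μ := by
  have := h.ennrealOfReal
  exact hf.integrable_mul hg

theorem tendsto_eLpNorm_of_bounded [IsFiniteMeasure μ] (hr : 0 < r) {g : ℕ → α → ℝ} {C : ENNReal}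
    (hC : C ≠ ⊤) (hg : ∀ n, AEStronglyMeasurable (g n) μ) (hb : ∀ n x, ‖g n x‖ₑ ≤ C)
    (hl : ∀ x, Tendsto (fun n => g n x) atTop (𝓝 0)) :
    Tendsto (fun n => eLpNorm (g n) (ENNReal.ofReal r) μ) atTop (𝓝 0) := by
  have h : Tendsto (fun n => ∫⁻ x, ‖g n x‖ₑ ^ r ∂μ) atTop (𝓝 (∫⁻ _, 0 ∂μ)) := by
    refine tendsto_lintegral_of_dominated_convergence' (fun _ => C ^ r)
      (fun n => (hg n).enorm.pow_const r)
      (fun n => ae_of_all _ fun x => ENNReal.rpow_le_rpow (hb n x) hr.le) ?_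
      (ae_of_all _ fun x => ?_)
    · rw [lintegral_const]
      exact ENNReal.mul_ne_top (ENNReal.rpow_ne_top_of_nonneg hr.le hC) (measure_ne_top _ _)
    · have h1 := (hl x).enorm
      rw [enorm_zero] at h1
      have h2 := (ENNReal.continuous_rpow_const (y := r)).tendsto 0 |>.comp h1
      simpa [Function.comp_def, ENNReal.zero_rpow_of_pos hr] using h2
  rw [lintegral_zero] at h
  have h2 := (ENNReal.continuous_rpow_const (y := 1 / r)).tendsto 0 |>.comp h
  rw [ENNReal.zero_rpow_of_pos (by positivity)] at h2
  refine h2.congr fun n => ?_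
  rw [eLpNorm_eq_lintegral_rpow_enorm_toReal (by simpa using hr) (by simp),
    ENNReal.toReal_ofReal hr.le]
  rfl

end Holder

/-! ### Representation by potentials -/

section Representation

variable {N : ℕ} {p q r : ℝ} {e f u g : Space N → ℝ} {s : ℕ} {i : Fin N}

theorem memLp_decay {b : ℝ} (hb : 0 < b) (hs : (N : ℝ) < s * b) :
    MemLp (fun x : Space N => ((1 + ‖x‖) ^ s)⁻¹) (ENNReal.ofReal b) volume := by
  have hc : Continuous fun x : Space N => ((1 + ‖x‖) ^ s)⁻¹ :=
    Continuous.inv₀ (by fun_prop) fun x => by positivity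
  rw [← integrable_norm_rpow_iff hc.aestronglyMeasurable (by simpa using hb) (by simp)]
  have h := integrable_one_add_norm (E := Space N) (μ := volume) (r := s * b) (by simpa using hs)
  refine h.congr (ae_of_all _ fun x => ?_)
  simp only [ENNReal.toReal_ofReal hb.le, norm_inv, norm_pow]
  rw [Real.norm_of_nonneg (by positivity), ← Real.rpow_natCast, ← Real.rpow_neg (by positivity),
    ← Real.rpow_mul (by positivity)]
  congr 1; ring

theorem memLp_rescale {b : ℝ} (hb : 0 < b) (hs : (N : ℝ) < s * b) (he : Continuous e)
    (hM : ∃ M, 0 ≤ M ∧ ∀ x, |e x| ≤ M * ((1 + ‖x‖) ^ s)⁻¹) {δ : ℝ} (hδ : 0 < δ) :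
    MemLp (rescale s e δ) (ENNReal.ofReal b) volume := by
  obtain ⟨M, hM0, hM⟩ := hM
  have hm : 0 < min δ 1 := by positivity
  refine ((memLp_decay hb hs).const_mul (M * (min δ 1 ^ s)⁻¹)).mono
    (continuous_rescale he δ).aestronglyMeasurable (ae_of_all _ fun x => ?_)
  refine (abs_rescale_le hδ hM x).trans ((le_abs_self _).trans' ?_)
  rw [mul_assoc, ← mul_inv, ← mul_pow]
  refine mul_le_mul_of_nonneg_left ?_ hM0
  rw [inv_le_inv₀ (by positivity) (by positivity)]
  refine pow_le_pow_left₀ (by positivity) ?_ _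
  have h1 := min_le_left δ 1
  have h2 := min_le_right δ 1
  nlinarith [norm_nonneg x]

theorem exists_decay_of_isTest (he : IsTest e) (s : ℕ) :
    ∃ M, 0 ≤ M ∧ ∀ x, |e x| ≤ M * ((1 + ‖x‖) ^ s)⁻¹ := by
  have hc : Continuous fun x : Space N => (1 + ‖x‖) ^ s := by fun_prop
  obtain ⟨M, hM⟩ := (hc.mul he.continuous).bounded_above_of_compact_support he.2.mul_left
  refine ⟨M, (norm_nonneg _).trans (hM 0), fun x => ?_⟩
  have h := hM x
  rw [Pi.mul_apply, norm_mul, Real.norm_of_nonneg (by positivity), Real.norm_eq_abs] at h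
  rwa [← div_eq_mul_inv, le_div_iff₀ (by positivity), mul_comm]

theorem memLp_comp_sub_left {b : ENNReal} (he : MemLp e b volume) (x : Space N) :
    MemLp (fun y => e (x - y)) b volume :=
  he.comp_measurePreserving (Measure.measurePreserving_sub_left volume x)

theorem eLpNorm_comp_sub_left {b : ENNReal} (he : AEStronglyMeasurable e volume) (x : Space N) :
    eLpNorm (fun y => e (x - y)) b volume = eLpNorm e b volume :=
  eLpNorm_comp_measurePreserving he (Measure.measurePreserving_sub_left volume x)

/-- The convolution with the rescaled kernel disappears when the scale tends to infinity. -/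
theorem tendsto_conv_rescale_atTop {a b : ℝ} (hab : a.HolderConjugate b) (hs0 : s ≠ 0)
    (hs : (N : ℝ) < s * b) (he : Continuous e)
    (hM : ∃ M, 0 ≤ M ∧ ∀ x, |e x| ≤ M * ((1 + ‖x‖) ^ s)⁻¹) (hf : MemLp f (ENNReal.ofReal a) volume)
    (x : Space N) :
    Tendsto (fun n : ℕ => conv (rescale s e (n + 1)) f x) atTop (𝓝 0) := by
  obtain ⟨M, hM0, hM⟩ := hM
  have hd : MemLp (fun y : Space N => ((1 + ‖x - y‖) ^ s)⁻¹) (ENNReal.ofReal b) volume :=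
    memLp_comp_sub_left (memLp_decay hab.symm.pos hs) x
  have hi := (integrable_mul_of_memLp hab.symm hd hf).norm.const_mul M
  have h := tendsto_integral_of_dominated_convergence (μ := (volume : Measure (Space N)))
    (F := fun (n : ℕ) y => rescale s e (n + 1) (x - y) * f y) (f := fun _ => 0)
    (fun y => M * ‖((1 + ‖x - y‖) ^ s)⁻¹ * f y‖) (fun n => ?_) hi
    (fun n => ae_of_all _ fun y => ?_) (ae_of_all _ fun y => ?_)
  · simpa [conv] using h
  · exact ((continuous_rescale he _).comp
      (continuous_const.sub continuous_id)).aestronglyMeasurable.mul hf.1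
  · rw [norm_mul, norm_mul, ← mul_assoc]
    refine mul_le_mul_of_nonneg_right ?_ (norm_nonneg _)
    refine (abs_rescale_le (by positivity) hM (x - y)).trans ?_
    rw [Real.norm_of_nonneg (by positivity)]
    refine mul_le_mul_of_nonneg_left ?_ hM0
    rw [inv_le_inv₀ (by positivity) (by positivity)]
    refine pow_le_pow_left₀ (by positivity) ?_ _
    have : (0 : ℝ) ≤ n := by positivity
    linarith
  · rw [← zero_mul (f y)]
    refine Tendsto.mul_const _ ?_
    have h1 : Tendsto (fun n : ℕ => (n : ℝ) + 1 + ‖x - y‖) atTop atTop :=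
      tendsto_atTop_add_const_right _ _
        (tendsto_atTop_add_const_right _ _ tendsto_natCast_atTop_atTop)
    have h2 := ((tendsto_pow_atTop hs0).comp h1).inv_tendsto_atTop.const_mul M
    rw [mul_zero] at h2
    exact squeeze_zero_norm (fun n => abs_rescale_le (by positivity) hM (x - y)) h2

theorem conv_sub_left {k₁ k₂ : Space N → ℝ} {x : Space N}
    (h₁ : Integrable fun y => k₁ (x - y) * f y) (h₂ : Integrable fun y => k₂ (x - y) * f y) :
    conv (fun y => k₁ y - k₂ y) f x = conv k₁ f x - conv k₂ f x := by
  simp only [conv, sub_mul]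
  exact integral_sub h₁ h₂

/-- The potential representation: up to a mollification `u` is the potential of its Laplacian. The
difference of the kernels at the scales `δ` and `R` is a test function, so that both sides change
by the same amount when `δ` is replaced by `R`; and both sides vanish as `R → ∞`. -/
theorem conv_rescale_lap_eq (E : CriticalExponents N p q r) (he : IsPotentialKernel s e)
    (hs0 : s ≠ 0) (hsq : (N : ℝ) < s * q) (hsN : N ≤ s + 2) (hu : TwiceWeaklyDifferentiable u)
    (hup : MemLp u (ENNReal.ofReal p) volume)
    (hΔ : MemLp (weakLaplacian u) (ENNReal.ofReal r) volume) {δ : ℝ} (hδ : 0 < δ) (x : Space N) :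
    conv (rescale (s + 2) (lap e) δ) u x = conv (rescale s e δ) (weakLaplacian u) x := by
  have hN := E.cast_three_le
  have hloc := hu.locallyIntegrable (by have := E.three_le; omega)
  have i1 : ∀ δ, 0 < δ → Integrable fun y => rescale (s + 2) (lap e) δ (x - y) * u y :=
    fun δ hδ => by
      simpa only [mul_comm] using
        hloc.integrable_mul_isTest ((isTest_rescale he.isTest_lap hδ).comp_sub_left x)
  have i2 : ∀ δ, 0 < δ → Integrable fun y => rescale s e δ (x - y) * weakLaplacian u y :=
    fun δ hδ => integrable_mul_of_memLp E.conj.symm (memLp_comp_sub_left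
      (memLp_rescale E.q_pos hsq he.contDiff.continuous he.exists_bound hδ) x) hΔ
  have key : ∀ R, 0 < R →
      conv (rescale (s + 2) (lap e) δ) u x - conv (rescale (s + 2) (lap e) R) u x
      = conv (rescale s e δ) (weakLaplacian u) x - conv (rescale s e R) (weakLaplacian u) x := by
    intro R hR
    rw [← conv_sub_left (i1 δ hδ) (i1 R hR), ← conv_sub_left (i2 δ hδ) (i2 R hR),
      ← conv_lap_eq (he.isTest_sub hδ hR) hu]
    have : lap (fun x => rescale s e δ x - rescale s e R x) =
        fun x => rescale (s + 2) (lap e) δ x - rescale (s + 2) (lap e) R x := by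
      funext y
      rw [lap_sub (contDiff_rescale he.contDiff R) (contDiff_rescale he.contDiff δ),
        lap_rescale he.contDiff, lap_rescale he.contDiff]
    rw [this]
  have hp := Real.HolderConjugate.conjExponent E.one_lt_p
  have t1 := tendsto_conv_rescale_atTop hp (s := s + 2) (by omega) (by
      have h1 : (N : ℝ) ≤ (s + 2 : ℕ) := by exact_mod_cast hsN
      have h2 := hp.symm.lt
      nlinarith) he.isTest_lap.continuous (exists_decay_of_isTest he.isTest_lap _) hup x
  have t2 := tendsto_conv_rescale_atTop E.conj hs0 hsq he.contDiff.continuous he.exists_bound hΔ x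
  have l1 := t1.const_sub (conv (rescale (s + 2) (lap e) δ) u x)
  have l2 := t2.const_sub (conv (rescale s e δ) (weakLaplacian u) x)
  rw [sub_zero] at l1 l2
  exact tendsto_nhds_unique (l1.congr fun n => key _ (by positivity)) l2

theorem HasWeakPartial.conv_eq (H : HasWeakPartial i u g) {k : Space N → ℝ} (hk : IsTest k) :
    conv k g = conv (LaneEmden.pd i k) u := by
  funext x
  have h := H.integral_mul_pd (hk.comp_sub_left x)
  rw [pd_comp_sub_left hk.1] at h
  simp only [mul_neg] at h
  rw [integral_neg, neg_inj] at h
  simpa only [conv, mul_comm] using h.symm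

/-- The rescaled kernels form a Cauchy family in `L¹` as the scale tends to `0`. -/
theorem IsPotentialKernel.exists_eLpNorm_sub_le (hN : 0 < N) (he : IsPotentialKernel s e)
    (hsN : s < N) {ε : ENNReal} (hε : ε ≠ 0) :
    ∃ δ : ℝ, 0 < δ ∧ ∀ δ', 0 < δ' → δ' ≤ δ →
      eLpNorm (fun x => rescale s e δ' x - rescale s e δ x) 1 volume ≤ ε := by
  have hne : Nonempty (Fin N) := ⟨⟨0, hN⟩⟩
  obtain ⟨M, hM0, hM⟩ := he.exists_bound
  set F : Space N → ℝ := fun x => 2 * M * (‖x‖ ^ s)⁻¹ with hF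
  have hFint : IntegrableOn F (Metric.ball 0 1) volume := by
    refine Integrable.const_mul ?_ _
    refine (integrableOn_fun_norm_addHaar (volume : Measure (Space N))
      (f := fun t => (t ^ s)⁻¹) (r := 1)).2 ?_
    have h1 : IntegrableOn (fun t : ℝ => t ^ (N - 1 - s)) (Set.Ioo 0 1) :=
      ((continuous_pow _).integrableOn_Icc (a := (0 : ℝ)) (b := 1)).mono_set Set.Ioo_subset_Icc_self
    refine h1.congr_fun (fun t ht => ?_) measurableSet_Ioo
    simp only [finrank_euclideanSpace, Fintype.card_fin, smul_eq_mul]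
    have : t ^ (N - 1) = t ^ (N - 1 - s) * t ^ s := by
      rw [← pow_add]; congr 1; omega
    rw [this, mul_assoc, mul_inv_cancel₀ (pow_ne_zero _ ht.1.ne'), mul_one]
  have hfin : ∫⁻ x in Metric.ball 0 1, ‖F x‖ₑ ≠ ⊤ := hFint.2.ne
  have hl : Tendsto (fun δ : ℝ => ∫⁻ x in Metric.closedBall 0 δ, ‖F x‖ₑ
      ∂(volume.restrict (Metric.ball 0 1))) (𝓝[>] 0) (𝓝 0) := by
    refine tendsto_setLIntegral_zero hfin ?_
    have h0 : Tendsto (fun δ : ℝ => ENNReal.ofReal (δ ^ N) * volume (Metric.ball (0 : Space N) 1))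
        (𝓝[>] 0) (𝓝 0) := by
      have h1 : Tendsto (fun δ : ℝ => ENNReal.ofReal (δ ^ N)) (𝓝[>] 0) (𝓝 0) := by
        have h2 : Tendsto (fun δ : ℝ => ENNReal.ofReal (δ ^ N)) (𝓝 0)
            (𝓝 (ENNReal.ofReal (0 ^ N))) :=
          (ENNReal.continuous_ofReal.comp (continuous_pow N)).tendsto 0
        rw [zero_pow hN.ne', ENNReal.ofReal_zero] at h2
        exact h2.mono_left nhdsWithin_le_nhds
      have := ENNReal.Tendsto.mul_const (b := volume (Metric.ball (0 : Space N) 1)) h1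
        (Or.inr measure_ball_lt_top.ne)
      rwa [zero_mul] at this
    refine tendsto_of_tendsto_of_tendsto_of_le_of_le' tendsto_const_nhds h0
      (Eventually.of_forall fun _ => zero_le) ?_
    filter_upwards [self_mem_nhdsWithin] with δ hδ
    refine (Measure.restrict_apply_le _ _).trans ?_
    rw [Measure.addHaar_closedBall _ _ (le_of_lt hδ), finrank_euclideanSpace, Fintype.card_fin]
  obtain ⟨δ, hδ1, hδ2⟩ := ((hl.eventually_le_const (pos_iff_ne_zero.2 hε)).and
    (Ioo_mem_nhdsGT one_pos)).exists
  refine ⟨δ, hδ2.1, fun δ' h0 hle => ?_⟩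
  rw [eLpNorm_one_eq_lintegral_enorm]
  refine le_trans ?_ hδ1
  rw [Measure.restrict_restrict measurableSet_closedBall,
    Set.inter_eq_left.2 (Metric.closedBall_subset_ball hδ2.2)]
  have hsupp : ∀ x ∉ Metric.closedBall (0 : Space N) δ,
      ‖rescale s e δ' x - rescale s e δ x‖ₑ = 0 := fun x hx => by
    rw [mem_closedBall_zero_iff, not_le] at hx
    rw [he.rescale_eq δ' δ h0 hδ2.1 x (hle.trans_lt hx) hx, sub_self, enorm_zero]
  rw [← setLIntegral_eq_of_support_subset (s := Metric.closedBall (0 : Space N) δ)]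
  · refine setLIntegral_mono_ae' measurableSet_closedBall ?_
    filter_upwards [Measure.ae_ne (volume : Measure (Space N)) 0] with x hx _
    have hxp : 0 < ‖x‖ := norm_pos_iff.2 hx
    have hb : ∀ t : ℝ, 0 < t → |rescale s e t x| ≤ M * (‖x‖ ^ s)⁻¹ := fun t ht => by
      refine (abs_rescale_le ht hM x).trans (mul_le_mul_of_nonneg_left ?_ hM0)
      rw [inv_le_inv₀ (by positivity) (by positivity)]
      exact pow_le_pow_left₀ (by positivity) (by linarith) _
    rw [enorm_le_iff_norm_le, Real.norm_eq_abs, Real.norm_of_nonneg (by positivity)]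
    refine (abs_sub _ _).trans ?_
    have h1 := hb δ' h0
    have h2 := hb δ hδ2.1
    simp only [hF]
    linarith
  · intro x hx
    by_contra h
    exact hx (hsupp x h)

end Representation

/-! ### Local strong convergence -/

section Compactness

variable {N : ℕ} {p q r : ℝ} {e ρ : Space N → ℝ} {s : ℕ}

/-- The compactness mechanism: if `ρ_δ * a_k = e_δ * f_k` for all scales `δ`, where `ρ` has nonzero
mass, and if `f_k ⇀ 0` weakly in `L^r`, then `a_k → 0` in `L^r(B)`. Indeed `(∫ρ) a_k - ρ_δ * a_k` is
the limit of `(e_δ' - e_δ) * f_k` as `δ' → 0`, hence small uniformly in `k`, while `e_δ * f_k → 0`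
pointwise with a uniform bound. -/
theorem tendsto_eLpNorm_restrict_of_conv_eq (E : CriticalExponents N p q r)
    (he : IsPotentialKernel s e) (hsN : s < N) (hsq : (N : ℝ) < s * q) (hρ : IsTest ρ)
    (hρ0 : ∫ x, ρ x ≠ 0) {a f : ℕ → Space N → ℝ} (ha : ∀ k, LocallyIntegrable (a k) volume)
    (hf : ∀ k, MemLp (f k) (ENNReal.ofReal r) volume)
    (hrep : ∀ k δ, 0 < δ → ∀ x, conv (rescale N ρ δ) (a k) x = conv (rescale s e δ) (f k) x)
    {L : ENNReal} (hL : L ≠ ⊤) (hfL : ∀ k, eLpNorm (f k) (ENNReal.ofReal r) volume ≤ L)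
    (hweak : ∀ h, MemLp h (ENNReal.ofReal q) volume →
      Tendsto (fun k => ∫ x, f k x * h x) atTop (𝓝 0)) (B : Set (Space N)) (hB : volume B ≠ ⊤) :
    Tendsto (fun k => eLpNorm (a k) (ENNReal.ofReal r) (volume.restrict B)) atTop (𝓝 0) := by
  have hN : 0 < N := by have := E.three_le; omega
  have hr1 : 1 ≤ ENNReal.ofReal r := ENNReal.one_le_ofReal.2 E.one_lt_r.le
  have hfin : IsFiniteMeasure (volume.restrict B) :=
    ⟨by rw [Measure.restrict_apply_univ]; exact hB.lt_top⟩
  set c := ∫ x, ρ x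
  have hemem : ∀ δ, 0 < δ → MemLp (rescale s e δ) (ENNReal.ofReal q) volume := fun δ hδ =>
    memLp_rescale E.q_pos hsq he.contDiff.continuous he.exists_bound hδ
  have hcont : ∀ k δ, 0 < δ → Continuous (conv (rescale N ρ δ) (a k)) := fun k δ hδ =>
    continuous_conv (isTest_rescale hρ hδ).continuous (isTest_rescale hρ hδ).2 (ha k)
  suffices h : Tendsto (fun k =>
      eLpNorm (fun x => c * a k x) (ENNReal.ofReal r) (volume.restrict B)) atTop (𝓝 0) by
    have h2 := ENNReal.Tendsto.const_mul (a := ‖c⁻¹‖ₑ) h (Or.inr enorm_ne_top)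
    rw [mul_zero] at h2
    refine h2.congr fun k => ?_
    have : a k = c⁻¹ • fun x => c * a k x := by
      funext x
      simp [hρ0, c]
    conv_rhs => rw [this]
    rw [eLpNorm_const_smul]
  rw [ENNReal.tendsto_nhds_zero]
  intro ε hε
  have hε2 : ε / 2 ≠ 0 := (ENNReal.half_pos hε.ne').ne'
  obtain ⟨δ, hδ, hκ⟩ := he.exists_eLpNorm_sub_le hN hsN
    (ε := ε / 2 / (L + 1)) (ENNReal.div_ne_zero.2 ⟨hε2, by simp [hL]⟩)
  -- the singular part of the kernel
  have hnear : ∀ k, eLpNorm (fun x => c * a k x - conv (rescale N ρ δ) (a k) x) (ENNReal.ofReal r)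
      volume ≤ ε / 2 := fun k => by
    set t : ℕ → ℝ := fun n => δ / ((n : ℝ) + 1)
    have ht : ∀ n, 0 < t n := fun n => by positivity
    have htδ : ∀ n, t n ≤ δ := fun n => div_le_self hδ.le (by
      have : (0 : ℝ) ≤ n := by positivity
      linarith)
    have ht0 : Tendsto t atTop (𝓝[>] 0) := by
      refine tendsto_nhdsWithin_iff.2 ⟨?_, Eventually.of_forall ht⟩
      have := tendsto_one_div_add_atTop_nhds_zero_nat.const_mul δ
      simpa [t, div_eq_mul_inv] using this
    refine Lp.eLpNorm_le_of_ae_tendsto (u := atTop)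
      (f := fun n x => conv (rescale N ρ (t n)) (a k) x - conv (rescale N ρ δ) (a k) x)
      (Eventually.of_forall fun n => ?_)
      (fun n => ((hcont k _ (ht n)).sub (hcont k _ hδ)).aestronglyMeasurable) ?_
    · have h1 : (fun x => conv (rescale N ρ (t n)) (a k) x - conv (rescale N ρ δ) (a k) x) =
          conv (fun x => rescale s e (t n) x - rescale s e δ x) (f k) := by
        funext x
        rw [hrep k _ (ht n), hrep k _ hδ, conv_sub_left]
        · exact integrable_mul_of_memLp E.conj.symm (memLp_comp_sub_left (hemem _ (ht n)) x) (hf k)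
        · exact integrable_mul_of_memLp E.conj.symm (memLp_comp_sub_left (hemem _ hδ) x) (hf k)
      rw [h1]
      refine (eLpNorm_conv_le E.conj (he.isTest_sub (ht n) hδ).continuous.measurable
        (hf k).1).trans ?_
      calc _ ≤ ε / 2 / (L + 1) * (L + 1) :=
            mul_le_mul' (hκ _ (ht n) (htδ n)) ((hfL k).trans le_self_add)
        _ = ε / 2 := ENNReal.div_mul_cancel (by simp) (by simp [hL])
    · filter_upwards [ae_tendsto_conv_rescale hρ.continuous hρ.2 (ha k)] with x hx
      exact (hx t ht0).sub_const _
  -- the regular part of the kernel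
  have hfar : Tendsto (fun k => eLpNorm (conv (rescale N ρ δ) (a k)) (ENNReal.ofReal r)
      (volume.restrict B)) atTop (𝓝 0) := by
    refine tendsto_eLpNorm_of_bounded E.r_pos
      (C := eLpNorm (rescale s e δ) (ENNReal.ofReal q) volume * L)
      (ENNReal.mul_ne_top (hemem δ hδ).2.ne hL)
      (fun k => (hcont k δ hδ).aestronglyMeasurable) (fun k x => ?_) (fun x => ?_)
    · rw [hrep k δ hδ]
      refine (enorm_integral_mul_le E.conj.symm (memLp_comp_sub_left (hemem δ hδ) x).1
        (hf k).1).trans ?_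
      rw [eLpNorm_comp_sub_left (hemem δ hδ).1]
      gcongr
      exact hfL k
    · refine (hweak _ (memLp_comp_sub_left (hemem δ hδ) x)).congr fun k => ?_
      rw [hrep k δ hδ, conv]
      simp only [mul_comm]
  filter_upwards [hfar.eventually_le_const (pos_iff_ne_zero.2 hε2)] with k hk
  have h1 : (fun x => c * a k x) = (fun x => c * a k x - conv (rescale N ρ δ) (a k) x) +
      conv (rescale N ρ δ) (a k) := by
    funext x
    simp
  rw [h1]
  refine (eLpNorm_add_le ?_ (hcont k δ hδ).aestronglyMeasurable hr1).trans ?_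
  · exact (((ha k).aestronglyMeasurable.const_mul c).sub
      (hcont k δ hδ).aestronglyMeasurable).restrict
  · calc _ ≤ ε / 2 + ε / 2 := add_le_add
          ((eLpNorm_mono_measure _ Measure.restrict_le_self).trans (hnear k)) hk
      _ = ε := ENNReal.add_halves ε

variable {w : ℕ → Space N → ℝ} {L : ENNReal} {B : Set (Space N)}

/-- If `Δw_k ⇀ 0` weakly in `L^r`, then `w_k → 0` in `L^r` on sets of finite measure. -/
theorem tendsto_eLpNorm_restrict (E : CriticalExponents N p q r)
    (hw : ∀ k, TwiceWeaklyDifferentiable (w k)) (hwp : ∀ k, MemLp (w k) (ENNReal.ofReal p) volume)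
    (hΔ : ∀ k, MemLp (weakLaplacian (w k)) (ENNReal.ofReal r) volume) (hL : L ≠ ⊤)
    (hΔL : ∀ k, eLpNorm (weakLaplacian (w k)) (ENNReal.ofReal r) volume ≤ L)
    (hweak : ∀ h, MemLp h (ENNReal.ofReal q) volume →
      Tendsto (fun k => ∫ x, weakLaplacian (w k) x * h x) atTop (𝓝 0)) (hB : volume B ≠ ⊤) :
    Tendsto (fun k => eLpNorm (w k) (ENNReal.ofReal r) (volume.restrict B)) atTop (𝓝 0) := by
  have h3 := E.three_le
  have he := isPotentialKernel_newton (N := N) (by omega)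
  have hsq : (N : ℝ) < (N - 2 : ℕ) * q := by
    have := E.lt_mul_q
    push_cast [show 2 ≤ N by omega]
    exact this
  refine tendsto_eLpNorm_restrict_of_conv_eq E he (by omega) hsq he.isTest_lap
    (integral_lap_newton_ne_zero h3) (fun k => (hw k).locallyIntegrable (by omega)) hΔ
    (fun k δ hδ x => ?_) hL hΔL hweak B hB
  have h := conv_rescale_lap_eq E he (by omega) hsq (by omega) (hw k) (hwp k) (hΔ k) hδ x
  rwa [show N - 2 + 2 = N by omega] at h

/-- If `Δw_k ⇀ 0` weakly in `L^r`, then `∇w_k → 0` in `L^r` on sets of finite measure. -/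
theorem tendsto_eLpNorm_weakPartial_restrict (E : CriticalExponents N p q r)
    (hw : ∀ k, TwiceWeaklyDifferentiable (w k)) (hwp : ∀ k, MemLp (w k) (ENNReal.ofReal p) volume)
    (hΔ : ∀ k, MemLp (weakLaplacian (w k)) (ENNReal.ofReal r) volume) (hL : L ≠ ⊤)
    (hΔL : ∀ k, eLpNorm (weakLaplacian (w k)) (ENNReal.ofReal r) volume ≤ L)
    (hweak : ∀ h, MemLp h (ENNReal.ofReal q) volume →
      Tendsto (fun k => ∫ x, weakLaplacian (w k) x * h x) atTop (𝓝 0)) (hB : volume B ≠ ⊤)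
    (i : Fin N) :
    Tendsto (fun k => eLpNorm (weakPartial i (w k)) (ENNReal.ofReal r) (volume.restrict B)) atTop
      (𝓝 0) := by
  have h3 := E.three_le
  have he := isPotentialKernel_newton (N := N) (by omega)
  have he' := he.pd i
  rw [show N - 2 + 1 = N - 1 by omega] at he'
  have hsq : (N : ℝ) < (N - 1 : ℕ) * q := by
    have := E.lt_mul_q
    have hq := E.q_pos
    push_cast [show 1 ≤ N by omega]
    linarith
  refine tendsto_eLpNorm_restrict_of_conv_eq E he' (by omega) hsq he.isTest_lap
    (integral_lap_newton_ne_zero h3) (fun k => ((hw k).weakPartial i i).1.2.1) hΔ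
    (fun k δ hδ x => ?_) hL hΔL hweak B hB
  have h := conv_rescale_lap_eq E he' (by omega) hsq (by omega) (hw k) (hwp k) (hΔ k) hδ x
  rw [show N - 1 + 2 = N + 1 by omega, lap_pd he.contDiff, ← pd_rescale he.isTest_lap.1] at h
  rw [((hw k).weakPartial i i).1.conv_eq (isTest_rescale he.isTest_lap hδ), h]

end Compactness

/-! ### The monotone nonlinearity `|t|^(r-2) t` -/

section SignedPower

variable {r σ : ℝ}

/-- The nonlinearity `|t|^(r-2) t`. -/
noncomputable def spow (r t : ℝ) : ℝ := |t| ^ (r - 2) * t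

theorem abs_spow (hr : 1 < r) (t : ℝ) : |spow r t| = |t| ^ (r - 1) := by
  rw [spow, abs_mul, abs_of_nonneg (Real.rpow_nonneg (abs_nonneg t) _)]
  rcases eq_or_lt_of_le (abs_nonneg t) with h | h
  · rw [← h, Real.zero_rpow (by linarith : r - 1 ≠ 0), mul_zero]
  · rw [← Real.rpow_add_one h.ne']
    congr 1; ring

theorem spow_of_nonneg (hr : 1 < r) {t : ℝ} (ht : 0 ≤ t) : spow r t = t ^ (r - 1) := by
  have h : 0 ≤ spow r t := mul_nonneg (Real.rpow_nonneg (abs_nonneg t) _) ht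
  rw [← abs_of_nonneg h, abs_spow hr, abs_of_nonneg ht]

theorem spow_neg (r t : ℝ) : spow r (-t) = - spow r t := by
  simp [spow]

theorem spow_mul_self (hr : 1 < r) (t : ℝ) : spow r t * t = |t| ^ r := by
  have h : spow r t * t = |t| ^ (r - 2) * |t| * |t| := by
    rw [spow, mul_assoc, mul_assoc, abs_mul_abs_self]
  rw [h]
  rcases eq_or_lt_of_le (abs_nonneg t) with h | h
  · rw [← h, Real.zero_rpow (by linarith : r ≠ 0), mul_zero]
  · rw [← Real.rpow_add_one h.ne', ← Real.rpow_add_one h.ne']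
    congr 1; ring

theorem continuous_spow (hr : 1 < r) : Continuous (spow r) := by
  refine continuous_iff_continuousAt.2 fun t => ?_
  rcases eq_or_ne t 0 with rfl | ht
  · have h0 : spow r 0 = 0 := by simp [spow]
    rw [ContinuousAt, h0]
    refine squeeze_zero_norm (a := fun t => |t| ^ (r - 1)) (fun t => (abs_spow hr t).le) ?_
    have h : Continuous fun t : ℝ => |t| ^ (r - 1) :=
      continuous_abs.rpow_const fun _ => Or.inr (by linarith)
    have h2 := h.tendsto 0
    rwa [abs_zero, Real.zero_rpow (by linarith)] at h2
  · exact (continuous_abs.continuousAt.rpow_const (Or.inl (abs_pos.2 ht).ne')).mul continuousAt_id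

theorem monotone_spow (hr : 1 < r) : Monotone (spow r) := by
  have hpos : ∀ a b : ℝ, 0 ≤ a → a ≤ b → spow r a ≤ spow r b := fun a b ha hab => by
    rw [spow_of_nonneg hr ha, spow_of_nonneg hr (ha.trans hab)]
    exact Real.rpow_le_rpow ha hab (by linarith)
  intro a b hab
  rcases le_total 0 a with ha | ha
  · exact hpos a b ha hab
  · rcases le_total 0 b with hb | hb
    · exact (mul_nonpos_of_nonneg_of_nonpos (Real.rpow_nonneg (abs_nonneg a) _) ha).trans
        (mul_nonneg (Real.rpow_nonneg (abs_nonneg b) _) hb)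
    · have h := hpos (-b) (-a) (by linarith) (by linarith)
      rw [spow_neg, spow_neg] at h
      linarith

theorem spow_sub_mul_nonneg (hr : 1 < r) (a b : ℝ) : 0 ≤ (spow r a - spow r b) * (a - b) := by
  rcases le_total a b with h | h
  · exact mul_nonneg_of_nonpos_of_nonpos (sub_nonpos.2 (monotone_spow hr h)) (sub_nonpos.2 h)
  · exact mul_nonneg (sub_nonneg.2 (monotone_spow hr h)) (sub_nonneg.2 h)

/-- Large arguments: `|t|^(r-1)` is a small multiple of `|t|^r`. -/
theorem abs_rpow_sub_one_le {t R : ℝ} (hR : 0 < R) (ht : R ≤ |t|) :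
    |t| ^ (r - 1) ≤ R⁻¹ * |t| ^ r := by
  have h0 : 0 < |t| := hR.trans_le ht
  rw [Real.rpow_sub_one h0.ne', div_eq_inv_mul]
  exact mul_le_mul_of_nonneg_right ((inv_le_inv₀ h0 hR).2 ht) (by positivity)

/-- A quantitative uniform continuity of `|t|^(r-2) t`. -/
theorem exists_abs_spow_sub_le (hr : 1 < r) (hσ : 0 < σ) :
    ∃ τ : ℝ, 0 < τ ∧ ∀ a b, |a - b| < τ →
      |spow r a - spow r b| ≤ σ * (1 + |a| ^ r + |b| ^ r) := by
  set R : ℝ := 2 / σ with hR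
  have hR0 : 0 < R := by positivity
  have huc := (isCompact_Icc (a := -R) (b := R)).uniformContinuousOn_of_continuous
    (continuous_spow hr).continuousOn
  obtain ⟨τ, hτ, h⟩ := Metric.uniformContinuousOn_iff.1 huc σ hσ
  refine ⟨τ, hτ, fun a b hab => ?_⟩
  have ha0 : 0 ≤ |a| ^ r := by positivity
  have hb0 : 0 ≤ |b| ^ r := by positivity
  have htri : |spow r a - spow r b| ≤ |a| ^ (r - 1) + |b| ^ (r - 1) := by
    rw [← abs_spow hr, ← abs_spow hr]
    exact abs_sub _ _
  have hlarge : ∀ t, R ≤ |t| → 2 * |t| ^ (r - 1) ≤ σ * |t| ^ r := fun t ht => by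
    have := abs_rpow_sub_one_le (r := r) hR0 ht
    rw [hR, inv_div] at this
    linarith
  by_cases hsmall : |a| ≤ R ∧ |b| ≤ R
  · have := (h a (abs_le.1 hsmall.1) b (abs_le.1 hsmall.2) hab).le
    rw [Real.dist_eq] at this
    nlinarith
  · rcases le_total |a| |b| with hle | hle
    · have hb : R ≤ |b| := by
        by_contra hcon
        exact hsmall ⟨by linarith, by linarith⟩
      have h1 : |a| ^ (r - 1) ≤ |b| ^ (r - 1) :=
        Real.rpow_le_rpow (abs_nonneg _) hle (by linarith)
      have := hlarge b hb
      nlinarith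
    · have ha : R ≤ |a| := by
        by_contra hcon
        exact hsmall ⟨by linarith, by linarith⟩
      have h1 : |b| ^ (r - 1) ≤ |a| ^ (r - 1) :=
        Real.rpow_le_rpow (abs_nonneg _) hle (by linarith)
      have := hlarge a ha
      nlinarith

/-- The difference of the nonlinearities is controlled by the monotonicity expression. -/
theorem exists_abs_spow_sub_le_mul (hr : 1 < r) (hσ : 0 < σ) :
    ∃ C : ℝ, 0 ≤ C ∧ ∀ a b, |spow r a - spow r b| ≤
      σ * (1 + |a| ^ r + |b| ^ r) + C * ((spow r a - spow r b) * (a - b)) := by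
  obtain ⟨τ, hτ, h⟩ := exists_abs_spow_sub_le hr hσ
  refine ⟨τ⁻¹, by positivity, fun a b => ?_⟩
  have hM := spow_sub_mul_nonneg hr a b
  rcases lt_or_ge |a - b| τ with hab | hab
  · exact (h a b hab).trans (le_add_of_nonneg_right (by positivity))
  · refine le_add_of_nonneg_of_le (by positivity) ?_
    rw [← abs_of_nonneg hM, abs_mul, inv_mul_eq_div, le_div_iff₀ hτ]
    exact mul_le_mul_of_nonneg_left hab (abs_nonneg _)

/-- The difference of the nonlinearities is controlled by the difference of the arguments, up to
a small multiple of the natural growth. -/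
theorem exists_abs_spow_sub_le_abs_sub (hr : 1 < r) (hσ : 0 < σ) :
    ∃ C : ℝ, 0 ≤ C ∧ ∀ a b, |spow r a - spow r b| ≤
      σ * (1 + |a| ^ r + |b| ^ r) + C * |a - b| := by
  obtain ⟨τ, hτ, h⟩ := exists_abs_spow_sub_le hr hσ
  set R : ℝ := σ⁻¹
  have hR : 0 < R := by positivity
  refine ⟨2 * R ^ (r - 1) / τ, by positivity, fun a b => ?_⟩
  rcases lt_or_ge |a - b| τ with hab | hab
  · exact (h a b hab).trans (le_add_of_nonneg_right (by positivity))
  · have hone : ∀ t : ℝ, |t| ^ (r - 1) ≤ σ * |t| ^ r + R ^ (r - 1) := fun t => by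
      rcases le_total R |t| with ht | ht
      · have := abs_rpow_sub_one_le (r := r) hR ht
        simp only [R, inv_inv] at this
        have h0 : 0 ≤ R ^ (r - 1) := by positivity
        exact this.trans (le_add_of_nonneg_right h0)
      · have := Real.rpow_le_rpow (abs_nonneg t) ht (by linarith : 0 ≤ r - 1)
        exact this.trans (le_add_of_nonneg_left (by positivity))
    have htri : |spow r a - spow r b| ≤ |a| ^ (r - 1) + |b| ^ (r - 1) := by
      rw [← abs_spow hr, ← abs_spow hr]
      exact abs_sub _ _
    have h1 : 2 * R ^ (r - 1) ≤ 2 * R ^ (r - 1) / τ * |a - b| := by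
      rw [div_mul_eq_mul_div, le_div_iff₀ hτ]
      exact mul_le_mul_of_nonneg_left hab (by positivity)
    have h2 := hone a
    have h3 := hone b
    nlinarith

/-- The critical term: `|a|^(r-1)|a-b|` is controlled by `|a-b|^r`, by a bounded multiple of
`|a-b|`, and by the part of `|b|^r` above the level `m`. -/
theorem abs_spow_mul_sub_le (hr : 1 < r) {m : ℝ} (hm : 0 ≤ m) (a b : ℝ) :
    |spow r a * (a - b)| ≤ 2 ^ (r - 1) * (|a - b| ^ r + m ^ (r - 1) * |a - b| +
      if m < |b| then |b| ^ r else 0) := by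
  have hmul : ∀ t : ℝ, 0 ≤ t → t ^ (r - 1) * t = t ^ r := fun t ht => by
    rcases ht.eq_or_lt with h | h
    · rw [← h, Real.zero_rpow (by linarith : r ≠ 0), mul_zero]
    · rw [← Real.rpow_add_one h.ne']
      congr 1; ring
  have hw := abs_nonneg (a - b)
  have hv := abs_nonneg b
  have hab : |a| ≤ |a - b| + |b| := by
    have := abs_add_le (a - b) b
    rwa [sub_add_cancel] at this
  have hle : ∀ t : ℝ, |a| ≤ 2 * t → |a| ^ (r - 1) ≤ 2 ^ (r - 1) * t ^ (r - 1) := fun t ht => by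
    have ht0 : 0 ≤ t := by linarith [abs_nonneg a]
    rw [← Real.mul_rpow (by norm_num) ht0]
    exact Real.rpow_le_rpow (abs_nonneg _) ht (by linarith)
  have h0 : 0 ≤ |a - b| ^ r := by positivity
  have h1 : 0 ≤ m ^ (r - 1) * |a - b| := by positivity
  have h2 : 0 ≤ if m < |b| then |b| ^ r else 0 := by split_ifs <;> positivity
  rw [abs_mul, abs_spow hr]
  rcases le_or_gt |b| |a - b| with hc | hc
  · calc |a| ^ (r - 1) * |a - b| ≤ 2 ^ (r - 1) * |a - b| ^ (r - 1) * |a - b| := by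
          gcongr
          exact hle _ (by linarith)
      _ = 2 ^ (r - 1) * |a - b| ^ r := by rw [mul_assoc, hmul _ hw]
      _ ≤ _ := by gcongr; linarith
  · calc |a| ^ (r - 1) * |a - b| ≤ 2 ^ (r - 1) * |b| ^ (r - 1) * |a - b| := by
          gcongr
          exact hle _ (by linarith)
      _ = 2 ^ (r - 1) * (|b| ^ (r - 1) * |a - b|) := by ring
      _ ≤ _ := by
        refine mul_le_mul_of_nonneg_left ?_ (by positivity)
        split_ifs at h2 ⊢ with hmb
        · have : |b| ^ (r - 1) * |a - b| ≤ |b| ^ r := by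
            rw [← hmul _ hv]
            gcongr
          linarith
        · have : |b| ^ (r - 1) * |a - b| ≤ m ^ (r - 1) * |a - b| := by
            gcongr
            exact not_lt.1 hmb
          linarith

variable {α : Type*} [MeasurableSpace α] {μ : Measure α} {f : α → ℝ} {q : ℝ}

theorem abs_spow_rpow (h : r.HolderConjugate q) (t : ℝ) : |spow r t| ^ q = |t| ^ r := by
  rw [abs_spow h.lt, ← Real.rpow_mul (abs_nonneg _)]
  congr 1
  have := h.sub_one_mul_conj
  linarith

theorem memLp_spow (h : r.HolderConjugate q) (hf : MemLp f (ENNReal.ofReal r) μ) :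
    MemLp (fun x => spow r (f x)) (ENNReal.ofReal q) μ := by
  have hm : AEStronglyMeasurable (fun x => spow r (f x)) μ :=
    (continuous_spow h.lt).comp_aestronglyMeasurable hf.1
  rw [← integrable_norm_rpow_iff hm (by simpa using h.symm.pos) (by simp)]
  have h2 := hf.integrable_norm_rpow (by simpa using h.pos) (by simp)
  simpa only [Real.norm_eq_abs, ENNReal.toReal_ofReal h.pos.le, ENNReal.toReal_ofReal h.symm.pos.le,
    abs_spow_rpow h] using h2

theorem eLpNorm_spow (h : r.HolderConjugate q) (hf : MemLp f (ENNReal.ofReal r) μ) :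
    eLpNorm (fun x => spow r (f x)) (ENNReal.ofReal q) μ =
      eLpNorm f (ENNReal.ofReal r) μ ^ (r - 1) := by
  rw [eLpNorm_ofReal_eq h.symm.pos (memLp_spow h hf), eLpNorm_ofReal_eq h.pos hf]
  simp only [abs_spow_rpow h]
  rw [ENNReal.ofReal_rpow_of_nonneg (by positivity) (by linarith [h.lt]), ← Real.rpow_mul
    (by positivity)]
  congr 2
  have h1 := h.sub_one_mul_conj
  have h2 := h.pos
  have h3 := h.symm.pos
  field_simp
  linarith

end SignedPower

/-! ### Weak convergence in `D^{2,r}` -/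

section WeakConvergence

variable {N : ℕ} {p q r : ℝ}

theorem twiceWeaklyDifferentiable_fnD2 (u : D2 N p r) : TwiceWeaklyDifferentiable (fnD2 u) := u.2.1

theorem memLp_fnD2 (u : D2 N p r) : MemLp (fnD2 u) (ENNReal.ofReal p) volume := Lp.memLp _

theorem memLp_weakLaplacian_fnD2 (u : D2 N p r) :
    MemLp (weakLaplacian (fnD2 u)) (ENNReal.ofReal r) volume := u.2.2

theorem fnD2_sub (u w : D2 N p r) : fnD2 (u - w) =ᵐ[volume] fun x => fnD2 u x - fnD2 w x :=
  Lp.coeFn_sub (u : Lp ℝ (ENNReal.ofReal p) (volume : Measure (Space N))) w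

theorem fnD2_add (u w : D2 N p r) : fnD2 u + fnD2 w =ᵐ[volume] fnD2 (u + w) :=
  (Lp.coeFn_add (u : Lp ℝ (ENNReal.ofReal p) (volume : Measure (Space N))) w).symm

theorem fnD2_smul (c : ℝ) (u : D2 N p r) : c • fnD2 u =ᵐ[volume] fnD2 (c • u) :=
  (Lp.coeFn_smul c (u : Lp ℝ (ENNReal.ofReal p) (volume : Measure (Space N)))).symm

theorem weakLaplacian_fnD2_add (u w : D2 N p r) : weakLaplacian (fnD2 (u + w)) =ᵐ[volume]
    weakLaplacian (fnD2 u) + weakLaplacian (fnD2 w) :=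
  (weakLaplacian_congr (u.2.1.add w.2.1) (fnD2_add u w)).trans (weakLaplacian_add u.2.1 w.2.1)

theorem weakLaplacian_fnD2_smul (c : ℝ) (u : D2 N p r) : weakLaplacian (fnD2 (c • u)) =ᵐ[volume]
    c • weakLaplacian (fnD2 u) :=
  (weakLaplacian_congr (u.2.1.const_smul c) (fnD2_smul c u)).trans
    (weakLaplacian_const_smul c u.2.1)

theorem weakLaplacian_fnD2_sub (u w : D2 N p r) : weakLaplacian (fnD2 (u - w)) =ᵐ[volume]
    fun x => weakLaplacian (fnD2 u) x - weakLaplacian (fnD2 w) x := by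
  have h := weakLaplacian_fnD2_add (u - w) w
  rw [sub_add_cancel] at h
  filter_upwards [h] with x hx
  rw [hx]
  simp

/-- The functional `w ↦ ∫ Δw h`. -/
noncomputable def laplacianPairing (h : r.HolderConjugate q) {g : Space N → ℝ}
    (hg : MemLp g (ENNReal.ofReal q) volume) : D2 N p r →ₗ[ℝ] ℝ where
  toFun w := ∫ x, weakLaplacian (fnD2 w) x * g x
  map_add' u w := by
    rw [← integral_add (integrable_mul_of_memLp h (memLp_weakLaplacian_fnD2 u) hg)
      (integrable_mul_of_memLp h (memLp_weakLaplacian_fnD2 w) hg)]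
    refine integral_congr_ae ?_
    filter_upwards [weakLaplacian_fnD2_add u w] with x hx
    rw [hx, Pi.add_apply, add_mul]
  map_smul' c u := by
    rw [RingHom.id_apply, smul_eq_mul, ← integral_const_mul]
    refine integral_congr_ae ?_
    filter_upwards [weakLaplacian_fnD2_smul c u] with x hx
    rw [hx, Pi.smul_apply, smul_eq_mul, mul_assoc]

theorem isBoundedFunctional_laplacianPairing (h : r.HolderConjugate q) {g : Space N → ℝ}
    (hg : MemLp g (ENNReal.ofReal q) volume) :
    IsBoundedFunctional (laplacianPairing (p := p) h hg) := by
  refine ⟨(eLpNorm g (ENNReal.ofReal q) volume).toReal, fun w => ?_⟩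
  have hw := memLp_weakLaplacian_fnD2 w
  have h1 : ‖laplacianPairing h hg w‖ₑ ≤ _ := enorm_integral_mul_le h hw.1 hg.1
  rw [eLpNorm_ofReal_eq h.pos hw] at h1
  have h2 := ENNReal.toReal_mono (ENNReal.mul_ne_top ENNReal.ofReal_ne_top hg.2.ne) h1
  rw [ENNReal.toReal_mul, ENNReal.toReal_ofReal (by positivity), toReal_enorm,
    Real.norm_eq_abs, mul_comm] at h2
  exact h2

theorem WeaklyConverges.tendsto_integral (h : r.HolderConjugate q) {v : ℕ → D2 N p r}
    {v₀ : D2 N p r} (hv : WeaklyConverges v v₀) {g : Space N → ℝ}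
    (hg : MemLp g (ENNReal.ofReal q) volume) :
    Tendsto (fun k => ∫ x, weakLaplacian (fnD2 (v k)) x * g x) atTop
      (𝓝 (∫ x, weakLaplacian (fnD2 v₀) x * g x)) :=
  hv _ (isBoundedFunctional_laplacianPairing h hg)

/-- Weakly convergent sequences in `L^r` are bounded. -/
theorem exists_eLpNorm_le_of_tendsto {α : Type*} [MeasurableSpace α] {μ : Measure α}
    (h : r.HolderConjugate q) {f : ℕ → α → ℝ}
    (hf : ∀ k, MemLp (f k) (ENNReal.ofReal r) μ) {l : (α → ℝ) → ℝ}
    (hl : ∀ g, MemLp g (ENNReal.ofReal q) μ →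
      Tendsto (fun k => ∫ x, f k x * g x ∂μ) atTop (𝓝 (l g))) :
    ∃ L : ENNReal, L ≠ ⊤ ∧ ∀ k, eLpNorm (f k) (ENNReal.ofReal r) μ ≤ L := by
  have hconj := h.ennrealOfReal
  have hr1 : Fact (1 ≤ ENNReal.ofReal r) := ⟨ENNReal.one_le_ofReal.2 h.lt.le⟩
  have hq1 : Fact (1 ≤ ENNReal.ofReal q) := ⟨ENNReal.one_le_ofReal.2 h.symm.lt.le⟩
  set T : ℕ → Lp ℝ (ENNReal.ofReal q) μ →L[ℝ] ℝ := fun k =>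
    (ContinuousLinearMap.mul ℝ ℝ).lpPairing μ (ENNReal.ofReal r) (ENNReal.ofReal q)
      ((hf k).toLp (f k)) with hT
  have hTapp : ∀ k (g : α → ℝ) (hg : MemLp g (ENNReal.ofReal q) μ),
      T k (hg.toLp g) = ∫ x, f k x * g x ∂μ := fun k g hg => by
    simp only [hT]
    rw [ContinuousLinearMap.lpPairing_eq_integral]
    refine integral_congr_ae ?_
    filter_upwards [(hf k).coeFn_toLp, hg.coeFn_toLp] with x h1 h2
    rw [h1, h2]
    rfl
  obtain ⟨C, hC⟩ := banach_steinhaus (g := T) fun g => by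
    have hg := Lp.memLp g
    have h1 := (hl _ hg).norm.bddAbove_range
    obtain ⟨C, hC⟩ := h1
    refine ⟨C, fun k => ?_⟩
    have h2 := hC ⟨k, rfl⟩
    simp only [← hTapp k _ hg, Lp.toLp_coeFn] at h2
    exact h2
  have hC0 : 0 ≤ C := (norm_nonneg _).trans (hC 0)
  refine ⟨ENNReal.ofReal C, ENNReal.ofReal_ne_top, fun k => ?_⟩
  have hr := h.pos
  have hq := h.symm.pos
  -- test with `|f_k|^(r-2) f_k`
  have hg := memLp_spow h (hf k)
  have h1 := (T k).le_of_opNorm_le (hC k) (hg.toLp _)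
  rw [hTapp, Lp.norm_toLp, eLpNorm_ofReal_eq hq hg, ENNReal.toReal_ofReal (by positivity)] at h1
  simp only [abs_spow_rpow h, mul_comm (f k _), spow_mul_self h.lt] at h1
  set I := ∫ x, |f k x| ^ r ∂μ
  have hI : 0 ≤ I := by positivity
  rw [Real.norm_of_nonneg hI] at h1
  rw [eLpNorm_ofReal_eq hr (hf k)]
  refine ENNReal.ofReal_le_ofReal ?_
  change I ^ (1 / r) ≤ C
  rcases hI.eq_or_lt with h0 | h0
  · rw [← h0, Real.zero_rpow (by positivity)]
    exact hC0
  · refine le_of_mul_le_mul_right (a := I ^ (1 / q)) ?_ (by positivity)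
    rw [← Real.rpow_add h0]
    have := h.inv_add_inv_eq_one
    simp only [one_div, this, Real.rpow_one] at h1 ⊢
    exact h1

end WeakConvergence

/-! ### The action of the orthogonal group -/

section Action

variable {N : ℕ} {p q r : ℝ}

theorem inner_act (g : Matrix.orthogonalGroup (Fin N) ℝ) (x y : Space N) :
    inner ℝ (act g x) (act g y) = inner ℝ x y := by
  have h : (g : Matrix (Fin N) (Fin N) ℝ).transpose * (g : Matrix (Fin N) (Fin N) ℝ) = 1 :=
    (Matrix.mem_orthogonalGroup_iff' _ _).1 g.2
  simp only [act, EuclideanSpace.inner_eq_star_dotProduct, star_trivial, Matrix.toLpLin_apply]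
  rw [Matrix.dotProduct_mulVec, ← Matrix.mulVec_transpose, Matrix.mulVec_mulVec, h,
    Matrix.one_mulVec]

/-- The action of an orthogonal matrix as a linear isometry. -/
noncomputable def actIsometry (g : Matrix.orthogonalGroup (Fin N) ℝ) :
    Space N ≃ₗᵢ[ℝ] Space N :=
  ((Matrix.toEuclideanLin (g : Matrix (Fin N) (Fin N) ℝ)).isometryOfInner
    (inner_act g)).toLinearIsometryEquiv rfl

theorem actIsometry_apply (g : Matrix.orthogonalGroup (Fin N) ℝ) (x : Space N) :
    actIsometry g x = act g x := rfl

theorem lap_comp_isometry (T : Space N ≃ₗᵢ[ℝ] Space N) {η : Space N → ℝ}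
    (hη : ContDiff ℝ (⊤ : ℕ∞) η) (x : Space N) : lap (fun y => η (T y)) x = lap η (T x) := by
  have hd : ∀ y, HasFDerivAt η (fderiv ℝ η y) y := fun y =>
    ((hη.differentiable (by simp)) y).hasFDerivAt
  have hd2 : ∀ y, HasFDerivAt (fderiv ℝ η) (fderiv ℝ (fderiv ℝ η) y) y := fun y =>
    (((hη.fderiv_right (m := (⊤ : ℕ∞)) (by simp)).differentiable (by simp)) y).hasFDerivAt
  have h1 : ∀ a b y : Space N, fderiv ℝ (fun z => fderiv ℝ η (T z) a) y b =
      fderiv ℝ (fderiv ℝ η) (T y) (T b) a := fun a b y => by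
    have h := ((hd2 (T y)).comp y T.toContinuousLinearEquiv.hasFDerivAt).clm_apply
      (hasFDerivAt_const a y)
    have h' : HasFDerivAt (fun z => fderiv ℝ η (T z) a) _ y := h
    rw [h'.fderiv]
    simp
  have h0 : ∀ a y : Space N, fderiv ℝ (fun z => η (T z)) y a = fderiv ℝ η (T y) (T a) :=
    fun a y => by
      have h : HasFDerivAt (fun z => η (T z)) _ y :=
        (hd (T y)).comp y T.toContinuousLinearEquiv.hasFDerivAt
      rw [h.fderiv]
      simp
  have h2 : ∀ a b y : Space N, fderiv ℝ (fun z => fderiv ℝ η z a) y b =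
      fderiv ℝ (fderiv ℝ η) y b a := fun a b y => by
    have h := (hd2 y).clm_apply (hasFDerivAt_const a y)
    have h' : HasFDerivAt (fun z => fderiv ℝ η z a) _ y := h
    rw [h'.fderiv]
    simp
  have hb := InnerProductSpace.laplacian_eq_iteratedFDeriv_orthonormalBasis η
    ((EuclideanSpace.basisFun (Fin N) ℝ).map T)
  have hb0 := InnerProductSpace.laplacian_eq_iteratedFDeriv_orthonormalBasis η
    (EuclideanSpace.basisFun (Fin N) ℝ)
  have hb' := congrFun (hb.symm.trans hb0) (T x)
  simp only [iteratedFDeriv_two_apply, OrthonormalBasis.map_apply,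
    EuclideanSpace.basisFun_apply, Matrix.cons_val_zero, Matrix.cons_val_one] at hb'
  have e1 : lap (fun y => η (T y)) x = ∑ i, fderiv ℝ (fderiv ℝ η) (T x)
      (T (EuclideanSpace.single i (1 : ℝ))) (T (EuclideanSpace.single i (1 : ℝ))) := by
    refine Finset.sum_congr rfl fun i _ => ?_
    have : pd i (fun y => η (T y)) = fun y => fderiv ℝ η (T y) (T (EuclideanSpace.single i 1)) :=
      funext fun y => h0 _ y
    rw [this]
    exact h1 _ _ x
  have e2 : lap η (T x) = ∑ i, fderiv ℝ (fderiv ℝ η) (T x)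
      (EuclideanSpace.single i (1 : ℝ)) (EuclideanSpace.single i (1 : ℝ)) :=
    Finset.sum_congr rfl fun i _ => h2 _ _ _
  rw [e1, e2]
  exact hb'

/-- The weak Laplacian commutes with linear isometries, hence inherits the symmetry
`u ∘ T = c u`. -/
theorem weakLaplacian_comp_isometry_ae_eq (hr : 1 ≤ r) (T : Space N ≃ₗᵢ[ℝ] Space N)
    {u : Space N → ℝ} {c : ℝ} (hu : TwiceWeaklyDifferentiable u)
    (hΔ : MemLp (weakLaplacian u) (ENNReal.ofReal r) volume)
    (h : ∀ᵐ x, u (T x) = c * u x) : ∀ᵐ x, weakLaplacian u (T x) = c * weakLaplacian u x := by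
  have hT := T.measurePreserving
  have hemb := T.toHomeomorph.measurableEmbedding
  have h1 : 1 ≤ ENNReal.ofReal r := ENNReal.one_le_ofReal.2 hr
  refine ae_eq_of_integral_contDiff_smul_eq
    ((hΔ.comp_measurePreserving hT).locallyIntegrable h1)
    ((hΔ.const_mul c).locallyIntegrable h1) fun η hη hc => ?_
  have ht : IsTest η := ⟨hη, hc⟩
  have ht' : IsTest fun y => η (T.symm y) :=
    ⟨hη.comp T.symm.contDiff, hc.comp_homeomorph T.symm.toHomeomorph⟩
  have e1 : ∫ x, η x * weakLaplacian u (T x) = ∫ y, weakLaplacian u y * η (T.symm y) := by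
    have := hT.integral_comp hemb (fun y => weakLaplacian u y * η (T.symm y))
    rw [← this]
    refine integral_congr_ae (ae_of_all _ fun x => ?_)
    simp [mul_comm]
  have e2 : ∫ y, u y * lap (fun y => η (T.symm y)) y = ∫ x, u (T x) * lap η x := by
    have := hT.integral_comp hemb (fun y => u y * lap (fun y => η (T.symm y)) y)
    rw [← this]
    refine integral_congr_ae (ae_of_all _ fun x => ?_)
    simp only [lap_comp_isometry T.symm hη, LinearIsometryEquiv.symm_apply_apply]
  have e3 : ∫ x, u (T x) * lap η x = c * ∫ x, u x * lap η x := by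
    rw [← integral_const_mul]
    refine integral_congr_ae ?_
    filter_upwards [h] with x hx
    rw [hx, mul_assoc]
  simp only [smul_eq_mul]
  rw [e1, ← hu.integral_mul_lap ht', e2, e3, hu.integral_mul_lap ht, ← integral_const_mul]
  refine integral_congr_ae (ae_of_all _ fun x => ?_)
  simp only []
  ring

theorem IsEquivariantD2.sub {G : Subgroup (Matrix.orthogonalGroup (Fin N) ℝ)} {φ : G →* ℤˣ}
    {u w : D2 N p r} (hu : IsEquivariantD2 φ u) (hw : IsEquivariantD2 φ w) :
    IsEquivariantD2 φ (u - w) := fun g => by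
  have hT : MeasurePreserving (act (g : Matrix.orthogonalGroup (Fin N) ℝ)) volume volume :=
    (actIsometry (g : Matrix.orthogonalGroup (Fin N) ℝ)).measurePreserving
  have hs := fnD2_sub u w
  filter_upwards [hu g, hw g, hs, hT.quasiMeasurePreserving.ae hs] with x h1 h2 h3 h4
  rw [h4, h3, h1, h2]
  ring

/-- For equivariant `u` the function `|Δu|` is invariant. -/
theorem IsEquivariantD2.enorm_weakLaplacian {G : Subgroup (Matrix.orthogonalGroup (Fin N) ℝ)}
    {φ : G →* ℤˣ} {u : D2 N p r} (hr : 1 ≤ r) (hu : IsEquivariantD2 φ u)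
    {g : Matrix.orthogonalGroup (Fin N) ℝ} (hg : g ∈ G) :
    ∀ᵐ x, ‖weakLaplacian (fnD2 u) (actIsometry g x)‖ₑ = ‖weakLaplacian (fnD2 u) x‖ₑ := by
  have h := weakLaplacian_comp_isometry_ae_eq hr (actIsometry g)
    (twiceWeaklyDifferentiable_fnD2 u) (memLp_weakLaplacian_fnD2 u) (hu ⟨g, hg⟩)
  filter_upwards [h] with x hx
  rw [hx, enorm_mul]
  rcases Int.units_eq_one_or (φ ⟨g, hg⟩) with h1 | h1 <;> simp [h1]

/-- Balls related by an isometry carry the same mass of an invariant function. -/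
theorem setLIntegral_closedBall_isometry (T : Space N ≃ₗᵢ[ℝ] Space N) {F : Space N → ENNReal}
    (hF : ∀ᵐ x, F (T x) = F x) (x : Space N) (s : ℝ) :
    ∫⁻ y in Metric.closedBall (T x) s, F y = ∫⁻ y in Metric.closedBall x s, F y := by
  have hT := T.measurePreserving
  have hemb := T.toHomeomorph.measurableEmbedding
  have hpre : T ⁻¹' Metric.closedBall (T x) s = Metric.closedBall x s := by
    ext y
    simp
  rw [← hT.setLIntegral_comp_preimage_emb hemb, hpre]
  exact lintegral_congr_ae (ae_restrict_of_ae hF)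

end Action

/-! ### Invariant cut-off functions -/

section Cutoff

variable {N : ℕ}

theorem act_mul (g h : Matrix.orthogonalGroup (Fin N) ℝ) (x : Space N) :
    act (g * h) x = act g (act h x) := by
  simp [act, Matrix.toLpLin_apply, Matrix.mulVec_mulVec]

theorem act_one (x : Space N) : act (1 : Matrix.orthogonalGroup (Fin N) ℝ) x = x := by
  simp [act]

theorem exists_radial_mollifier {s : ℝ} (hs : 0 < s) : ∃ ρ : Space N → ℝ, IsTest ρ ∧
    (∀ x, 0 ≤ ρ x) ∧ ∫ x, ρ x = 1 ∧ (∀ x, s ≤ ‖x‖ → ρ x = 0) ∧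
    ∀ (T : Space N ≃ₗᵢ[ℝ] Space N) (x : Space N), ρ (T x) = ρ x := by
  set b : Space N → ℝ := fun x => Real.smoothTransition (1 - ‖x‖ ^ 2 / s ^ 2) with hb
  have hb0 : ∀ x, s ≤ ‖x‖ → b x = 0 := fun x hx => by
    refine Real.smoothTransition.zero_of_nonpos ?_
    rw [sub_nonpos, one_le_div (by positivity)]
    exact pow_le_pow_left₀ hs.le hx 2
  have hbt : IsTest b := by
    refine ⟨Real.smoothTransition.contDiff.comp
      (contDiff_const.sub ((contDiff_norm_sq ℝ).div_const _)), ?_⟩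
    refine HasCompactSupport.intro (isCompact_closedBall (0 : Space N) s) fun x hx => hb0 x ?_
    rw [mem_closedBall_zero_iff, not_le] at hx
    exact hx.le
  have hbn : ∀ x, 0 ≤ b x := fun x => Real.smoothTransition.nonneg _
  have hpos : 0 < ∫ x, b x := by
    refine hbt.continuous.integral_pos_of_hasCompactSupport_nonneg_nonzero hbt.2 hbn (x := 0) ?_
    simp [hb]
  refine ⟨fun x => (∫ y, b y)⁻¹ * b x, hbt.mul_left contDiff_const,
    fun x => mul_nonneg (inv_nonneg.2 hpos.le) (hbn x), ?_, fun x hx => by simp [hb0 x hx],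
    fun T x => by simp [hb]⟩
  rw [integral_const_mul, inv_mul_cancel₀ hpos.ne']

/-- Every invariant subset `A` of a compact set has a smooth invariant cut-off function equal to `1`
on `A` and supported near `A`: mollify the indicator of a neighbourhood of `A` by a radial
kernel. -/
theorem exists_invariant_cutoff (G : Subgroup (Matrix.orthogonalGroup (Fin N) ℝ))
    {Θ K A : Set (Space N)} {s : ℝ} (hs : 0 < s) (hK : IsCompact K)
    (hKΘ : Metric.cthickening (2 * s) K ⊆ Θ) (hAK : A ⊆ K) (hA : IsInvariantSet G A) :
    ∃ ψ : Space N → ℝ, IsInvariantTestFunction G Θ ψ ∧ (∀ x, 0 ≤ ψ x) ∧ (∀ x, ψ x ≤ 1) ∧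
      (∀ x ∈ A, ψ x = 1) ∧ ∀ x, ψ x ≠ 0 → ∃ a ∈ A, dist x a < 2 * s := by
  obtain ⟨ρ, hρ, hρ0, hρ1, hρs, hρT⟩ := exists_radial_mollifier (N := N) hs
  set U := Metric.thickening s A
  have hU : MeasurableSet U := Metric.isOpen_thickening.measurableSet
  have hUinv : IsInvariantSet G U := fun g hg x hx => by
    rw [Metric.mem_thickening_iff] at hx ⊢
    obtain ⟨a, ha, hxa⟩ := hx
    refine ⟨act g a, hA g hg a ha, ?_⟩
    rw [← actIsometry_apply, ← actIsometry_apply, LinearIsometryEquiv.dist_map]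
    exact hxa
  set χ : Space N → ℝ := U.indicator fun _ => 1 with hχ
  have hχ0 : ∀ x, 0 ≤ χ x := fun x => Set.indicator_nonneg (fun _ _ => zero_le_one) x
  have hχ1 : ∀ x, χ x ≤ 1 := fun x => Set.indicator_le_self' (fun _ _ => zero_le_one) x
  have hχinv : ∀ g ∈ G, ∀ x, χ (act g x) = χ x := fun g hg x => by
    have : act g x ∈ U ↔ x ∈ U := by
      refine ⟨fun h => ?_, hUinv g hg x⟩
      have := hUinv g⁻¹ (G.inv_mem hg) _ h
      rwa [← act_mul, inv_mul_cancel, act_one] at this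
    by_cases hx : x ∈ U
    · simp only [hχ]
      rw [Set.indicator_of_mem hx, Set.indicator_of_mem (this.2 hx)]
    · simp only [hχ]
      rw [Set.indicator_of_notMem hx, Set.indicator_of_notMem (mt this.1 hx)]
  have hχloc : LocallyIntegrable χ volume :=
    ((locallyIntegrable_const (1 : ℝ)).indicator hU)
  have hint : ∀ x, Integrable fun y => ρ (x - y) := fun x =>
    (hρ.comp_sub_left x).continuous.integrable_of_hasCompactSupport (hρ.comp_sub_left x).2
  have hint1 : ∀ x, ∫ y, ρ (x - y) = 1 := fun x => by
    rw [integral_sub_left_eq_self ρ volume x, hρ1]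
  have hint' : ∀ x, Integrable fun y => ρ (x - y) * χ y := fun x => by
    simpa only [mul_comm] using hχloc.integrable_mul_isTest (hρ.comp_sub_left x)
  have hsupp : ∀ x, conv ρ χ x ≠ 0 → ∃ a ∈ A, dist x a < 2 * s := fun x hx => by
    by_contra! hcon
    refine hx (integral_eq_zero_of_ae (ae_of_all _ fun y => ?_))
    by_cases hy : y ∈ U
    · obtain ⟨a, ha, hya⟩ := Metric.mem_thickening_iff.1 hy
      have h1 := hcon a ha
      have h2 : s ≤ ‖x - y‖ := by
        rw [← dist_eq_norm]
        linarith [dist_triangle x y a]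
      simp [hρs _ h2]
    · simp [hχ, Set.indicator_of_notMem hy]
  have hts : tsupport (conv ρ χ) ⊆ Metric.cthickening (2 * s) K := by
    refine closure_minimal (fun x hx => ?_) Metric.isClosed_cthickening
    obtain ⟨a, ha, hxa⟩ := hsupp x hx
    exact Metric.mem_cthickening_of_dist_le x a _ K (hAK ha) hxa.le
  refine ⟨conv ρ χ, ⟨⟨contDiff_conv hρ hχloc, ?_, hts.trans hKΘ⟩, fun g hg x _ => ?_⟩,
    fun x => integral_nonneg fun y => mul_nonneg (hρ0 _) (hχ0 _), fun x => ?_, fun x hx => ?_,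
    hsupp⟩
  · exact hK.cthickening.of_isClosed_subset (isClosed_tsupport _) hts
  · have h := (actIsometry g).measurePreserving.integral_comp
      (actIsometry g).toHomeomorph.measurableEmbedding (fun y => ρ (act g x - y) * χ y)
    rw [conv, ← h]
    refine integral_congr_ae (ae_of_all _ fun y => ?_)
    simp only [actIsometry_apply, hχinv g hg]
    rw [← actIsometry_apply, ← actIsometry_apply, ← map_sub, hρT]
  · rw [← hint1 x]
    exact integral_mono (hint' x) (hint x) fun y => mul_le_of_le_one_right (hρ0 _) (hχ1 _)
  · rw [← hint1 x]
    refine integral_congr_ae (ae_of_all _ fun y => ?_)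
    by_cases hy : y ∈ U
    · simp [hχ, Set.indicator_of_mem hy]
    · have h2 : s ≤ ‖x - y‖ := by
        by_contra h
        refine hy (Metric.mem_thickening_iff.2 ⟨x, hx, ?_⟩)
        rw [dist_comm, dist_eq_norm]
        exact not_le.1 h
      simp [hρs _ h2]

end Cutoff

/-! ### Packings of balls -/

section Packing

variable {N : ℕ} {s : ℝ}

theorem volume_closedBall_eq (x : Space N) {R : ℝ} (hR : 0 ≤ R) :
    volume (Metric.closedBall x R) =
      ENNReal.ofReal (R ^ N) * volume (Metric.ball (0 : Space N) 1) := by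
  rw [Measure.addHaar_closedBall _ _ hR, finrank_euclideanSpace, Fintype.card_fin]

theorem card_mul_le_of_disjoint_closedBall {F : Finset (Space N)} (hs : 0 ≤ s)
    (hF : (F : Set (Space N)).PairwiseDisjoint fun t => Metric.closedBall t s) {y : Space N} {R : ℝ}
    (hR : 0 ≤ R) (hsub : ∀ t ∈ F, Metric.closedBall t s ⊆ Metric.closedBall y R) :
    F.card * ENNReal.ofReal (s ^ N) ≤ ENNReal.ofReal (R ^ N) := by
  have hω0 : volume (Metric.ball (0 : Space N) 1) ≠ 0 := (Metric.measure_ball_pos _ _ one_pos).ne'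
  have hω1 : volume (Metric.ball (0 : Space N) 1) ≠ ⊤ := measure_ball_lt_top.ne
  have h1 : ∑ t ∈ F, volume (Metric.closedBall t s) ≤ volume (Metric.closedBall y R) := by
    rw [← measure_biUnion_finset hF fun t _ => measurableSet_closedBall]
    exact measure_mono (Set.iUnion₂_subset hsub)
  rw [volume_closedBall_eq y hR, Finset.sum_congr rfl fun t _ => volume_closedBall_eq t hs,
    Finset.sum_const, nsmul_eq_mul, ← mul_assoc] at h1
  exact (ENNReal.mul_le_mul_iff_left hω0 hω1).1 h1

/-- A bounded set contains the centres of finitely many disjoint balls of radius `s` whose fourfold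
enlargements cover it. -/
theorem exists_finset_covering {A : Set (Space N)} (hA : Bornology.IsBounded A) (hs : 0 < s) :
    ∃ F : Finset (Space N), (F : Set (Space N)) ⊆ A ∧
      ((F : Set (Space N)).PairwiseDisjoint fun t => Metric.closedBall t s) ∧
      ∀ a ∈ A, ∃ t ∈ F, dist a t ≤ 4 * s := by
  obtain ⟨u, huA, hdis, hcov⟩ := Vitali.exists_disjoint_subfamily_covering_enlargement_closedBall
    A (fun x => x) (fun _ => s) s (fun _ _ => le_rfl) 4 (by norm_num)
  obtain ⟨R, hR⟩ := hA.subset_closedBall (0 : Space N)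
  have hfin : u.Finite := by
    by_contra hinf
    set M := ENNReal.ofReal ((max R 0 + s) ^ N) / ENNReal.ofReal (s ^ N)
    have hsN : ENNReal.ofReal (s ^ N) ≠ 0 := by simpa using pow_pos hs N
    have hM : M ≠ ⊤ := ENNReal.div_ne_top ENNReal.ofReal_ne_top hsN
    obtain ⟨n, hn⟩ := ENNReal.exists_nat_gt hM
    obtain ⟨F, hFu, hFn⟩ := Set.Infinite.exists_subset_card_eq hinf n
    have h := card_mul_le_of_disjoint_closedBall hs.le (hdis.subset hFu) (y := 0)
      (R := max R 0 + s) (by positivity) fun t ht => by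
        refine Metric.closedBall_subset_closedBall' ?_
        have := hR (huA (hFu ht))
        rw [Metric.mem_closedBall] at this
        linarith [le_max_left R 0]
    rw [hFn] at h
    exact absurd ((ENNReal.le_div_iff_mul_le (Or.inl hsN) (Or.inl ENNReal.ofReal_ne_top)).2 h)
      (not_le.2 hn)
  refine ⟨hfin.toFinset, by simpa using huA, by simpa using hdis, fun a ha => ?_⟩
  obtain ⟨b, hb, hsub⟩ := hcov a ha
  exact ⟨b, by simpa using hb, hsub (Metric.mem_closedBall_self hs.le)⟩

/-- The sevenfold enlargements of disjoint balls have bounded overlap. -/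
theorem sum_setLIntegral_closedBall_le {F : Finset (Space N)} (hs : 0 < s)
    (hF : (F : Set (Space N)).PairwiseDisjoint fun t => Metric.closedBall t s)
    {f : Space N → ENNReal} (hf : AEMeasurable f volume) :
    ∑ t ∈ F, ∫⁻ y in Metric.closedBall t (7 * s), f y ≤ 8 ^ N * ∫⁻ y, f y := by
  classical
  simp_rw [← lintegral_indicator (measurableSet_closedBall (x := _) (ε := 7 * s))]
  rw [← lintegral_finsetSum' _ fun t _ => hf.indicator measurableSet_closedBall,
    ← lintegral_const_mul'' _ hf]
  refine lintegral_mono fun y => ?_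
  set F' := F.filter fun t => y ∈ Metric.closedBall t (7 * s)
  have h1 : ∑ t ∈ F, (Metric.closedBall t (7 * s)).indicator f y = F'.card * f y := by
    simp only [Set.indicator_apply, F']
    rw [← Finset.sum_filter, Finset.sum_const, nsmul_eq_mul]
  have h2 := card_mul_le_of_disjoint_closedBall hs.le (F := F')
    (hF.subset fun t ht => Finset.mem_coe.2 (Finset.mem_filter.1 (Finset.mem_coe.1 ht)).1) (y := y)
    (R := 8 * s) (by positivity) fun t ht => by
      refine Metric.closedBall_subset_closedBall' ?_
      have := (Finset.mem_filter.1 ht).2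
      rw [Metric.mem_closedBall, dist_comm] at this
      linarith
  have hsN : ENNReal.ofReal (s ^ N) ≠ 0 := by simpa using pow_pos hs N
  rw [mul_pow, ENNReal.ofReal_mul (by positivity)] at h2
  have h3 := (ENNReal.mul_le_mul_iff_left hsN ENNReal.ofReal_ne_top).1 h2
  rw [h1]
  gcongr
  refine h3.trans_eq ?_
  rw [ENNReal.ofReal_pow (by norm_num)]
  norm_num

end Packing

/-! ### Localization by cut-off functions -/

section Localization

variable {N : ℕ} {p q r : ℝ} {w : ℕ → Space N → ℝ} {L : ENNReal} {η : Space N → ℝ}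

/-- A sequence in `D^{2,r}(ℝᴺ)` converging weakly to `0`, whose norms are bounded by `L`. -/
structure WeaklyNull (p q r : ℝ) (L : ENNReal) (w : ℕ → Space N → ℝ) : Prop where
  twice : ∀ k, TwiceWeaklyDifferentiable (w k)
  memLp : ∀ k, MemLp (w k) (ENNReal.ofReal p) volume
  memLp_weakLaplacian : ∀ k, MemLp (weakLaplacian (w k)) (ENNReal.ofReal r) volume
  ne_top : L ≠ ⊤
  bound : ∀ k, eLpNorm (weakLaplacian (w k)) (ENNReal.ofReal r) volume ≤ L
  tendsto : ∀ h, MemLp h (ENNReal.ofReal q) volume →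
      Tendsto (fun k => ∫ x, weakLaplacian (w k) x * h x) atTop (𝓝 0)

/-- The lower order part `2 ∇η · ∇u + u Δη` of `Δ(ηu)`. -/
noncomputable def leibnizRemainder (η u : Space N → ℝ) (x : Space N) : ℝ :=
  2 * (∑ i, pd i η x * weakPartial i u x) + lap η x * u x

theorem leibnizRemainder_eq (η u : Space N → ℝ) : leibnizRemainder η u =
    (2 : ℝ) • (∑ i, fun x => pd i η x * weakPartial i u x) + fun x => lap η x * u x := by
  ext x
  simp [leibnizRemainder]

theorem aestronglyMeasurable_leibnizRemainder (hN : 0 < N) {u : Space N → ℝ}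
    (hu : TwiceWeaklyDifferentiable u) (hη : IsTest η) :
    AEStronglyMeasurable (leibnizRemainder η u) volume := by
  rw [leibnizRemainder_eq]
  exact ((Finset.aestronglyMeasurable_sum _ fun i _ =>
    (hη.pd i).continuous.aestronglyMeasurable.mul
      (hu.weakPartial i i).1.2.1.aestronglyMeasurable).const_smul _).add
    (hη.lap.continuous.aestronglyMeasurable.mul (hu.locallyIntegrable hN).aestronglyMeasurable)

theorem tendsto_eLpNorm_isTest_mul {s : ENNReal} {f : ℕ → Space N → ℝ} {B : Set (Space N)}
    (hη : IsTest η) (hB : Function.support η ⊆ B)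
    (h : Tendsto (fun k => eLpNorm (f k) s (volume.restrict B)) atTop (𝓝 0)) :
    Tendsto (fun k => eLpNorm (fun x => η x * f k x) s volume) atTop (𝓝 0) := by
  obtain ⟨M, hM⟩ := hη.continuous.bounded_above_of_compact_support hη.2
  have h2 := ENNReal.Tendsto.const_mul (a := ENNReal.ofReal M) h (Or.inr ENNReal.ofReal_ne_top)
  rw [mul_zero] at h2
  refine tendsto_of_tendsto_of_tendsto_of_le_of_le tendsto_const_nhds h2
    (fun _ => zero_le) fun k => ?_
  have hs : Function.support (fun x => η x * f k x) ⊆ B :=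
    (Function.support_mul_subset_left _ _).trans hB
  rw [← eLpNorm_restrict_eq_of_support_subset hs]
  refine eLpNorm_le_mul_eLpNorm_of_ae_le_mul (ae_of_all _ fun x => ?_) s
  rw [norm_mul]
  exact mul_le_mul_of_nonneg_right (hM x) (norm_nonneg _)

theorem WeaklyNull.tendsto_leibnizRemainder (E : CriticalExponents N p q r)
    (W : WeaklyNull p q r L w) (hη : IsTest η) :
    Tendsto (fun k => eLpNorm (leibnizRemainder η (w k)) (ENNReal.ofReal r) volume) atTop
      (𝓝 0) := by
  have hN : 0 < N := by have := E.three_le; omega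
  have hr1 : 1 ≤ ENNReal.ofReal r := ENNReal.one_le_ofReal.2 E.one_lt_r.le
  set B := tsupport η
  have hB : volume B ≠ ⊤ := hη.2.measure_lt_top.ne
  have h0 := tendsto_eLpNorm_isTest_mul hη.lap
    ((subset_tsupport _).trans (support_lap_subset η))
    (tendsto_eLpNorm_restrict E W.twice W.memLp W.memLp_weakLaplacian W.ne_top W.bound W.tendsto hB)
  have h1 := fun i => tendsto_eLpNorm_isTest_mul (hη.pd i)
    ((subset_tsupport _).trans (support_pd_subset i η))
    (tendsto_eLpNorm_weakPartial_restrict E W.twice W.memLp W.memLp_weakLaplacian W.ne_top W.bound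
      W.tendsto hB i)
  have h2 := tendsto_finsetSum Finset.univ fun i _ => h1 i
  have h3 := (ENNReal.Tendsto.const_mul (a := ‖(2 : ℝ)‖ₑ) h2 (Or.inr (by simp))).add h0
  simp only [Finset.sum_const_zero, mul_zero, add_zero] at h3
  have m1 : ∀ k i, AEStronglyMeasurable (fun x => pd i η x * weakPartial i (w k) x) volume :=
    fun k i => (hη.pd i).continuous.aestronglyMeasurable.mul
      ((W.twice k).weakPartial i i).1.2.1.aestronglyMeasurable
  have m0 : ∀ k, AEStronglyMeasurable (fun x => lap η x * w k x) volume :=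
    fun k => hη.lap.continuous.aestronglyMeasurable.mul (W.memLp k).1
  refine tendsto_of_tendsto_of_tendsto_of_le_of_le tendsto_const_nhds h3
    (fun _ => zero_le) fun k => ?_
  have m2 : AEStronglyMeasurable (∑ i, fun x => pd i η x * weakPartial i (w k) x) volume :=
    Finset.aestronglyMeasurable_sum _ fun i _ => m1 k i
  rw [leibnizRemainder_eq]
  refine (eLpNorm_add_le (m2.const_smul _) (m0 k) hr1).trans ?_
  rw [eLpNorm_const_smul]
  gcongr
  exact eLpNorm_sum_le (fun i _ => m1 k i) hr1

/-- A local form of the Sobolev inequality, with a lower order error term. -/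
theorem exists_eLpNorm_restrict_le (E : CriticalExponents N p q r) :
    ∃ C : ENNReal, C ≠ ⊤ ∧ ∀ (u χ : Space N → ℝ) (S B : Set (Space N)),
      TwiceWeaklyDifferentiable u → IsTest χ → (∀ x, |χ x| ≤ 1) → (∀ x ∈ S, χ x = 1) →
      Function.support χ ⊆ B → MeasurableSet S →
      eLpNorm u (ENNReal.ofReal p) (volume.restrict S) ≤
        C * (eLpNorm (weakLaplacian u) (ENNReal.ofReal r) (volume.restrict B) +
          eLpNorm (leibnizRemainder χ u) (ENNReal.ofReal r) volume) := by
  obtain ⟨C, -, hS⟩ := exists_sobolev_hasCompactSupport E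
  have hN : 0 < N := by have := E.three_le; omega
  have hr1 : 1 ≤ ENNReal.ofReal r := ENNReal.one_le_ofReal.2 E.one_lt_r.le
  refine ⟨ENNReal.ofReal C, ENNReal.ofReal_ne_top, fun u χ S B hu hχ hχ1 hχS hχB hSm => ?_⟩
  have hlap : AEStronglyMeasurable (weakLaplacian u) volume :=
    (hu.locallyIntegrable_weakLaplacian).aestronglyMeasurable
  have m1 : AEStronglyMeasurable (fun x => χ x * weakLaplacian u x) volume :=
    hχ.continuous.aestronglyMeasurable.mul hlap
  have m2 := aestronglyMeasurable_leibnizRemainder hN hu hχ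
  have h1 : eLpNorm u (ENNReal.ofReal p) (volume.restrict S) ≤
      eLpNorm (fun x => χ x * u x) (ENNReal.ofReal p) volume := by
    refine le_trans (eLpNorm_congr_ae ?_).le
      (eLpNorm_mono_measure (fun x => χ x * u x) Measure.restrict_le_self)
    filter_upwards [ae_restrict_mem hSm] with x hx
    rw [hχS x hx, one_mul]
  refine h1.trans ((hS _ (hu.smooth_mul hχ.1) hχ.2.mul_right).trans ?_)
  gcongr
  rw [eLpNorm_congr_ae (hu.weakLaplacian_smooth_mul hχ.1)]
  refine (eLpNorm_add_le m1 m2 hr1).trans ?_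
  gcongr
  have hs : Function.support (fun x => χ x * weakLaplacian u x) ⊆ B :=
    (Function.support_mul_subset_left _ _).trans hχB
  rw [← eLpNorm_restrict_eq_of_support_subset hs]
  refine eLpNorm_mono fun x => ?_
  rw [norm_mul]
  exact mul_le_of_le_one_left (norm_nonneg _) (hχ1 x)

theorem exists_isTest_closedBall (t : Space N) {s : ℝ} (hs : 0 < s) :
    ∃ χ : Space N → ℝ, IsTest χ ∧ (∀ x, |χ x| ≤ 1) ∧ (∀ x ∈ Metric.closedBall t (6 * s), χ x = 1) ∧
      Function.support χ ⊆ Metric.closedBall t (7 * s) := by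
  let b : ContDiffBump t := ⟨6 * s, 7 * s, by positivity, by linarith⟩
  refine ⟨b, ⟨b.contDiff, b.hasCompactSupport⟩, fun x => ?_, fun x hx =>
    b.one_of_mem_closedBall hx, ?_⟩
  · rw [abs_of_nonneg b.nonneg]
    exact b.le_one
  · rw [b.support_eq]
    exact Metric.ball_subset_closedBall

theorem eLpNorm_ofReal_rpow {α : Type*} [MeasurableSpace α] {μ : Measure α} {f : α → ℝ} {s : ℝ}
    (hs : 0 < s) : eLpNorm f (ENNReal.ofReal s) μ ^ s = ∫⁻ x, ‖f x‖ₑ ^ s ∂μ := by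
  rw [eLpNorm_eq_lintegral_rpow_enorm_toReal (by simpa using hs) (by simp),
    ENNReal.toReal_ofReal hs.le, one_div, ENNReal.rpow_inv_rpow hs.ne']

theorem eLpNorm_ofReal_eq_lintegral {α : Type*} [MeasurableSpace α] {μ : Measure α} {f : α → ℝ}
    {s : ℝ} (hs : 0 < s) :
    eLpNorm f (ENNReal.ofReal s) μ = (∫⁻ x, ‖f x‖ₑ ^ s ∂μ) ^ (1 / s) := by
  rw [eLpNorm_eq_lintegral_rpow_enorm_toReal (by simpa using hs) (by simp),
    ENNReal.toReal_ofReal hs.le]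

end Localization

/-! ### Concentration on small sets -/

section Concentration

variable {N : ℕ} {p q r : ℝ} {w : ℕ → Space N → ℝ} {L : ENNReal}

/-- A bounded set is small if, around each of its points, the densities `f k` of total mass at most
`M` eventually carry mass at least `ε`: a covering is controlled by finitely many disjoint balls,
on which one single `f k` carries that mass. -/
theorem exists_covering_of_concentration {𝒰 : Filter ℕ} [𝒰.NeBot] {f : ℕ → Space N → ENNReal}
    {M ε : ENNReal} (hε0 : ε ≠ 0) (hε : ε ≠ ⊤) (hf : ∀ k, ∫⁻ y, f k y ≤ M)
    {A : Set (Space N)} {s : ℝ} (hs : 0 < s) (hA : Bornology.IsBounded A)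
    (hfA : ∀ x ∈ A, ∀ᶠ k in 𝒰, ε ≤ ∫⁻ y in Metric.closedBall x s, f k y) :
    ∃ U : Set (Space N), MeasurableSet U ∧ A ⊆ U ∧
      volume U ≤ M / ε * (ENNReal.ofReal ((4 * s) ^ N) * volume (Metric.ball (0 : Space N) 1)) := by
  obtain ⟨F, hFA, hdis, hcov⟩ := exists_finset_covering hA hs
  refine ⟨⋃ t ∈ F, Metric.closedBall t (4 * s),
    F.measurableSet_biUnion fun t _ => measurableSet_closedBall, fun a ha => ?_, ?_⟩
  · obtain ⟨t, ht, hat⟩ := hcov a ha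
    exact Set.mem_biUnion (Finset.mem_coe.2 ht) hat
  · obtain ⟨k, hk⟩ := ((eventually_all_finset F).2 fun t ht => hfA t (hFA ht)).exists
    have h1 : F.card * ε ≤ M := by
      calc (F.card : ENNReal) * ε = ∑ t ∈ F, ε := by rw [Finset.sum_const, nsmul_eq_mul]
        _ ≤ ∑ t ∈ F, ∫⁻ y in Metric.closedBall t s, f k y := Finset.sum_le_sum hk
        _ = ∫⁻ y in ⋃ t ∈ F, Metric.closedBall t s, f k y :=
          (lintegral_biUnion_finset hdis (fun _ _ => measurableSet_closedBall) _).symm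
        _ ≤ M := (setLIntegral_le_lintegral _ _).trans (hf k)
    refine (measure_biUnion_finset_le _ _).trans ?_
    rw [Finset.sum_congr rfl fun t _ => volume_closedBall_eq t (by positivity : 0 ≤ 4 * s),
      Finset.sum_const, nsmul_eq_mul]
    gcongr
    exact (ENNReal.le_div_iff_mul_le (Or.inl hε0) (Or.inl hε)).2 h1

/-- Near a set where the mass of `|Δw_k|^r` on balls is at most `ε`, the Sobolev inequality bounds
the mass of `|w_k|^p` by a positive power of `ε`. -/
theorem exists_eventually_lintegral_le (E : CriticalExponents N p q r) (hL : L ≠ ⊤) :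
    ∃ C : ENNReal, C ≠ ⊤ ∧ ∀ (w : ℕ → Space N → ℝ) (𝒰 : Filter ℕ) (ε : ENNReal) (s : ℝ)
      (A : Set (Space N)), WeaklyNull p q r L w → 𝒰 ≤ atTop → ε ≠ 0 → ε ≠ ⊤ → 0 < s →
      Bornology.IsBounded A →
      (∀ x ∈ A, ∀ᶠ k in 𝒰, ∫⁻ y in Metric.closedBall x (7 * s), ‖weakLaplacian (w k) y‖ₑ ^ r ≤ ε) →
      ∀ᶠ k in 𝒰, ∫⁻ y in {y | ∃ a ∈ A, dist y a < 2 * s}, ‖w k y‖ₑ ^ p ≤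
        C * ε ^ (p / r - 1) := by
  obtain ⟨C, hC, hloc⟩ := exists_eLpNorm_restrict_le E
  have hr := E.r_pos
  have hp := E.p_pos
  have hpr : 0 < p / r - 1 := by
    rw [sub_pos, one_lt_div hr]
    exact E.r_lt_p
  refine ⟨C ^ p * (2 ^ (p - 1) * (8 ^ N * L ^ r + 1)), ?_, fun w 𝒰 ε s A W h𝒰 hε0 hε hs hA hm => ?_⟩
  · have h1 : L ^ r ≠ ⊤ := ENNReal.rpow_ne_top_of_nonneg hr.le hL
    have h2 : C ^ p ≠ ⊤ := ENNReal.rpow_ne_top_of_nonneg hp.le hC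
    have h3 : (2 : ENNReal) ^ (p - 1) ≠ ⊤ :=
      ENNReal.rpow_ne_top_of_nonneg (by linarith [E.one_lt_p]) (by simp)
    finiteness
  -- the balls of radius `4s` about the points of `F` cover `A`, so those of radius `6s` cover the
  -- `2s`-neighbourhood, and the cut-off functions `χ t` live on balls of radius `7s`
  obtain ⟨F, hFA, hdis, hcov⟩ := exists_finset_covering hA hs
  choose χ hχ hχ1 hχS hχB using fun t : Space N => exists_isTest_closedBall t hs
  set m : ℕ → Space N → ENNReal := fun k t =>
    ∫⁻ y in Metric.closedBall t (7 * s), ‖weakLaplacian (w k) y‖ₑ ^ r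
  set ρ : ℕ → Space N → ENNReal := fun k t =>
    eLpNorm (leibnizRemainder (χ t) (w k)) (ENNReal.ofReal r) volume
  have hρ : Tendsto (fun k => ∑ t ∈ F, ρ k t ^ p) 𝒰 (𝓝 0) := by
    have h := tendsto_finsetSum F fun t _ =>
      ((ENNReal.continuous_rpow_const (y := p)).tendsto 0).comp
        (W.tendsto_leibnizRemainder E (hχ t))
    simp only [ENNReal.zero_rpow_of_pos hp, Finset.sum_const_zero] at h
    exact h.mono_left h𝒰
  have hev := hρ.eventually_le_const (ENNReal.rpow_pos (p := p / r - 1) (pos_iff_ne_zero.2 hε0) hε)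
  filter_upwards [hev, (eventually_all_finset F).2 fun t ht => hm t (hFA ht)] with k hk1 hk2
  have hsub : {y | ∃ a ∈ A, dist y a < 2 * s} ⊆ ⋃ t ∈ F, Metric.closedBall t (6 * s) := by
    rintro y ⟨a, ha, hya⟩
    obtain ⟨t, ht, hat⟩ := hcov a ha
    refine Set.mem_biUnion (Finset.mem_coe.2 ht) ?_
    rw [Metric.mem_closedBall]
    linarith [dist_triangle y a t]
  have hball : ∀ t ∈ F, ∫⁻ y in Metric.closedBall t (6 * s), ‖w k y‖ₑ ^ p ≤
      C ^ p * (2 ^ (p - 1) * (ε ^ (p / r - 1) * m k t + ρ k t ^ p)) := fun t ht => by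
    have h1 := hloc (w k) (χ t) _ _ (W.twice k) (hχ t) (hχ1 t) (hχS t) (hχB t)
      measurableSet_closedBall
    have h2 := ENNReal.rpow_le_rpow h1 hp.le
    rw [eLpNorm_ofReal_rpow hp, ENNReal.mul_rpow_of_nonneg _ _ hp.le] at h2
    refine h2.trans ?_
    gcongr
    refine (ENNReal.rpow_add_le_mul_rpow_add_rpow _ _ E.one_lt_p.le).trans ?_
    gcongr
    rw [eLpNorm_ofReal_eq_lintegral hr, ← ENNReal.rpow_mul]
    change m k t ^ (1 / r * p) ≤ _
    have e : 1 / r * p = (p / r - 1) + 1 := by ring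
    rw [e, ENNReal.rpow_add_of_nonneg _ _ hpr.le zero_le_one, ENNReal.rpow_one]
    gcongr
    exact hk2 t ht
  have hΔ : ∫⁻ y, ‖weakLaplacian (w k) y‖ₑ ^ r ≤ L ^ r := by
    rw [← eLpNorm_ofReal_rpow hr]
    exact ENNReal.rpow_le_rpow (W.bound k) hr.le
  have hsum : ∑ t ∈ F, m k t ≤ 8 ^ N * L ^ r :=
    (sum_setLIntegral_closedBall_le hs hdis
      ((W.memLp_weakLaplacian k).1.enorm.pow_const r)).trans (by gcongr)
  calc ∫⁻ y in {y | ∃ a ∈ A, dist y a < 2 * s}, ‖w k y‖ₑ ^ p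
      ≤ ∫⁻ y in ⋃ t ∈ F, Metric.closedBall t (6 * s), ‖w k y‖ₑ ^ p := lintegral_mono_set hsub
    _ ≤ ∑ t ∈ F, ∫⁻ y in Metric.closedBall t (6 * s), ‖w k y‖ₑ ^ p := by
      rw [← Finset.sum_coe_sort F, ← tsum_fintype (L := .unconditional _)]
      have := lintegral_iUnion_le (μ := volume)
        (fun t : F => Metric.closedBall (t : Space N) (6 * s)) fun y => ‖w k y‖ₑ ^ p
      rwa [Set.iUnion_subtype (· ∈ F)] at this
    _ ≤ ∑ t ∈ F, C ^ p * (2 ^ (p - 1) * (ε ^ (p / r - 1) * m k t + ρ k t ^ p)) :=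
      Finset.sum_le_sum hball
    _ = C ^ p * (2 ^ (p - 1) * (ε ^ (p / r - 1) * ∑ t ∈ F, m k t + ∑ t ∈ F, ρ k t ^ p)) := by
      simp only [Finset.mul_sum, Finset.sum_add_distrib, mul_add]
    _ ≤ C ^ p * (2 ^ (p - 1) * (ε ^ (p / r - 1) * (8 ^ N * L ^ r) + ε ^ (p / r - 1))) := by
      gcongr
    _ = _ := by ring

/-- Outside of a set of small measure, a weakly null sequence with `G`-invariant `|Δw_k|` does not
concentrate on `K`. More precisely there is a `G`-invariant cut-off function, equal to `1` on `K` up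
to a set of small measure, on whose support the `L^p` mass is small. The points of concentration are
singled out along an ultrafilter, which makes them an invariant set without passing to
subsequences. -/
theorem exists_cutoff_lintegral_le (E : CriticalExponents N p q r) (hL : L ≠ ⊤) :
    ∃ C : ENNReal, C ≠ ⊤ ∧ ∀ (G : Subgroup (Matrix.orthogonalGroup (Fin N) ℝ)) (K Θ : Set (Space N))
      (w : ℕ → Space N → ℝ) (𝒰 : Ultrafilter ℕ) (ε η₀ : ENNReal), WeaklyNull p q r L w →
      (𝒰 : Filter ℕ) ≤ atTop → IsCompact K → IsOpen Θ → K ⊆ Θ → IsInvariantSet G K →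
      (∀ g ∈ G, ∀ k, ∀ᵐ x, ‖weakLaplacian (w k) (actIsometry g x)‖ₑ = ‖weakLaplacian (w k) x‖ₑ) →
      ε ≠ 0 → ε ≠ ⊤ → η₀ ≠ 0 →
      ∃ (ψ : Space N → ℝ) (U : Set (Space N)), IsInvariantTestFunction G Θ ψ ∧ (∀ x, 0 ≤ ψ x) ∧
        (∀ x, ψ x ≤ 1) ∧ MeasurableSet U ∧ volume U ≤ η₀ ∧ (∀ x ∈ K \ U, ψ x = 1) ∧
        ∀ᶠ k in 𝒰, ∫⁻ y in Function.support ψ, ‖w k y‖ₑ ^ p ≤ C * ε ^ (p / r - 1) := by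
  obtain ⟨C, hC, hmain⟩ := exists_eventually_lintegral_le E hL
  refine ⟨C, hC, fun G K Θ w 𝒰 ε η₀ W h𝒰 hK hΘ hKΘ hKG hinv hε0 hε hη₀ => ?_⟩
  have hr := E.r_pos
  have hN : N ≠ 0 := by have := E.three_le; omega
  obtain ⟨δ, hδ, hδΘ⟩ := hK.exists_cthickening_subset_open hΘ hKΘ
  have hM : L ^ r ≠ ⊤ := ENNReal.rpow_ne_top_of_nonneg hr.le hL
  -- the radius is chosen so small that the concentration set has measure at most `η₀`
  have hlim : Tendsto (fun s : ℝ => L ^ r / ε * (ENNReal.ofReal ((4 * (7 * s)) ^ N) *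
      volume (Metric.ball (0 : Space N) 1))) (𝓝[>] 0) (𝓝 0) := by
    have h1 : Tendsto (fun s : ℝ => ENNReal.ofReal ((4 * (7 * s)) ^ N)) (𝓝[>] 0) (𝓝 0) := by
      have : Continuous fun s : ℝ => ENNReal.ofReal ((4 * (7 * s)) ^ N) :=
        ENNReal.continuous_ofReal.comp (by fun_prop)
      have h := this.tendsto 0
      simp only [mul_zero, zero_pow hN, ENNReal.ofReal_zero] at h
      exact h.mono_left nhdsWithin_le_nhds
    have h2 := ENNReal.Tendsto.const_mul (a := L ^ r / ε) (ENNReal.Tendsto.mul_const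
      (b := volume (Metric.ball (0 : Space N) 1)) h1 (Or.inr measure_ball_lt_top.ne))
      (Or.inr (ENNReal.div_ne_top hM hε0))
    simpa using h2
  obtain ⟨s, ⟨hsη, hsδ⟩, hs⟩ := ((hlim.eventually_le_const (pos_iff_ne_zero.2 hη₀)).and
    (nhdsWithin_le_nhds (Iic_mem_nhds (half_pos hδ)))).and self_mem_nhdsWithin |>.exists
  replace hs : 0 < s := hs
  set m : ℕ → Space N → ENNReal := fun k t =>
    ∫⁻ y in Metric.closedBall t (7 * s), ‖weakLaplacian (w k) y‖ₑ ^ r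
  set A : Set (Space N) := {x | x ∈ K ∧ ∀ᶠ k in 𝒰, m k x ≤ ε}
  have hAK : A ⊆ K := fun x hx => hx.1
  have hAG : IsInvariantSet G A := fun g hg x hx => by
    refine ⟨hKG g hg x hx.1, hx.2.mono fun k hk => ?_⟩
    refine le_trans (le_of_eq ?_) hk
    refine setLIntegral_closedBall_isometry (actIsometry g) ?_ x (7 * s)
    filter_upwards [hinv g hg k] with y hy
    rw [hy]
  obtain ⟨ψ, hψ, hψ0, hψ1, hψA, hψS⟩ := exists_invariant_cutoff G hs hK
    ((Metric.cthickening_mono (by linarith) K).trans hδΘ) hAK hAG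
  obtain ⟨U, hU, hAU, hUvol⟩ := exists_covering_of_concentration (𝒰 := (𝒰 : Filter ℕ))
    (f := fun k y => ‖weakLaplacian (w k) y‖ₑ ^ r) (M := L ^ r) hε0 hε (fun k => by
      rw [← eLpNorm_ofReal_rpow hr]
      exact ENNReal.rpow_le_rpow (W.bound k) hr.le) (A := K \ A) (s := 7 * s) (by positivity)
    (hK.isBounded.subset Set.sdiff_subset) fun x hx => by
      have h : ¬ ∀ᶠ k in 𝒰, m k x ≤ ε := fun h => hx.2 ⟨hx.1, h⟩
      exact (Ultrafilter.eventually_not.2 h).mono fun k hk => (not_le.1 hk).le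
  refine ⟨ψ, U, hψ, hψ0, hψ1, hU, hUvol.trans hsη, fun x hx => hψA x ?_,
    (hmain w 𝒰 ε s A W h𝒰 hε0 hε hs (hK.isBounded.subset hAK) fun x hx => hx.2).mono
      fun k hk => (lintegral_mono_set fun x hx => hψS x hx).trans hk⟩
  by_contra h
  exact hx.2 (hAU ⟨hx.1, h⟩)

end Concentration

/-! ### Passage to the limit in the nonlinear terms -/

section Limit

variable {N : ℕ} {p q r : ℝ} {L : ENNReal}

theorem exists_mul_rpow_le {C X : ENNReal} {a : ℝ} (hC : C ≠ ⊤) (ha : 0 < a) (hX : X ≠ 0) :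
    ∃ ε : ENNReal, ε ≠ 0 ∧ ε ≠ ⊤ ∧ C * ε ^ a ≤ X := by
  have h1 := ((ENNReal.continuous_rpow_const (y := a)).tendsto 0).comp
    ENNReal.tendsto_inv_nat_nhds_zero
  rw [ENNReal.zero_rpow_of_pos ha] at h1
  have h2 := ENNReal.Tendsto.const_mul (a := C) h1 (Or.inr hC)
  rw [mul_zero] at h2
  obtain ⟨n, hn, hn0⟩ := ((h2.eventually_le_const (pos_iff_ne_zero.2 hX)).and
    (eventually_gt_atTop 0)).exists
  exact ⟨(n : ENNReal)⁻¹, by simp, by simpa using hn0.ne', hn⟩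

theorem lintegral_enorm_spow_sub_le {α : Type*} [MeasurableSpace α] {μ : Measure α} {s σ C : ℝ}
    {a b M : α → ℝ} (hs : 0 < s) (hσ : 0 ≤ σ) (hC : 0 ≤ C) (ha : AEStronglyMeasurable a μ)
    (hb : AEStronglyMeasurable b μ)
    (h : ∀ x, |spow s (a x) - spow s (b x)| ≤ σ * (1 + |a x| ^ s + |b x| ^ s) + C * M x)
    (hM : ∀ x, 0 ≤ M x) :
    ∫⁻ x, ‖spow s (a x) - spow s (b x)‖ₑ ∂μ ≤
      ENNReal.ofReal σ * (μ Set.univ + ∫⁻ x, ‖a x‖ₑ ^ s ∂μ + ∫⁻ x, ‖b x‖ₑ ^ s ∂μ) +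
        ENNReal.ofReal C * ∫⁻ x, ENNReal.ofReal (M x) ∂μ := by
  have e : ∀ t : ℝ, ENNReal.ofReal (|t| ^ s) = ‖t‖ₑ ^ s := fun t => by
    rw [Real.enorm_eq_ofReal_abs, ENNReal.ofReal_rpow_of_nonneg (abs_nonneg t) hs.le]
  calc ∫⁻ x, ‖spow s (a x) - spow s (b x)‖ₑ ∂μ
      ≤ ∫⁻ x, (ENNReal.ofReal σ * (1 + ‖a x‖ₑ ^ s + ‖b x‖ₑ ^ s) +
          ENNReal.ofReal C * ENNReal.ofReal (M x)) ∂μ := by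
        refine lintegral_mono fun x => ?_
        rw [Real.enorm_eq_ofReal_abs]
        refine (ENNReal.ofReal_le_ofReal (h x)).trans_eq ?_
        have := hM x
        rw [ENNReal.ofReal_add (by positivity) (by positivity), ENNReal.ofReal_mul hσ,
          ENNReal.ofReal_mul hC, ENNReal.ofReal_add (by positivity) (by positivity),
          ENNReal.ofReal_add (by positivity) (by positivity), e, e, ENNReal.ofReal_one]
    _ = _ := by
        have ma := ha.enorm.pow_const s
        have mb := hb.enorm.pow_const s
        have m1 : AEMeasurable (fun x => 1 + ‖a x‖ₑ ^ s) μ := aemeasurable_const.add ma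
        have m2 : AEMeasurable
            (fun x => ENNReal.ofReal σ * (1 + ‖a x‖ₑ ^ s + ‖b x‖ₑ ^ s)) μ :=
          (m1.add mb).const_mul _
        rw [lintegral_add_left' m2, lintegral_const_mul' _ _ ENNReal.ofReal_ne_top,
          lintegral_const_mul' _ _ ENNReal.ofReal_ne_top, lintegral_add_left' m1,
          lintegral_add_left' aemeasurable_const, lintegral_one]

theorem enorm_integral_mul_le_of_bounded {α : Type*} [MeasurableSpace α] {μ : Measure α}
    {F h : α → ℝ} {H : ℝ} {K : Set α} (hK : MeasurableSet K) (hH : ∀ x, |h x| ≤ H)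
    (hh : Function.support h ⊆ K) :
    ‖∫ x, F x * h x ∂μ‖ₑ ≤ ENNReal.ofReal H * ∫⁻ x in K, ‖F x‖ₑ ∂μ := by
  refine (enorm_integral_le_lintegral_enorm _).trans ?_
  rw [← lintegral_const_mul' _ _ ENNReal.ofReal_ne_top, ← lintegral_indicator hK]
  refine lintegral_mono fun x => ?_
  by_cases hx : x ∈ K
  · rw [Set.indicator_of_mem hx, enorm_mul, mul_comm, Real.enorm_eq_ofReal_abs (h x)]
    gcongr
    exact hH x
  · have : h x = 0 := by
      by_contra h0
      exact hx (hh h0)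
    simp [this]

theorem WeaklyNull.tendsto_lintegral_enorm {w : ℕ → Space N → ℝ} (E : CriticalExponents N p q r)
    (W : WeaklyNull p q r L w) {B : Set (Space N)} (hB : volume B ≠ ⊤) :
    Tendsto (fun k => ∫⁻ x in B, ‖w k x‖ₑ) atTop (𝓝 0) := by
  have h1 := tendsto_eLpNorm_restrict E W.twice W.memLp W.memLp_weakLaplacian W.ne_top W.bound
    W.tendsto hB
  have hr1 : 1 ≤ ENNReal.ofReal r := ENNReal.one_le_ofReal.2 E.one_lt_r.le
  set c : ENNReal := volume.restrict B Set.univ ^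
    (1 / (1 : ENNReal).toReal - 1 / (ENNReal.ofReal r).toReal)
  have hc : c ≠ ⊤ := by
    refine ENNReal.rpow_ne_top_of_nonneg ?_ (by simpa using hB)
    rw [ENNReal.toReal_ofReal E.r_pos.le, sub_nonneg, ENNReal.toReal_one, div_one]
    exact (div_le_one E.r_pos).2 E.one_lt_r.le
  have h2 := ENNReal.Tendsto.mul_const (b := c) h1 (Or.inr hc)
  rw [zero_mul] at h2
  refine tendsto_of_tendsto_of_tendsto_of_le_of_le tendsto_const_nhds h2
    (fun _ => zero_le) fun k => ?_
  rw [← eLpNorm_one_eq_lintegral_enorm]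
  exact eLpNorm_le_eLpNorm_mul_rpow_measure_univ hr1 (W.memLp k).1.restrict

/-- The critical nonlinearity tested against `ψ w_k` is controlled by the mass of `|w_k|^p` on the
support of `ψ`. -/
theorem eventually_enorm_integral_spow_mul_le {w u : ℕ → Space N → ℝ} {u₀ ψ : Space N → ℝ}
    (E : CriticalExponents N p q r) (W : WeaklyNull p q r L w)
    (hw : ∀ k, w k =ᵐ[volume] fun x => u k x - u₀ x) (hu₀ : MemLp u₀ (ENNReal.ofReal p) volume)
    (hψ : IsTest ψ) (hψ1 : ∀ x, |ψ x| ≤ 1) {𝒰 : Filter ℕ} (h𝒰 : 𝒰 ≤ atTop) {X δ : ENNReal}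
    (hδ : δ ≠ 0) (hX : ∀ᶠ k in 𝒰, ∫⁻ y in Function.support ψ, ‖w k y‖ₑ ^ p ≤ X) :
    ∀ᶠ k in 𝒰, ‖∫ x, spow p (u k x) * (ψ x * w k x)‖ₑ ≤
      ENNReal.ofReal (2 ^ (p - 1)) * (X + δ + δ) := by
  have hp := E.p_pos
  have hS : MeasurableSet (Function.support ψ) := hψ.continuous.isOpen_support.measurableSet
  have hSv : volume (Function.support ψ) ≠ ⊤ :=
    (measure_mono (subset_tsupport ψ)).trans_lt hψ.2.measure_lt_top |>.ne
  -- cut off the large values of `u₀`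
  have htail : Tendsto (fun n : ℕ => ∫⁻ x, {x | (n : ℝ) < |u₀ x|}.indicator
      (fun x => ‖u₀ x‖ₑ ^ p) x) atTop (𝓝 (∫⁻ _ : Space N, 0)) := by
    have hm := hu₀.1.aemeasurable
    refine tendsto_lintegral_of_dominated_convergence' (fun x => ‖u₀ x‖ₑ ^ p)
      (fun n => ?_) (fun n => ae_of_all _ fun x => Set.indicator_le_self' (fun _ _ => zero_le) x)
      ?_ (ae_of_all _ fun x => ?_)
    · exact (hu₀.1.enorm.pow_const p).indicator₀ (nullMeasurableSet_lt aemeasurable_const hm.abs)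
    · rw [← eLpNorm_ofReal_rpow hp]
      exact ENNReal.rpow_ne_top_of_nonneg hp.le hu₀.2.ne
    · refine tendsto_const_nhds.congr' ?_
      obtain ⟨n, hn⟩ := exists_nat_ge |u₀ x|
      filter_upwards [eventually_ge_atTop n] with k hk
      rw [Set.indicator_of_notMem]
      rw [Set.mem_ofPred_eq, not_lt]
      exact hn.trans (by exact_mod_cast hk)
  rw [lintegral_zero] at htail
  obtain ⟨n, hn⟩ := (htail.eventually_le_const (pos_iff_ne_zero.2 hδ)).exists
  have h1 := ENNReal.Tendsto.const_mul (a := ENNReal.ofReal ((n : ℝ) ^ (p - 1)))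
    (W.tendsto_lintegral_enorm E hSv) (Or.inr ENNReal.ofReal_ne_top)
  rw [mul_zero] at h1
  filter_upwards [hX, h𝒰 (h1.eventually_le_const (pos_iff_ne_zero.2 hδ))] with k hk1 hk2
  have hpt : ∀ᵐ x, ‖spow p (u k x) * (ψ x * w k x)‖ₑ ≤ (Function.support ψ).indicator (fun x =>
      ENNReal.ofReal (2 ^ (p - 1)) * (‖w k x‖ₑ ^ p + ENNReal.ofReal ((n : ℝ) ^ (p - 1)) * ‖w k x‖ₑ +
        {x | (n : ℝ) < |u₀ x|}.indicator (fun x => ‖u₀ x‖ₑ ^ p) x)) x := by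
    filter_upwards [hw k] with x hx
    by_cases hxS : ψ x = 0
    · simp [hxS]
    · rw [Set.indicator_of_mem (by simpa using hxS)]
      have h2 := abs_spow_mul_sub_le E.one_lt_p (Nat.cast_nonneg n) (u k x) (u₀ x)
      rw [← hx] at h2
      have h3 : |spow p (u k x) * (ψ x * w k x)| ≤ |spow p (u k x) * w k x| := by
        rw [abs_mul, abs_mul, abs_mul]
        exact mul_le_mul_of_nonneg_left (mul_le_of_le_one_left (abs_nonneg _) (hψ1 x))
          (abs_nonneg _)
      rw [Real.enorm_eq_ofReal_abs]
      refine (ENNReal.ofReal_le_ofReal (h3.trans h2)).trans_eq ?_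
      rw [ENNReal.ofReal_mul (by positivity), ENNReal.ofReal_add (by positivity)
        (by split_ifs <;> positivity), ENNReal.ofReal_add (by positivity) (by positivity),
        ENNReal.ofReal_mul (by positivity), ← ENNReal.ofReal_rpow_of_nonneg (abs_nonneg _) hp.le,
        ← Real.enorm_eq_ofReal_abs]
      congr 2
      by_cases hx0 : (n : ℝ) < |u₀ x|
      · rw [if_pos hx0, Set.indicator_of_mem (by exact hx0),
          ← ENNReal.ofReal_rpow_of_nonneg (abs_nonneg _) hp.le, ← Real.enorm_eq_ofReal_abs]
      · rw [if_neg hx0, Set.indicator_of_notMem (by exact hx0), ENNReal.ofReal_zero]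
  refine (enorm_integral_le_lintegral_enorm _).trans ((lintegral_mono_ae hpt).trans ?_)
  rw [lintegral_indicator hS, lintegral_const_mul' _ _ ENNReal.ofReal_ne_top]
  have m1 := ((W.memLp k).1.enorm.pow_const p).restrict (s := Function.support ψ)
  have m2 := ((W.memLp k).1.enorm.const_mul
    (ENNReal.ofReal ((n : ℝ) ^ (p - 1)))).restrict (s := Function.support ψ)
  have m3 : AEMeasurable (fun x => ‖w k x‖ₑ ^ p + ENNReal.ofReal ((n : ℝ) ^ (p - 1)) * ‖w k x‖ₑ)
      (volume.restrict (Function.support ψ)) := m1.add m2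
  gcongr
  rw [lintegral_add_left' m3, lintegral_add_left' m1,
    lintegral_const_mul' _ _ ENNReal.ofReal_ne_top]
  gcongr
  exact (setLIntegral_le_lintegral _ _).trans hn

/-- Local convergence of the critical nonlinearity. -/
theorem tendsto_integral_spow_sub_mul {w u : ℕ → Space N → ℝ} {u₀ η : Space N → ℝ}
    (E : CriticalExponents N p q r) (W : WeaklyNull p q r L w)
    (hw : ∀ k, w k =ᵐ[volume] fun x => u k x - u₀ x)
    (hu : ∀ k, MemLp (u k) (ENNReal.ofReal p) volume) (hu₀ : MemLp u₀ (ENNReal.ofReal p) volume)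
    (hη : IsTest η) :
    Tendsto (fun k => ∫ x, (spow p (u k x) - spow p (u₀ x)) * η x) atTop (𝓝 0) := by
  have hp := E.p_pos
  have hp1 : 1 ≤ ENNReal.ofReal p := ENNReal.one_le_ofReal.2 E.one_lt_p.le
  obtain ⟨H, hH⟩ := hη.continuous.bounded_above_of_compact_support hη.2
  set K := tsupport η
  have hK : IsCompact K := hη.2
  have hKm : MeasurableSet K := (isClosed_tsupport η).measurableSet
  have hKv : volume K ≠ ⊤ := hK.measure_lt_top.ne
  -- a bound for `u k` in `L^p(K)`
  obtain ⟨A, hA, hAk⟩ : ∃ A : ENNReal, A ≠ ⊤ ∧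
      ∀ᶠ k in atTop, ∫⁻ x in K, ‖u k x‖ₑ ^ p ≤ A := by
    obtain ⟨R, hR0, hR⟩ := hK.isBounded.subset_closedBall_lt 0 (0 : Space N)
    obtain ⟨χ, hχ, hχ1, hχS, hχB⟩ := exists_isTest_closedBall (0 : Space N) hR0
    obtain ⟨C, hC, hloc⟩ := exists_eLpNorm_restrict_le E
    refine ⟨(C * (L + 1) + eLpNorm u₀ (ENNReal.ofReal p) volume) ^ p,
      ENNReal.rpow_ne_top_of_nonneg hp.le (ENNReal.add_ne_top.2
        ⟨ENNReal.mul_ne_top hC (ENNReal.add_ne_top.2 ⟨W.ne_top, ENNReal.one_ne_top⟩),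
          hu₀.2.ne⟩), ?_⟩
    filter_upwards [(W.tendsto_leibnizRemainder E hχ).eventually_le_const one_pos] with k hk
    rw [← eLpNorm_ofReal_rpow hp]
    refine ENNReal.rpow_le_rpow ?_ hp.le
    have e : u k =ᵐ[volume.restrict K] w k + u₀ := by
      filter_upwards [ae_restrict_of_ae (hw k)] with x hx
      rw [Pi.add_apply, hx]
      ring
    rw [eLpNorm_congr_ae e]
    refine (eLpNorm_add_le (W.memLp k).1.restrict hu₀.1.restrict hp1).trans ?_
    gcongr ?_ + ?_
    · refine (hloc (w k) χ K _ (W.twice k) hχ hχ1 (fun x hx => hχS x ?_) hχB hKm).trans ?_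
      · exact Metric.closedBall_subset_closedBall (by linarith) (hR hx)
      · gcongr
        exact (eLpNorm_mono_measure _ Measure.restrict_le_self).trans (W.bound k)
    · exact eLpNorm_mono_measure _ Measure.restrict_le_self
  have hb₀ : ∫⁻ x in K, ‖u₀ x‖ₑ ^ p ≠ ⊤ := by
    refine ((setLIntegral_le_lintegral _ _).trans_lt ?_).ne
    rw [← eLpNorm_ofReal_rpow hp]
    exact ENNReal.rpow_lt_top_of_nonneg hp.le hu₀.2.ne
  rw [tendsto_zero_iff_enorm_tendsto_zero]
  rw [ENNReal.tendsto_nhds_zero]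
  intro τ hτ
  set B := volume K + A + ∫⁻ x in K, ‖u₀ x‖ₑ ^ p
  have hB : B ≠ ⊤ := by finiteness
  obtain ⟨τ', hτ'0, -, hτ'⟩ := exists_mul_rpow_le (C := ENNReal.ofReal H * 2) (a := 1) (X := τ)
    (by finiteness) one_pos hτ.ne'
  rw [ENNReal.rpow_one] at hτ'
  obtain ⟨σ, hσ0, hσt, hσ⟩ := exists_mul_rpow_le hB one_pos hτ'0
  rw [ENNReal.rpow_one] at hσ
  obtain ⟨C, hC, hCσ⟩ := exists_abs_spow_sub_le_abs_sub E.one_lt_p (ENNReal.toReal_pos hσ0 hσt)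
  have h1 := ENNReal.Tendsto.const_mul (a := ENNReal.ofReal C) (W.tendsto_lintegral_enorm E hKv)
    (Or.inr ENNReal.ofReal_ne_top)
  rw [mul_zero] at h1
  filter_upwards [hAk, h1.eventually_le_const (pos_iff_ne_zero.2 hτ'0)] with k hk1 hk2
  refine (enorm_integral_mul_le_of_bounded hKm hH (subset_tsupport η)).trans ?_
  refine le_trans ?_ hτ'
  rw [mul_assoc]
  gcongr
  refine (lintegral_enorm_spow_sub_le hp ENNReal.toReal_nonneg hC (hu k).1.restrict hu₀.1.restrict
    (fun x => hCσ (u k x) (u₀ x)) fun x => abs_nonneg _).trans ?_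
  rw [two_mul, ENNReal.ofReal_toReal hσt, Measure.restrict_apply_univ]
  refine add_le_add (le_trans ?_ hσ) (le_trans (le_of_eq ?_) hk2)
  · rw [mul_comm]
    simp only [B]
    gcongr
  · congr 1
    refine lintegral_congr_ae ?_
    filter_upwards [ae_restrict_of_ae (hw k)] with x hx
    rw [hx, Real.enorm_eq_ofReal_abs]

end Limit

/-! ### Convergence of the derivative -/

section Derivative

variable {N : ℕ} {p q r : ℝ} {L : ENNReal} {v : ℕ → D2 N p r} {v₀ : D2 N p r} {η ψ : Space N → ℝ}

theorem WeaklyConverges.exists_weaklyNull (E : CriticalExponents N p q r)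
    (hv : WeaklyConverges v v₀) : ∃ L : ENNReal, WeaklyNull p q r L (fun k => fnD2 (v k - v₀)) ∧
      (∀ k, eLpNorm (weakLaplacian (fnD2 (v k))) (ENNReal.ofReal r) volume ≤ L) ∧
      eLpNorm (weakLaplacian (fnD2 v₀)) (ENNReal.ofReal r) volume ≤ L := by
  have hr1 : 1 ≤ ENNReal.ofReal r := ENNReal.one_le_ofReal.2 E.one_lt_r.le
  have hv0 := memLp_weakLaplacian_fnD2 v₀
  obtain ⟨L, hL, hvL⟩ := exists_eLpNorm_le_of_tendsto E.conj
    (fun k => memLp_weakLaplacian_fnD2 (v k)) fun g hg => hv.tendsto_integral E.conj hg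
  refine ⟨L + eLpNorm (weakLaplacian (fnD2 v₀)) (ENNReal.ofReal r) volume,
    ⟨fun k => twiceWeaklyDifferentiable_fnD2 _, fun k => memLp_fnD2 _,
      fun k => memLp_weakLaplacian_fnD2 _, ENNReal.add_ne_top.2 ⟨hL, hv0.2.ne⟩, fun k => ?_,
      fun h hh => ?_⟩, fun k => (hvL k).trans le_self_add, le_add_self⟩
  · rw [eLpNorm_congr_ae (weakLaplacian_fnD2_sub (v k) v₀)]
    exact (eLpNorm_sub_le (memLp_weakLaplacian_fnD2 (v k)).1 hv0.1 hr1).trans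
      (by gcongr; exact hvL k)
  · have h1 := (hv.tendsto_integral E.conj hh).sub_const (∫ x, weakLaplacian (fnD2 v₀) x * h x)
    rw [sub_self] at h1
    refine h1.congr fun k => ?_
    rw [← integral_sub (integrable_mul_of_memLp E.conj (memLp_weakLaplacian_fnD2 (v k)) hh)
      (integrable_mul_of_memLp E.conj hv0 hh)]
    refine integral_congr_ae ?_
    filter_upwards [weakLaplacian_fnD2_sub (v k) v₀] with x hx
    rw [hx, sub_mul]

theorem memLp_isTest_mul {s : ENNReal} {f : Space N → ℝ} (hψ : IsTest ψ) (hf : MemLp f s volume) :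
    MemLp (fun x => ψ x * f x) s volume := by
  obtain ⟨M, hM⟩ := hψ.continuous.bounded_above_of_compact_support hψ.2
  refine hf.of_le_mul (c := M) (hψ.continuous.aestronglyMeasurable.mul hf.1)
    (ae_of_all _ fun x => ?_)
  rw [norm_mul]
  exact mul_le_mul_of_nonneg_right (hM x) (norm_nonneg _)

/-- Testing `J'(v_k)` with `ψ (v_k - v)`, the lower order terms and the terms that are linear in
`v_k - v` drop out. -/
theorem tendsto_integral_cutoff_mul_spow_sub (E : CriticalExponents N p q r)
    (W : WeaklyNull p q r L (fun k => fnD2 (v k - v₀)))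
    (hvL : ∀ k, eLpNorm (weakLaplacian (fnD2 (v k))) (ENNReal.ofReal r) volume ≤ L)
    (hψ : IsTest ψ) (h : Tendsto (fun k => derivJ p r (fnD2 (v k))
      (fun x => ψ x * fnD2 (v k - v₀) x)) atTop (𝓝 0)) :
    Tendsto (fun k => (∫ x, ψ x * ((spow r (weakLaplacian (fnD2 (v k)) x) -
        spow r (weakLaplacian (fnD2 v₀) x)) *
          (weakLaplacian (fnD2 (v k)) x - weakLaplacian (fnD2 v₀) x))) -
      ∫ x, spow p (fnD2 (v k) x) * (ψ x * fnD2 (v k - v₀) x)) atTop (𝓝 0) := by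
  have hN : 0 < N := by have := E.three_le; omega
  have hr1 : 0 ≤ r - 1 := by linarith [E.one_lt_r]
  have hf := fun k => memLp_weakLaplacian_fnD2 (v k)
  have hf0 := memLp_weakLaplacian_fnD2 v₀
  have hrem := W.tendsto_leibnizRemainder E hψ
  -- the lower order terms
  have h1 : Tendsto (fun k => ∫ x, spow r (weakLaplacian (fnD2 (v k)) x) *
      leibnizRemainder ψ (fnD2 (v k - v₀)) x) atTop (𝓝 0) := by
    have h2 := ENNReal.Tendsto.const_mul (a := L ^ (r - 1)) hrem
      (Or.inr (ENNReal.rpow_ne_top_of_nonneg hr1 W.ne_top))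
    rw [mul_zero] at h2
    rw [tendsto_zero_iff_enorm_tendsto_zero]
    refine tendsto_of_tendsto_of_tendsto_of_le_of_le tendsto_const_nhds h2
      (fun _ => zero_le) fun k => ?_
    refine (enorm_integral_mul_le E.conj.symm (memLp_spow E.conj (hf k)).1
      (aestronglyMeasurable_leibnizRemainder hN (W.twice k) hψ)).trans ?_
    rw [eLpNorm_spow E.conj (hf k)]
    gcongr
    exact hvL k
  -- the linear terms
  have h2 := W.tendsto _ (memLp_isTest_mul hψ (memLp_spow E.conj hf0))
  have h3 := (h.sub h1).sub h2
  simp only [sub_zero] at h3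
  refine h3.congr' ?_
  filter_upwards [hrem.eventually_le_const one_pos] with k hk
  set f := weakLaplacian (fnD2 (v k))
  set f₀ := weakLaplacian (fnD2 v₀)
  set w := fnD2 (v k - v₀)
  set R := leibnizRemainder ψ w
  have hR : MemLp R (ENNReal.ofReal r) volume :=
    ⟨aestronglyMeasurable_leibnizRemainder hN (W.twice k) hψ, hk.trans_lt ENNReal.one_lt_top⟩
  have hsub : MemLp (fun x => f x - f₀ x) (ENNReal.ofReal r) volume := (hf k).sub hf0
  have i1 : Integrable fun x => spow r (f x) * R x :=
    integrable_mul_of_memLp E.conj.symm (memLp_spow E.conj (hf k)) hR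
  have i2 : Integrable fun x => spow r (f x) * (ψ x * (f x - f₀ x)) :=
    integrable_mul_of_memLp E.conj.symm (memLp_spow E.conj (hf k)) (memLp_isTest_mul hψ hsub)
  have i3 : Integrable fun x => (f x - f₀ x) * (ψ x * spow r (f₀ x)) :=
    integrable_mul_of_memLp E.conj hsub (memLp_isTest_mul hψ (memLp_spow E.conj hf0))
  have e1 : ∫ x, |f x| ^ (r - 2) * f x * weakLaplacian (fun x => ψ x * w x) x =
      (∫ x, spow r (f x) * (ψ x * (f x - f₀ x))) + ∫ x, spow r (f x) * R x := by
    rw [← integral_add i2 i1]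
    refine integral_congr_ae ?_
    filter_upwards [(W.twice k).weakLaplacian_smooth_mul hψ.1, weakLaplacian_fnD2_sub (v k) v₀]
      with x hx hx'
    rw [hx, hx', ← mul_add]
    rfl
  have e2 : ∫ x, weakLaplacian w x * (ψ x * spow r (f₀ x)) =
      ∫ x, (f x - f₀ x) * (ψ x * spow r (f₀ x)) := by
    refine integral_congr_ae ?_
    filter_upwards [weakLaplacian_fnD2_sub (v k) v₀] with x hx
    rw [hx]
  have e3 : ∫ x, ψ x * ((spow r (f x) - spow r (f₀ x)) * (f x - f₀ x)) =
      (∫ x, spow r (f x) * (ψ x * (f x - f₀ x))) -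
        ∫ x, (f x - f₀ x) * (ψ x * spow r (f₀ x)) := by
    rw [← integral_sub i2 i3]
    refine integral_congr_ae (ae_of_all _ fun x => ?_)
    simp only []
    ring
  have e4 : derivJ p r (fnD2 (v k)) (fun x => ψ x * w x) =
      (∫ x, |f x| ^ (r - 2) * f x * weakLaplacian (fun x => ψ x * w x) x) -
        ∫ x, spow p (fnD2 (v k) x) * (ψ x * w x) := rfl
  rw [e4, e1, e2, e3]
  ring

theorem eLpNorm_spow_restrict_le (h : r.HolderConjugate q) {f : Space N → ℝ}
    (hf : MemLp f (ENNReal.ofReal r) volume) (hfL : eLpNorm f (ENNReal.ofReal r) volume ≤ L)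
    (U : Set (Space N)) :
    eLpNorm (fun x => spow r (f x)) 1 (volume.restrict U) ≤ L ^ (r - 1) * volume U ^ (1 / r) := by
  have hr1 : 0 ≤ r - 1 := by linarith [h.lt]
  have hs := memLp_spow h hf
  have h1 := eLpNorm_mul_le h.symm (μ := volume.restrict U) hs.1.restrict
    (aestronglyMeasurable_const (b := (1 : ℝ)))
  simp only [mul_one] at h1
  refine h1.trans (mul_le_mul' ?_ ?_)
  · refine (eLpNorm_mono_measure _ Measure.restrict_le_self).trans ?_
    rw [eLpNorm_spow h hf]
    gcongr
  · rw [eLpNorm_ofReal_eq_lintegral h.pos]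
    simp only [enorm_one, ENNReal.one_rpow, lintegral_one, Measure.restrict_apply_univ]
    exact le_rfl

/-- The difference of the nonlinear terms is controlled by monotonicity on the set where `ψ = 1`,
and by Hölder's inequality on the remaining set `U`. -/
theorem enorm_integral_spow_sub_mul_le (hrq : r.HolderConjugate q) {f f₀ h : Space N → ℝ}
    {K U : Set (Space N)} {σ C H : ℝ} (hf : MemLp f (ENNReal.ofReal r) volume)
    (hf₀ : MemLp f₀ (ENNReal.ofReal r) volume) (hfL : eLpNorm f (ENNReal.ofReal r) volume ≤ L)
    (hf₀L : eLpNorm f₀ (ENNReal.ofReal r) volume ≤ L) (hσ : 0 ≤ σ) (hC : 0 ≤ C)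
    (hCσ : ∀ a b, |spow r a - spow r b| ≤
      σ * (1 + |a| ^ r + |b| ^ r) + C * ((spow r a - spow r b) * (a - b)))
    (hψ : IsTest ψ) (hψ0 : ∀ x, 0 ≤ ψ x) (hK : MeasurableSet K) (hU : MeasurableSet U)
    (hψK : ∀ x ∈ K \ U, ψ x = 1) (hH : ∀ x, |h x| ≤ H) (hh : Function.support h ⊆ K) :
    ‖∫ x, (spow r (f x) - spow r (f₀ x)) * h x‖ₑ ≤
      ENNReal.ofReal H * ((volume K + L ^ r + L ^ r) * ENNReal.ofReal σ +
        ENNReal.ofReal C * ‖∫ x, ψ x * ((spow r (f x) - spow r (f₀ x)) * (f x - f₀ x))‖ₑ +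
        (L ^ (r - 1) + L ^ (r - 1)) * volume U ^ (1 / r)) := by
  have hr := hrq.pos
  set M : Space N → ℝ := fun x => (spow r (f x) - spow r (f₀ x)) * (f x - f₀ x)
  have hM : ∀ x, 0 ≤ M x := fun x => spow_sub_mul_nonneg hrq.lt _ _
  have hMi : Integrable fun x => ψ x * M x := by
    have hs : MemLp (fun x => spow r (f x) - spow r (f₀ x)) (ENNReal.ofReal q) volume :=
      (memLp_spow hrq hf).sub (memLp_spow hrq hf₀)
    refine (integrable_mul_of_memLp hrq.symm hs (memLp_isTest_mul hψ (hf.sub hf₀))).congr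
      (ae_of_all _ fun x => ?_)
    simp only [M, Pi.sub_apply]
    ring
  have hMX : ∫⁻ x in K \ U, ENNReal.ofReal (M x) ≤ ‖∫ x, ψ x * M x‖ₑ := by
    calc ∫⁻ x in K \ U, ENNReal.ofReal (M x)
        = ∫⁻ x in K \ U, ENNReal.ofReal (ψ x * M x) := by
          refine setLIntegral_congr_fun (hK.diff hU) fun x hx => ?_
          simp only [hψK x hx, one_mul]
      _ ≤ ∫⁻ x, ENNReal.ofReal (ψ x * M x) := setLIntegral_le_lintegral _ _
      _ = ‖∫ x, ψ x * M x‖ₑ := by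
          rw [← ofReal_integral_eq_lintegral_ofReal hMi
            (ae_of_all _ fun x => mul_nonneg (hψ0 x) (hM x)), Real.enorm_eq_ofReal_abs,
            abs_of_nonneg (integral_nonneg fun x => mul_nonneg (hψ0 x) (hM x))]
  have hfr : ∀ g : Space N → ℝ, eLpNorm g (ENNReal.ofReal r) volume ≤ L →
      ∫⁻ x in K \ U, ‖g x‖ₑ ^ r ≤ L ^ r := fun g hg => by
    refine (setLIntegral_le_lintegral _ _).trans ?_
    rw [← eLpNorm_ofReal_rpow hr]
    exact ENNReal.rpow_le_rpow hg hr.le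
  have hout : ∫⁻ x in K \ U, ‖spow r (f x) - spow r (f₀ x)‖ₑ ≤
      (volume K + L ^ r + L ^ r) * ENNReal.ofReal σ +
        ENNReal.ofReal C * ‖∫ x, ψ x * M x‖ₑ := by
    refine (lintegral_enorm_spow_sub_le hr hσ hC hf.1.restrict hf₀.1.restrict
      (fun x => hCσ (f x) (f₀ x)) hM).trans ?_
    rw [Measure.restrict_apply_univ, mul_comm (ENNReal.ofReal σ)]
    gcongr
    · exact Set.sdiff_subset
    · exact hfr _ hfL
    · exact hfr _ hf₀L
  have hin : ∫⁻ x in U, ‖spow r (f x) - spow r (f₀ x)‖ₑ ≤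
      (L ^ (r - 1) + L ^ (r - 1)) * volume U ^ (1 / r) := by
    rw [← eLpNorm_one_eq_lintegral_enorm, add_mul]
    exact (eLpNorm_sub_le (memLp_spow hrq hf).1.restrict (memLp_spow hrq hf₀).1.restrict
      le_rfl).trans (add_le_add (eLpNorm_spow_restrict_le hrq hf hfL U)
        (eLpNorm_spow_restrict_le hrq hf₀ hf₀L U))
  refine (enorm_integral_mul_le_of_bounded hK hH hh).trans ?_
  gcongr
  have hKU : K ⊆ (K \ U) ∪ U := fun x hx => by
    by_cases hxU : x ∈ U
    · exact Or.inr hxU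
    · exact Or.inl ⟨hx, hxU⟩
  exact (lintegral_mono_set hKU).trans ((lintegral_union_le _ _ _).trans (add_le_add hout hin))

/-- The nonlinear second order term converges along every ultrafilter. -/
theorem tendsto_integral_spow_weakLaplacian (E : CriticalExponents N p q r)
    {G : Subgroup (Matrix.orthogonalGroup (Fin N) ℝ)} {φ : G →* ℤˣ} {Θ K : Set (Space N)}
    (hΘ : IsOpen Θ) (hv : ∀ k, IsEquivariantD2 φ (v k)) (hv₀ : IsEquivariantD2 φ v₀)
    (W : WeaklyNull p q r L (fun k => fnD2 (v k - v₀)))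
    (hvL : ∀ k, eLpNorm (weakLaplacian (fnD2 (v k))) (ENNReal.ofReal r) volume ≤ L)
    (hv₀L : eLpNorm (weakLaplacian (fnD2 v₀)) (ENNReal.ofReal r) volume ≤ L)
    (h₂ : ∀ ψ, IsInvariantTestFunction G Θ ψ → Tendsto (fun k => derivJ p r (fnD2 (v k))
      (fun x => ψ x * fnD2 (v k - v₀) x)) atTop (𝓝 0))
    {𝒰 : Ultrafilter ℕ} (h𝒰 : (𝒰 : Filter ℕ) ≤ atTop) {h : Space N → ℝ} {H : ℝ}
    (hH : ∀ x, |h x| ≤ H) (hh : Function.support h ⊆ K) (hK : IsCompact K)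
    (hKΘ : K ⊆ Θ) (hKG : IsInvariantSet G K) :
    Tendsto (fun k => ∫ x, (spow r (weakLaplacian (fnD2 (v k)) x) -
      spow r (weakLaplacian (fnD2 v₀) x)) * h x) 𝒰 (𝓝 0) := by
  have hr := E.r_pos
  have hpr : 0 < p / r - 1 := by
    rw [sub_pos, one_lt_div hr]
    exact E.r_lt_p
  have hLr : L ^ r ≠ ⊤ := ENNReal.rpow_ne_top_of_nonneg hr.le W.ne_top
  have hLr1 : L ^ (r - 1) ≠ ⊤ :=
    ENNReal.rpow_ne_top_of_nonneg (by linarith [E.one_lt_r]) W.ne_top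
  have hKv : volume K ≠ ⊤ := hK.measure_lt_top.ne
  obtain ⟨C₀, hC₀, hconc⟩ := exists_cutoff_lintegral_le E W.ne_top
  rw [tendsto_zero_iff_enorm_tendsto_zero, ENNReal.tendsto_nhds_zero]
  intro τ hτ
  obtain ⟨τ', hτ'0, -, hτ'⟩ := exists_mul_rpow_le (C := ENNReal.ofReal H * 3) (a := 1) (X := τ)
    (ENNReal.mul_ne_top ENNReal.ofReal_ne_top (by simp)) one_pos hτ.ne'
  rw [ENNReal.rpow_one] at hτ'
  -- choose the constant of the monotonicity inequality, the level of concentration, and the size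
  -- of the concentration set, in this order
  obtain ⟨σ, hσ0, hσt, hσ⟩ := exists_mul_rpow_le (C := volume K + L ^ r + L ^ r)
    (ENNReal.add_ne_top.2 ⟨ENNReal.add_ne_top.2 ⟨hKv, hLr⟩, hLr⟩) one_pos hτ'0
  rw [ENNReal.rpow_one] at hσ
  obtain ⟨C, hC, hCσ⟩ := exists_abs_spow_sub_le_mul E.one_lt_r (ENNReal.toReal_pos hσ0 hσt)
  set c := ENNReal.ofReal (2 ^ (p - 1))
  obtain ⟨X, hX0, -, hX⟩ := exists_mul_rpow_le (C := ENNReal.ofReal C * (c * 3 + 1))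
    (ENNReal.mul_ne_top ENNReal.ofReal_ne_top (ENNReal.add_ne_top.2
      ⟨ENNReal.mul_ne_top ENNReal.ofReal_ne_top (by simp), ENNReal.one_ne_top⟩)) one_pos hτ'0
  rw [ENNReal.rpow_one] at hX
  obtain ⟨ε, hε0, hεt, hε⟩ := exists_mul_rpow_le hC₀ hpr hX0
  obtain ⟨η₀, hη0, -, hη⟩ := exists_mul_rpow_le (C := L ^ (r - 1) + L ^ (r - 1))
    (ENNReal.add_ne_top.2 ⟨hLr1, hLr1⟩) (one_div_pos.2 hr) hτ'0
  obtain ⟨ψ, U, hψ, hψ0, hψ1, hU, hUv, hψK, hψw⟩ := hconc G K Θ _ 𝒰 ε η₀ W h𝒰 hK hΘ hKΘ hKG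
    (fun g hg k => ((hv k).sub hv₀).enorm_weakLaplacian E.one_lt_r.le hg) hε0 hεt hη0
  have hψt : IsTest ψ := ⟨hψ.1.1, hψ.1.2.1⟩
  have hψa : ∀ x, |ψ x| ≤ 1 := fun x => by rw [abs_of_nonneg (hψ0 x)]; exact hψ1 x
  have hmono := h𝒰 ((tendsto_zero_iff_enorm_tendsto_zero.1 (tendsto_integral_cutoff_mul_spow_sub E W
    hvL hψt (h₂ ψ hψ))).eventually_le_const (pos_iff_ne_zero.2 hX0))
  filter_upwards [hmono, eventually_enorm_integral_spow_mul_le E W (fun k => fnD2_sub (v k) v₀)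
    (memLp_fnD2 v₀) hψt hψa h𝒰 hX0 hψw] with k hk1 hk2
  refine (enorm_integral_spow_sub_mul_le E.conj (memLp_weakLaplacian_fnD2 (v k))
    (memLp_weakLaplacian_fnD2 v₀) (hvL k) hv₀L ENNReal.toReal_nonneg hC hCσ hψt hψ0 hK.measurableSet
    hU hψK hH hh).trans (le_trans ?_ hτ')
  rw [mul_assoc, ENNReal.ofReal_toReal hσt]
  gcongr
  have h3 : (3 : ENNReal) * τ' = τ' + τ' + τ' := by ring
  rw [h3]
  refine add_le_add (add_le_add hσ (le_trans ?_ hX)) (le_trans ?_ hη)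
  · rw [mul_assoc]
    gcongr
    have h4 : (c * 3 + 1) * X = X + c * (X + X + X) := by ring
    rw [h4]
    refine le_trans ?_ (add_le_add hk1 (hk2.trans (by gcongr)))
    refine le_trans (le_of_eq ?_) (enorm_add_le _ _)
    rw [sub_add_cancel]
  · gcongr

theorem isInvariantSet_tsupport {G : Subgroup (Matrix.orthogonalGroup (Fin N) ℝ)} {φ : G →* ℤˣ}
    {Θ : Set (Space N)} (hη : IsEquivariantTestFunction φ Θ η) :
    IsInvariantSet G (tsupport η) := fun g hg => by
  have hmaps : Set.MapsTo (actIsometry g) (Function.support η) (Function.support η) :=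
    fun x hx => by
      have hxΘ : x ∈ Θ := hη.1.2.2 (subset_tsupport η hx)
      rw [Function.mem_support] at hx ⊢
      rw [actIsometry_apply, hη.2 ⟨g, hg⟩ x hxΘ]
      exact mul_ne_zero (by simp) hx
  exact hmaps.closure (actIsometry g).continuous

end Derivative

section Conclusion

variable {N : ℕ} {p q r : ℝ}

theorem criticalExponents_of_hyperbola (hN : 3 ≤ N) (hp : 0 < p) (hq : 0 < q)
    (hpq : 1 / p + 1 / q = ((N : ℝ) - 2) / N) : CriticalExponents N p q (q / (q - 1)) := by
  have hN' : (3 : ℝ) ≤ N := by exact_mod_cast hN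
  have h1 : ((N : ℝ) - 2) / N < 1 := by
    rw [div_lt_one (by linarith)]
    linarith
  have h2 : 0 < 1 / p := one_div_pos.2 hp
  have hq1 : 1 < q := by
    have h3 : 1 / q < 1 := by linarith
    rwa [div_lt_one hq] at h3
  exact ⟨hN, hp, (Real.HolderConjugate.conjExponent hq1).symm, hpq⟩

theorem derivJ_eq_of_isTest {u η : Space N → ℝ} (hη : IsTest η) : derivJ p r u η =
    (∫ x, spow r (weakLaplacian u x) * lap η x) - ∫ x, spow p (u x) * η x := by
  rw [derivJ]
  congr 1
  refine integral_congr_ae ?_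
  filter_upwards [weakLaplacian_of_contDiff hη.1] with x hx
  rw [hx]
  rfl

theorem integral_spow_sub_mul (h : r.HolderConjugate q) {f g η : Space N → ℝ}
    (hf : MemLp f (ENNReal.ofReal r) volume) (hg : MemLp g (ENNReal.ofReal r) volume)
    (hη : IsTest η) : ∫ x, (spow r (f x) - spow r (g x)) * η x =
      (∫ x, spow r (f x) * η x) - ∫ x, spow r (g x) * η x := by
  have hη' := hη.memLp (s := ENNReal.ofReal r)
  rw [← integral_sub (integrable_mul_of_memLp h.symm (memLp_spow h hf) hη')
    (integrable_mul_of_memLp h.symm (memLp_spow h hg) hη')]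
  simp only [sub_mul]

end Conclusion

end LaneEmden

theorem propositionA1 (N : ℕ) (hN : 3 ≤ N) (p q : ℝ) (hp : 0 < p) (hq : 0 < q)
    (hpq : 1 / p + 1 / q = ((N : ℝ) - 2) / N)
    (G : Subgroup (Matrix.orthogonalGroup (Fin N) ℝ))
    (hG : IsClosed (G : Set (Matrix.orthogonalGroup (Fin N) ℝ)))
    (φ : G →* ℤˣ) (hφ : Continuous φ)
    (Θ : Set (LaneEmden.Space N)) (hΘ : IsOpen Θ) (hΘG : LaneEmden.IsInvariantSet G Θ)
    (v : ℕ → LaneEmden.D2 N p (q / (q - 1))) (v₀ : LaneEmden.D2 N p (q / (q - 1)))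
    (hv : ∀ k, LaneEmden.IsEquivariantD2 φ (v k)) (hv₀ : LaneEmden.IsEquivariantD2 φ v₀)
    (hweak : LaneEmden.WeaklyConverges v v₀)
    (h₁ : ∀ η, LaneEmden.IsEquivariantTestFunction φ Θ η →
      Tendsto (fun k => LaneEmden.derivJ p (q / (q - 1)) (LaneEmden.fnD2 (v k)) η) atTop (𝓝 0))
    (h₂ : ∀ ψ, LaneEmden.IsInvariantTestFunction G Θ ψ →
      Tendsto (fun k => LaneEmden.derivJ p (q / (q - 1)) (LaneEmden.fnD2 (v k))
        (fun x => ψ x * LaneEmden.fnD2 (v k - v₀) x)) atTop (𝓝 0)) :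
    ∀ η, LaneEmden.IsEquivariantTestFunction φ Θ η →
      LaneEmden.derivJ p (q / (q - 1)) (LaneEmden.fnD2 v₀) η = 0 := by
  intro η hη
  have E := LaneEmden.criticalExponents_of_hyperbola hN hp hq hpq
  obtain ⟨L, W, hvL, hv₀L⟩ := hweak.exists_weaklyNull E
  have ht : LaneEmden.IsTest η := ⟨hη.1.1, hη.1.2.1⟩
  -- all limits are taken along one fixed free ultrafilter
  have h𝒰 : (hyperfilter ℕ : Filter ℕ) ≤ atTop := Nat.hyperfilter_le_atTop
  obtain ⟨H, hH⟩ := ht.lap.continuous.bounded_above_of_compact_support ht.lap.2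
  have hΔ := LaneEmden.tendsto_integral_spow_weakLaplacian E hΘ hv hv₀ W hvL hv₀L h₂ h𝒰 hH
    ((subset_tsupport _).trans (LaneEmden.support_lap_subset η)) ht.2 hη.1.2.2
    (LaneEmden.isInvariantSet_tsupport hη)
  have hcrit := (LaneEmden.tendsto_integral_spow_sub_mul E W
    (fun k => LaneEmden.fnD2_sub (v k) v₀) (fun k => LaneEmden.memLp_fnD2 (v k))
    (LaneEmden.memLp_fnD2 v₀) ht).mono_left h𝒰
  have hlim := ((h₁ η hη).mono_left h𝒰).sub (hΔ.sub hcrit)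
  simp only [sub_zero] at hlim
  refine tendsto_nhds_unique (tendsto_const_nhds.congr fun k => ?_) hlim
  rw [LaneEmden.derivJ_eq_of_isTest ht, LaneEmden.derivJ_eq_of_isTest ht,
    LaneEmden.integral_spow_sub_mul E.conj (LaneEmden.memLp_weakLaplacian_fnD2 (v k))
      (LaneEmden.memLp_weakLaplacian_fnD2 v₀) ht.lap,
    LaneEmden.integral_spow_sub_mul (Real.HolderConjugate.conjExponent E.one_lt_p)
      (LaneEmden.memLp_fnD2 (v k)) (LaneEmden.memLp_fnD2 v₀) ht]
  ring
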